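/- **Setting.** All fields and kernels in the time domain are real-valued. Let $\varepsilon,\mu$ be two real symmetric $3\times3$ matrix fields on $\mathbb R^3$, measurable and uniformly elliptic (there are $0<\alpha\le\beta$ with $\alpha|\xi|^2\le \varepsilon(x)\xi\cdot\xi\le\beta|\xi|^2$ and the same for $\mu$, for all $\xi\in\mathbb R^3$ and a.e. $x$). Put $M=\begin{bmatrix}\varepsilon&0\\0&\mu\end{bmatrix}$, $\mathcal H=L^2(\mathbb R^3)^3\times L^2(\mathbb R^3)^3$, $\mathcal V=H_{\mathrm{curl}}(\mathbb R^3)\times H_{\mathrm{curl}}(\mathbb R^3)$, and $\mathbb A(E,H)=(\operatorname{curl}H,-\operatorname{curl}E)$. Let $\Lambda=(\Lambda_{ij})$ be a $6\times6$ matrix of kernels $\Lambda_{ij}\in L^1_{loc}(\mathbb R;L^\infty(\mathbb R^3))$ whose temporal Fourier transforms, in the sense of tempered distributions, normalized by $\widehat\Lambda(\omega,x)=\frac1{\sqrt{2\pi}}\int_{\mathbb R}\Lambda(t,x)e^{i\omega t}\,dt$, also belong to $L^1_{loc}(\mathbb R;L^\infty(\mathbb R^3))$ (with complex values). Assume causality,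 $\Lambda(t)=0$ for a.e. $t<0$, and passivity, $\operatorname{Re}\big(\widehat\Lambda(\omega,x)X\cdot\overline X\big)\ge0$ for a.e. $\omega$, a.e. $x$ and all $X\in\mathbb C^6$. Write $(\Lambda\star u)(t)=\int_0^t\Lambda(t-\tau)u(\tau)\,d\tau$. For $T>0$, $u_0\in\mathcal H$ and $f\in L^1(0,T;\mathcal H)$, a weak solution on $(0,T)$ of $$M\partial_t u+\Lambda\star u=\mathbb A u+f,\qquad u(0)=u_0,$$ is a function $u\in L^\infty(0,T;\mathcal H)$ such that, for all $v\in\mathcal V$, $$\frac{d}{dt}\langle Mu(t),v\rangle_{\mathcal H}+\langle(\Lambda\star u)(t),v\rangle_{\mathcal H}=\langle u(t),\mathbb A v\rangle_{\mathcal H}+\langle f(t),v\rangle_{\mathcal H}$$ in the sense of distributions on $(0,T)$, and such that the continuous representative on $[0,T]$ of $t\mapsto\langle Mu(t),v\rangle_{\mathcal H}$ equals $\langle Mu_0,v\rangle_{\mathcal H}$ at $t=0$. For $R>0$ and $a\in\mathbb R^3$ let $B(a,R)$ be the open ball of radius $R$ centred at $a$, and let $$c_{a,R}=\operatorname*{ess\,sup}_{x\in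 B(a,R)}\gamma_e(x)\gamma_m(x),$$ where $\gamma_e(x),\gamma_m(x)$ are the largest eigenvalues of $\varepsilon(x)^{-1/2}$ and $\mu(x)^{-1/2}$. **Theorem 2.** Let $R>0$, $a\in\mathbb R^3$, $T>R/c_{a,R}$, $u_0\in\mathcal H$ and $f\in L^1(0,T;\mathcal H)$. Suppose that $u_0=0$ a.e. on $B(a,R)$ and that, for a.e. $t\in(0,R/c_{a,R})$, $f(t,\cdot)=0$ a.e. on $B(a,R-c_{a,R}t)$. Let $u$ be the weak solution on $(0,T)$. Then, for a.e. $t\in(0,R/c_{a,R})$, $u(t,\cdot)=0$ a.e. on $B(a,R-c_{a,R}t)$. -/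

import Mathlib

open MeasureTheory Set
open scoped ENNReal ContDiff SchwartzMap

noncomputable section

namespace Maxwell

/-- Physical space `ℝ³`. -/
abbrev Space : Type := EuclideanSpace ℝ (Fin 3)

/-- Indices of the six components of an electromagnetic field: `Sum.inl` for the three electric
components, `Sum.inr` for the three magnetic ones. -/
abbrev Idx : Type := Fin 3 ⊕ Fin 3

/-- The scalar space `L²(ℝ³)` (real-valued). -/
abbrev ScalarL2 : Type := Lp ℝ 2 (volume : Measure Space)

/-- `L^∞(ℝ³)`, real-valued. -/
abbrev RealLinf : Type := Lp ℝ ⊤ (volume : Measure Space)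

/-- `L^∞(ℝ³)`, complex-valued. -/
abbrev ComplexLinf : Type := Lp ℂ ⊤ (volume : Measure Space)

/-- The Hilbert space `L²(ℝ³)³ × L²(ℝ³)³`, as six components with the sum of the six scalar
`L²` inner products. -/
abbrev FieldSpace : Type := PiLp 2 (fun _ : Idx => ScalarL2)

/-- The three electric components of a field. -/
def electric (u : FieldSpace) : Fin 3 → ScalarL2 := fun i => u (Sum.inl i)

/-- The three magnetic components of a field. -/
def magnetic (u : FieldSpace) : Fin 3 → ScalarL2 := fun i => u (Sum.inr i)

/-! ### Material coefficients -/

/-- A `3 × 3` real symmetric uniformly elliptic matrix field on `ℝ³` (measurable, bounded below and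
above). -/
structure IsUniformlyElliptic (A : Space → Matrix (Fin 3) (Fin 3) ℝ) : Prop where
  aemeasurable : ∀ i j, AEMeasurable (fun x => A x i j) volume
  symm : ∀ᵐ x : Space, (A x).IsSymm
  elliptic : ∃ α β : ℝ, 0 < α ∧ ∀ᵐ x : Space, ∀ ξ : Fin 3 → ℝ,
    α * (ξ ⬝ᵥ ξ) ≤ ξ ⬝ᵥ (A x).mulVec ξ ∧ ξ ⬝ᵥ (A x).mulVec ξ ≤ β * (ξ ⬝ᵥ ξ)

/-- `A^{-1/2}` for a symmetric positive definite matrix `A`, by the functional calculus. -/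
def invSqrt (A : Matrix (Fin 3) (Fin 3) ℝ) : Matrix (Fin 3) (Fin 3) ℝ :=
  cfc (fun s : ℝ => s ^ (-(1 / 2) : ℝ)) A

/-- The largest (real) eigenvalue of a matrix. -/
def maxEigenvalue (A : Matrix (Fin 3) (Fin 3) ℝ) : ℝ :=
  sSup {k : ℝ | Module.End.HasEigenvalue (Matrix.toLin' A) k}

/-- The local speed `c(x)`: the product of the largest eigenvalues of `ε(x)^{-1/2}` and
`μ(x)^{-1/2}`. -/
def localSpeed (ε μ : Space → Matrix (Fin 3) (Fin 3) ℝ) (x : Space) : ℝ :=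
  maxEigenvalue (invSqrt (ε x)) * maxEigenvalue (invSqrt (μ x))

/-- The speed `c_{a,R}`: the essential supremum of `c` over the ball `B(a,R)`. -/
def speed (ε μ : Space → Matrix (Fin 3) (Fin 3) ℝ) (a : Space) (R : ℝ) : ℝ :=
  essSup (localSpeed ε μ) (volume.restrict (Metric.ball a R))

/-- `⟨M u, v⟩` in `L²(ℝ³)⁶`, with `M(x)` the block diagonal matrix of `ε(x)` and `μ(x)`. -/
def massForm (ε μ : Space → Matrix (Fin 3) (Fin 3) ℝ) (u v : FieldSpace) : ℝ :=
  ∫ x : Space, (Matrix.fromBlocks (ε x) 0 0 (μ x)).mulVec (fun i => u i x) ⬝ᵥ (fun i => v i x)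

/-! ### The Maxwell operator -/

/-- The `j`-th partial derivative of the `i`-th component of a vector field. -/
def partialDeriv (φ : Space → Space) (j i : Fin 3) (x : Space) : ℝ :=
  fderiv ℝ φ x (EuclideanSpace.single j 1) i

/-- The classical curl of a vector field on `ℝ³`. -/
def curl (φ : Space → Space) (x : Space) : Fin 3 → ℝ :=
  ![partialDeriv φ 1 2 x - partialDeriv φ 2 1 x,
    partialDeriv φ 2 0 x - partialDeriv φ 0 2 x,
    partialDeriv φ 0 1 x - partialDeriv φ 1 0 x]

/-- The vector field `w ∈ L²(ℝ³)³` belongs to `H_curl(ℝ³)` and `g ∈ L²(ℝ³)³` is its weak curl. -/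
def HasWeakCurl (w g : Fin 3 → ScalarL2) : Prop :=
  ∀ φ : Space → Space, ContDiff ℝ ∞ φ → HasCompactSupport φ →
    ∫ x : Space, (fun i => w i x) ⬝ᵥ curl φ x = ∫ x : Space, (fun i => g i x) ⬝ᵥ (φ x).ofLp

/-- The field `v = (E, H)` belongs to `H_curl(ℝ³) × H_curl(ℝ³)` and `g` is its image
`(curl H, -curl E)` under the Maxwell operator. -/
def HasMaxwell (v g : FieldSpace) : Prop :=
  HasWeakCurl (magnetic v) (electric g) ∧ HasWeakCurl (electric v) (-magnetic g)

/-! ### The memory kernel -/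

/-- A function `ℝ → L^∞(ℝ³)` seen with complex values. -/
def complexify (l : ℝ → RealLinf) : ℝ → ComplexLinf :=
  fun t => Complex.ofRealCLM.compLpL ⊤ (volume : Measure Space) (l t)

/-- The locally integrable function `m` of the frequency is the temporal Fourier transform,
in the sense of tempered distributions with values in `L^∞(ℝ³)`, of the locally integrable function
`l` of time, with the normalization `m(w) = (2π)^{-1/2} ∫ l(t) e^{iwt} dt`. That is: there is a
tempered distribution `S` which is given by `l`, and whose Fourier transform `φ ↦ S (φ^)` is given
by `m`, on compactly supported test functions. -/
def IsFourierTransform (l m : ℝ → ComplexLinf) : Prop :=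
  ∃ S : 𝓢(ℝ, ℂ) →L[ℂ] ComplexLinf,
    (∀ φ : 𝓢(ℝ, ℂ), HasCompactSupport φ → S φ = ∫ t : ℝ, φ t • l t) ∧
    (∀ φ ψ : 𝓢(ℝ, ℂ), HasCompactSupport φ →
      (∀ t : ℝ, ψ t = ((1 / Real.sqrt (2 * Real.pi) : ℝ) : ℂ) *
        ∫ w : ℝ, φ w * Complex.exp (Complex.I * w * t)) →
      S ψ = ∫ w : ℝ, φ w • m w)

/-- Passivity of the frequency-domain kernel:
`Re (Λ^(w,x) X · conj X) ≥ 0` for almost every `w` and `x` and all `X ∈ ℂ⁶`. -/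
def IsPassive (Λhat : Idx → Idx → ℝ → ComplexLinf) : Prop :=
  ∀ᵐ w : ℝ, ∀ᵐ x : Space, ∀ X : Idx → ℂ,
    0 ≤ (∑ i, (∑ j, Λhat i j w x * X j) * (starRingEnd ℂ) (X i)).re

/-- Causality: the kernel vanishes at negative times. -/
def IsCausal (Λ : Idx → Idx → ℝ → RealLinf) : Prop :=
  ∀ i j, ∀ᵐ t : ℝ, t < 0 → Λ i j t = 0

/-- The truncated time convolution `(Λ ⋆ u)(t) = ∫₀ᵗ Λ(t - τ) u(τ) dτ`; the product inside the
integral is the pointwise product `L^∞(ℝ³) × L²(ℝ³) → L²(ℝ³)`. -/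
def memory (Λ : Idx → Idx → ℝ → RealLinf) (u : ℝ → FieldSpace) (t : ℝ) : FieldSpace :=
  WithLp.toLp 2 (fun i => ∑ j, ∫ τ in (0 : ℝ)..t, (Λ i j (t - τ) • u τ j : ScalarL2))

/-! ### Weak solutions -/

/-- `u ∈ L^∞(0,T; L²(ℝ³)⁶)` is a weak solution on `(0,T)` of
`M ∂ₜu + Λ ⋆ u = 𝔸 u + f`, `u(0) = u₀`. The equation tested with `v` holds in the sense of
distributions on `(0,T)`, and the continuous representative on `[0,T]` of `t ↦ ⟨M u(t), v⟩`
takes the value `⟨M u₀, v⟩` at `0`. -/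
structure IsWeakSolution (ε μ : Space → Matrix (Fin 3) (Fin 3) ℝ)
    (Λ : Idx → Idx → ℝ → RealLinf) (T : ℝ) (u₀ : FieldSpace) (f u : ℝ → FieldSpace) : Prop where
  memLp : MemLp u ⊤ (volume.restrict (Ioo 0 T))
  equation : ∀ v Av : FieldSpace, HasMaxwell v Av →
    ∀ φ : ℝ → ℝ, ContDiff ℝ ∞ φ → HasCompactSupport φ → tsupport φ ⊆ Ioo 0 T →
      -(∫ t in Ioo 0 T, deriv φ t * massForm ε μ (u t) v)
          + ∫ t in Ioo 0 T, φ t * inner ℝ (memory Λ u t) v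
        = (∫ t in Ioo 0 T, φ t * inner ℝ (u t) Av) + ∫ t in Ioo 0 T, φ t * inner ℝ (f t) v
  initial : ∀ v Av : FieldSpace, HasMaxwell v Av →
    ∃ g : ℝ → ℝ, ContinuousOn g (Icc 0 T) ∧
      (∀ᵐ t ∂(volume.restrict (Ioo 0 T)), g t = massForm ε μ (u t) v) ∧
      g 0 = massForm ε μ u₀ v

/-- The field `w` vanishes almost everywhere on the open ball `B(a,r)`, i.e. its (essential)
support does not meet `B(a,r)`. -/
def VanishesOnBall (w : FieldSpace) (a : Space) (r : ℝ) : Prop :=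
  ∀ᵐ x ∂(volume.restrict (Metric.ball a r)), ∀ i, w i x = 0

end Maxwell

end

open Maxwell

/-!
Finite speed of propagation by a local energy estimate, with weights `exp (l (R - |x - a|))` whose
rate `l` tends to infinity.

A weak solution `u` is too rough in time to be tested with itself, but its second primitive `W` is
not. Write `U` for the first primitive. Integrating the equation twice in time gives, at every time
`t` and for every `v` in the domain of the Maxwell operator `𝔸`,
`⟨M U + Λ ⋆ W - G, v⟩ = ⟨W, 𝔸 v⟩`, where `G` is built from `u₀` and the second primitive of `f`
(`IsWeakSolution.integrated_twice`). Hence `W t` itself belongs to that domain, with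
`𝔸 W = -(M U + Λ ⋆ W - G)`, and so does `ψ W` for a smooth compactly supported weight `ψ` in space.
As `𝔸` is skew-symmetric, testing with `ψ W` leaves only the commutator of `𝔸` with `ψ`, that is
`⟨M U + Λ ⋆ W - G, ψ W⟩ = ∫ E · (∇ψ × H)` with `W = (E, H)`
(`inner_scalarOp_eq_integral_fluxDensity`). The right-hand side is at most half of
`∫ |∇ψ| c (M W · W)`, by the definition of the speed `c` (`abs_fluxDensity_le`).

Let `D t = ⟨M W, ψ W⟩ / 2 + ∫₀ᵗ ⟨Λ ⋆ W, ψ W⟩`. The second term is nonnegative by passivity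
(`integral_inner_memoryKernel_weight_nonneg`): `ψ` is a square, which commutes with the convolution
in time, and the quadratic form of the kernel is, on the frequency side, the integral of a
nonnegative function. As the Fourier transform of `Λ` is only a locally integrable function, that
function is first truncated in frequency (`sum_integral_correlation_nonneg`), for sums of test
functions of time with values in `L²`, and these are dense enough by Bernstein approximation
(`integral_inner_kernel_nonneg`). With `|∇ψ| ≤ l (ψ + C)`, and because `ψ ≤ exp (l c t)` outside the
ball `B(a, R - c t)` where `G t` vanishes, one gets `D' ≤ l c D + (A + l B) exp (l c t)`, and
therefore `D t ≤ t (A + l B) exp (l c t)` (`energy_le`). Where `|x - a| < R - c t - η` the weight is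
at least `exp (l (c t + η))`, so `l → ∞` forces `W t` to vanish there
(`vanishesOnBall_of_weighted_energy_le`). Differentiating twice in time gives the result for `u`.
-/

noncomputable section

namespace Maxwell

open Filter Topology

/-! ### Distributional differential equations on an interval -/

theorem exists_primitive_of_integral_eq_zero {T : ℝ} {χ : ℝ → ℝ} (hχ : ContDiff ℝ ∞ χ)
    (hc : HasCompactSupport χ) (hs : tsupport χ ⊆ Ioo 0 T) (h0 : ∫ t, χ t = 0) :
    ∃ φ : ℝ → ℝ, ContDiff ℝ ∞ φ ∧ HasCompactSupport φ ∧ tsupport φ ⊆ Ioo 0 T ∧ deriv φ = χ := by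
  obtain ⟨a, b, ha, hb, hab⟩ : ∃ a b, 0 < a ∧ b < T ∧ tsupport χ ⊆ Icc a b := by
    rcases (tsupport χ).eq_empty_or_nonempty with he | hne
    · exact ⟨1, T - 1, by norm_num, by linarith, by simp [he]⟩
    · obtain ⟨a, ha⟩ := hc.isCompact.exists_isLeast hne
      obtain ⟨b, hb⟩ := hc.isCompact.exists_isGreatest hne
      exact ⟨a, b, (hs ha.1).1, (hs hb.1).2, fun x hx => ⟨ha.2 hx, hb.2 hx⟩⟩
  have hzero : ∀ t, t ∉ Icc a b → χ t = 0 := fun t ht =>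
    image_eq_zero_of_notMem_tsupport fun h => ht (hab h)
  have hint : Integrable χ := hχ.continuous.integrable_of_hasCompactSupport hc
  have hder : ∀ t, HasDerivAt (fun t => ∫ s in a..t, χ s) (χ t) t := fun t =>
    intervalIntegral.integral_hasDerivAt_right hint.intervalIntegrable
      (hχ.continuous.stronglyMeasurableAtFilter _ _) hχ.continuous.continuousAt
  have hout : ∀ t, t ∉ Icc a b → ∫ s in a..t, χ s = 0 := by
    intro t ht
    rcases lt_or_ge t a with h | h
    · rw [intervalIntegral.integral_symm, neg_eq_zero]
      apply intervalIntegral.integral_zero_ae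
      filter_upwards [Measure.ae_ne volume a] with s hs' hs
      rw [uIoc_of_le h.le] at hs
      exact hzero s fun h' => hs' (le_antisymm hs.2 h'.1)
    · have hbt : b < t := by
        by_contra hc'
        exact ht ⟨h, not_lt.1 hc'⟩
      rw [intervalIntegral.integral_of_le h, ← integral_indicator measurableSet_Ioc, ← h0]
      apply integral_congr_ae
      filter_upwards [Measure.ae_ne volume a] with s hs'
      by_cases hs : s ∈ Ioc a t
      · rw [indicator_of_mem hs]
      · rw [indicator_of_notMem hs, hzero s]
        intro h'
        exact hs ⟨lt_of_le_of_ne h'.1 (Ne.symm hs'), h'.2.trans hbt.le⟩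
  have hsub : tsupport (fun t => ∫ s in a..t, χ s) ⊆ Icc a b :=
    closure_minimal (fun t ht => by by_contra h; exact ht (hout t h)) isClosed_Icc
  have hd : deriv (fun t => ∫ s in a..t, χ s) = χ := funext fun t => (hder t).deriv
  refine ⟨fun t => ∫ s in a..t, χ s, ?_, ?_, ?_, hd⟩
  · rw [contDiff_infty_iff_deriv]
    exact ⟨fun t => (hder t).differentiableAt, by rw [hd]; exact hχ⟩
  · exact isCompact_Icc.of_isClosed_subset (isClosed_tsupport _) hsub
  · exact hsub.trans fun t ht => ⟨ha.trans_le ht.1, ht.2.trans_lt hb⟩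

/-- The lemma of du Bois-Reymond: a function with zero distributional derivative is constant. -/
theorem ae_eq_const_of_integral_deriv_mul_eq_zero {T : ℝ} (hT : 0 < T) {p : ℝ → ℝ}
    (hp : IntegrableOn p (Ioo 0 T))
    (h : ∀ φ : ℝ → ℝ, ContDiff ℝ ∞ φ → HasCompactSupport φ → tsupport φ ⊆ Ioo 0 T →
      ∫ t in Ioo 0 T, deriv φ t * p t = 0) :
    ∃ c, ∀ᵐ t ∂(volume.restrict (Ioo 0 T)), p t = c := by
  -- a test function of integral one, used to correct the integral of any other test function
  let b : ContDiffBump (T / 2) := ⟨T / 8, T / 4, by linarith, by linarith⟩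
  let ψ₀ : ℝ → ℝ := b.normed volume
  have hψ₀ : ContDiff ℝ ∞ ψ₀ := b.contDiff_normed
  have hψ₀c : HasCompactSupport ψ₀ := b.hasCompactSupport_normed
  have hψ₀s : tsupport ψ₀ ⊆ Ioo 0 T := by
    rw [b.tsupport_normed_eq, Real.closedBall_eq_Icc]
    intro x hx
    simp only [b, mem_Icc, mem_Ioo] at hx ⊢
    constructor <;> linarith [hx.1, hx.2]
  have hψ₀i : ∫ t, ψ₀ t = 1 := b.integral_normed
  have hmul : ∀ g : ℝ → ℝ, ContDiff ℝ ∞ g → HasCompactSupport g →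
      Integrable (fun t => g t * p t) (volume.restrict (Ioo 0 T)) := by
    intro g hg hgc
    obtain ⟨C, hC⟩ := hg.continuous.bounded_above_of_compact_support hgc
    exact hp.bdd_mul hg.continuous.aestronglyMeasurable (Eventually.of_forall hC)
  refine ⟨∫ t in Ioo 0 T, ψ₀ t * p t, ?_⟩
  set c := ∫ t in Ioo 0 T, ψ₀ t * p t with hc
  have key : ∀ᵐ t : ℝ, t ∈ Ioo 0 T → p t - c = 0 := by
    apply isOpen_Ioo.ae_eq_zero_of_integral_contDiff_smul_eq_zero
    · exact (hp.sub (integrableOn_const (by simp))).locallyIntegrableOn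
    · intro g hg hgc hgs
      set m := ∫ t, g t with hm
      have hgi : Integrable g := hg.continuous.integrable_of_hasCompactSupport hgc
      have hψi : Integrable ψ₀ := hψ₀.continuous.integrable_of_hasCompactSupport hψ₀c
      obtain ⟨φ, h1, h2, h3, h4⟩ := exists_primitive_of_integral_eq_zero (T := T)
        (χ := fun t => g t - m * ψ₀ t) (hg.sub (contDiff_const.mul hψ₀))
        (hgc.sub (hψ₀c.mul_left (f := fun _ => m)))
        ((tsupport_sub g (fun t => m * ψ₀ t)).trans (union_subset hgs
          ((closure_mono (fun t ht => by
            intro h0; apply ht; simp [h0])).trans hψ₀s)))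
        (by rw [integral_sub hgi (hψi.const_mul m), integral_const_mul, hψ₀i, mul_one, sub_self])
      have h5 := h φ h1 h2 h3
      rw [h4] at h5
      have e1 : ∫ t in Ioo 0 T, (g t - m * ψ₀ t) * p t
          = (∫ t in Ioo 0 T, g t * p t) - m * c := by
        rw [hc, ← integral_const_mul, ← integral_sub (hmul g hg hgc) ((hmul ψ₀ hψ₀ hψ₀c).const_mul m)]
        congr 1; ext t; ring
      have e2 : ∫ t, g t • (p t - c) = ∫ t in Ioo 0 T, g t * (p t - c) := by
        rw [← integral_indicator measurableSet_Ioo]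
        congr 1; ext t
        by_cases ht : t ∈ Ioo 0 T
        · simp [ht]
        · simp [ht, image_eq_zero_of_notMem_tsupport fun h' => ht (hgs h')]
      have e3 : ∫ t in Ioo 0 T, g t = m := by
        rw [hm, ← integral_indicator measurableSet_Ioo]
        congr 1; ext t
        by_cases ht : t ∈ Ioo 0 T
        · simp [ht]
        · simp [ht, image_eq_zero_of_notMem_tsupport fun h' => ht (hgs h')]
      rw [e2]
      have e4 : ∫ t in Ioo 0 T, g t * (p t - c)
          = (∫ t in Ioo 0 T, g t * p t) - (∫ t in Ioo 0 T, g t) * c := by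
        rw [← integral_mul_const, ← integral_sub (hmul g hg hgc) (hgi.integrableOn.mul_const c)]
        congr 1; ext t; ring
      rw [e4, e3, ← e1, h5]
  rw [ae_restrict_iff' measurableSet_Ioo]
  filter_upwards [key] with t ht h' using sub_eq_zero.1 (ht h')

/-- Integration by parts against a test function; the primitive of `k` is only absolutely
continuous. -/
theorem integral_mul_eq_neg_integral_deriv_mul_primitive {T : ℝ} (hT : 0 < T) {k φ : ℝ → ℝ}
    (hk : IntegrableOn k (Ioo 0 T)) (hφ : ContDiff ℝ ∞ φ) (hs : tsupport φ ⊆ Ioo 0 T) :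
    ∫ t in Ioo 0 T, φ t * k t = -∫ t in Ioo 0 T, deriv φ t * ∫ s in (0 : ℝ)..t, k s := by
  have hkI : IntervalIntegrable k volume 0 T := by
    rwa [intervalIntegrable_iff_integrableOn_Ioo_of_le hT.le]
  have hac := hkI.absolutelyContinuousOnInterval_intervalIntegral (c := 0) (by simp)
  have hφac : AbsolutelyContinuousOnInterval φ 0 T := by
    obtain ⟨K, hK⟩ := hφ.contDiffOn.exists_lipschitzOnWith (by simp) (convex_uIcc 0 T) isCompact_uIcc
    exact hK.absolutelyContinuousOnInterval
  have h := hφac.integral_mul_deriv_eq_deriv_mul hac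
  have h0 : φ 0 = 0 := image_eq_zero_of_notMem_tsupport fun h => lt_irrefl _ (hs h).1
  have h1 : φ T = 0 := image_eq_zero_of_notMem_tsupport fun h => lt_irrefl _ (hs h).2
  rw [h0, h1, zero_mul, zero_mul, sub_self, zero_sub] at h
  rw [← integral_Ioc_eq_integral_Ioo, ← integral_Ioc_eq_integral_Ioo,
    ← intervalIntegral.integral_of_le hT.le, ← intervalIntegral.integral_of_le hT.le, ← h]
  apply intervalIntegral.integral_congr_ae
  filter_upwards [hkI.ae_hasDerivAt_integral] with t ht htm
  rw [(ht (uIoc_subset_uIcc htm) 0 (by simp)).deriv]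

/-- A continuous function whose distributional derivative on `(0,T)` is the integrable function `k`
is a primitive of `k`. -/
theorem eq_add_integral_of_distributional_deriv {T : ℝ} (hT : 0 < T) {p g k : ℝ → ℝ}
    (hk : IntegrableOn k (Ioo 0 T)) (hg : ContinuousOn g (Icc 0 T))
    (hgp : ∀ᵐ t ∂(volume.restrict (Ioo 0 T)), g t = p t)
    (h : ∀ φ : ℝ → ℝ, ContDiff ℝ ∞ φ → HasCompactSupport φ → tsupport φ ⊆ Ioo 0 T →
      (∫ t in Ioo 0 T, deriv φ t * p t) + ∫ t in Ioo 0 T, φ t * k t = 0) :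
    ∀ t ∈ Icc 0 T, g t = g 0 + ∫ s in (0 : ℝ)..t, k s := by
  have hkI : IntervalIntegrable k volume 0 T := by
    rwa [intervalIntegrable_iff_integrableOn_Ioo_of_le hT.le]
  have hprim : ContinuousOn (fun t => ∫ s in (0 : ℝ)..t, k s) (Icc 0 T) := by
    have := intervalIntegral.continuousOn_primitive_interval'
      (μ := volume) (f := k) (a := 0) (b₁ := 0) (b₂ := T) hkI (by simp)
    rwa [uIcc_of_le hT.le] at this
  have hgK : IntegrableOn g (Ioo 0 T) :=
    (hg.integrableOn_compact isCompact_Icc).mono_set Ioo_subset_Icc_self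
  have hKi : IntegrableOn (fun t => ∫ s in (0 : ℝ)..t, k s) (Ioo 0 T) :=
    (hprim.integrableOn_compact isCompact_Icc).mono_set Ioo_subset_Icc_self
  have hmul : ∀ φ : ℝ → ℝ, ContDiff ℝ ∞ φ → HasCompactSupport φ → ∀ q : ℝ → ℝ,
      IntegrableOn q (Ioo 0 T) → IntegrableOn (fun t => deriv φ t * q t) (Ioo 0 T) := by
    intro φ hφ hφc q hq
    have hd : Continuous (deriv φ) := hφ.continuous_deriv (by simp)
    obtain ⟨C, hC⟩ := hd.bounded_above_of_compact_support hφc.deriv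
    exact hq.bdd_mul hd.aestronglyMeasurable (Eventually.of_forall hC)
  obtain ⟨c, hc⟩ := ae_eq_const_of_integral_deriv_mul_eq_zero hT
    (p := fun t => g t - ∫ s in (0 : ℝ)..t, k s) (hgK.sub hKi) (by
      intro φ hφ hφc hφs
      have h1 := h φ hφ hφc hφs
      rw [integral_mul_eq_neg_integral_deriv_mul_primitive hT hk hφ hφs] at h1
      have h2 : ∫ t in Ioo 0 T, deriv φ t * p t = ∫ t in Ioo 0 T, deriv φ t * g t := by
        apply integral_congr_ae
        filter_upwards [hgp] with t ht
        rw [ht]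
      simp_rw [mul_sub]
      rw [integral_sub (hmul φ hφ hφc g hgK) (hmul φ hφ hφc _ hKi), ← h2]
      linarith)
  have heq : EqOn (fun t => g t - ∫ s in (0 : ℝ)..t, k s) (fun _ => c) (Icc 0 T) := by
    apply Measure.eqOn_Icc_of_ae_eq volume hT.ne _ (hg.sub hprim) continuousOn_const
    rw [← restrict_Ioo_eq_restrict_Icc]
    exact hc
  intro t ht
  have h0 := heq (left_mem_Icc.2 hT.le)
  have h1 := heq ht
  simp only [intervalIntegral.integral_same, sub_zero] at h0 h1
  rw [h0]; linarith

/-! ### Convolution in time -/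

section TimeConv

variable {H : Type*} [NormedAddCommGroup H] [NormedSpace ℝ H]

/-- The convolution `∫ K(τ) g(t - τ) dτ` of an operator-valued kernel with a function of time. -/
def timeConv (K : ℝ → H →L[ℝ] H) (g : ℝ → H) (t : ℝ) : H := ∫ τ, K τ (g (t - τ))

theorem timeConv_eq_convolution (K : ℝ → H →L[ℝ] H) (g : ℝ → H) :
    timeConv K g = convolution K g (ContinuousLinearMap.id ℝ (H →L[ℝ] H)) volume := rfl

theorem integrable_timeConv_integrand_prod {K : ℝ → H →L[ℝ] H} {g : ℝ → H} {C t : ℝ}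
    (hK : Integrable K) (hg : AEStronglyMeasurable g) (hC : ∀ᵐ t, ‖g t‖ ≤ C) :
    Integrable (fun z : ℝ × ℝ => K z.2 (g (z.1 - z.2)))
      ((volume.restrict (uIoc 0 t)).prod volume) := by
  have hm : AEStronglyMeasurable (fun z : ℝ × ℝ => K z.2 (g (z.1 - z.2))) (volume.prod volume) :=
    AEStronglyMeasurable.convolution_integrand (ContinuousLinearMap.id ℝ (H →L[ℝ] H))
      hK.aestronglyMeasurable hg
  have hle : (volume.restrict (uIoc 0 t)).prod (volume : Measure ℝ)
      ≤ (volume : Measure ℝ).prod volume := by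
    conv_lhs => rw [← Measure.restrict_univ (μ := (volume : Measure ℝ)), Measure.prod_restrict]
    rw [Measure.restrict_univ]
    exact Measure.restrict_le_self
  have hC' : ∀ᵐ z : ℝ × ℝ ∂(volume.prod volume), ‖g (z.1 - z.2)‖ ≤ C :=
    (quasiMeasurePreserving_sub volume volume).ae hC
  have hbound : Integrable (fun z : ℝ × ℝ => (1 : ℝ) * (‖K z.2‖ * C))
      ((volume.restrict (uIoc 0 t)).prod volume) := by
    apply Integrable.mul_prod (f := fun _ : ℝ => (1 : ℝ)) (g := fun s : ℝ => ‖K s‖ * C)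
    · exact integrableOn_const (by simp [uIoc])
    · exact hK.norm.mul_const C
  refine hbound.mono' (hm.mono_measure hle) ?_
  filter_upwards [ae_mono hle hC'] with z hz
  rw [one_mul]
  exact (ContinuousLinearMap.le_opNorm _ _).trans (by gcongr)

theorem intervalIntegrable_timeConv {K : ℝ → H →L[ℝ] H} {g : ℝ → H} {C : ℝ}
    (hK : Integrable K) (hg : AEStronglyMeasurable g) (hC : ∀ᵐ t, ‖g t‖ ≤ C) (t : ℝ) :
    IntervalIntegrable (timeConv K g) volume 0 t := by
  rw [intervalIntegrable_iff]
  exact (integrable_timeConv_integrand_prod hK hg hC).integral_prod_left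

/-- Convolution by a causal kernel commutes with taking the primitive in time. -/
theorem integral_timeConv [CompleteSpace H] {K : ℝ → H →L[ℝ] H} {g : ℝ → H} {C : ℝ}
    (hK : Integrable K) (hK0 : ∀ t < 0, K t = 0)
    (hg : AEStronglyMeasurable g) (hC : ∀ᵐ t, ‖g t‖ ≤ C) (hg0 : ∀ t ≤ 0, g t = 0) (t : ℝ) :
    ∫ r in (0 : ℝ)..t, timeConv K g r = timeConv K (fun s => ∫ r in (0 : ℝ)..s, g r) t := by
  have hgi : ∀ a b, IntervalIntegrable g volume a b := by
    intro a b
    refine (intervalIntegrable_const (c := C)).mono_fun' hg.restrict (ae_restrict_of_ae hC)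
  unfold timeConv
  rw [intervalIntegral_integral_swap (integrable_timeConv_integrand_prod hK hg hC)]
  congr 1; ext τ
  rcases lt_or_ge τ 0 with h | h
  · simp [hK0 τ h]
  have hz : ∫ r in (-τ)..0, g r = 0 := by
    apply intervalIntegral.integral_zero_ae
    filter_upwards with r hr
    rw [uIoc_of_le (by linarith)] at hr
    exact hg0 r hr.2
  rw [ContinuousLinearMap.intervalIntegral_comp_comm, intervalIntegral.integral_comp_sub_right,
    zero_sub, ← intervalIntegral.integral_add_adjacent_intervals (hgi (-τ) 0) (hgi 0 _), hz,
    zero_add]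
  simpa using (hgi (0 - τ) (t - τ)).comp_sub_right τ

theorem continuous_timeConv {K : ℝ → H →L[ℝ] H} {g : ℝ → H} {C : ℝ}
    (hK : Integrable K) (hg : Continuous g) (hC : ∀ t, ‖g t‖ ≤ C) :
    Continuous (timeConv K g) := by
  rw [timeConv_eq_convolution]
  refine BddAbove.continuous_convolution_right_of_integrable _ ⟨C, ?_⟩ hK hg
  rintro _ ⟨t, rfl⟩
  exact hC t

end TimeConv

/-! ### Multiplication operators on fields -/

/-- The product `L^∞(ℝ³) × L²(ℝ³) → L²(ℝ³)` as a continuous bilinear map. -/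
def linfMul : RealLinf →L[ℝ] ScalarL2 →L[ℝ] ScalarL2 :=
  (ContinuousLinearMap.lsmul ℝ ℝ).holderL volume ⊤ 2 2

theorem linfMul_apply (g : RealLinf) (w : ScalarL2) : linfMul g w = (g • w : ScalarL2) := by
  apply Lp.ext
  filter_upwards [(ContinuousLinearMap.lsmul ℝ ℝ).coeFn_holder (r := 2) g w,
    Lp.coeFn_lpSMul (r := 2) g w] with x h1 h2
  exact h1.trans h2.symm

/-- The inclusion of the `i`-th component. -/
def component (i : Idx) : ScalarL2 →L[ℝ] FieldSpace :=
  ((PiLp.continuousLinearEquiv 2 ℝ (fun _ : Idx => ScalarL2)).symm :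
    (Idx → ScalarL2) →L[ℝ] FieldSpace) ∘L ContinuousLinearMap.single ℝ (fun _ : Idx => ScalarL2) i

theorem component_apply (i j : Idx) (w : ScalarL2) :
    component i w j = if j = i then w else 0 := by
  by_cases h : j = i
  · subst h; simp [component]
  · simp [component, h]

/-- The operator of pointwise multiplication of fields by a bounded matrix field `A`, depending
continuously on `A`. -/
def mulOp : (Idx → Idx → RealLinf) →L[ℝ] FieldSpace →L[ℝ] FieldSpace :=
  ∑ i, ∑ j, ((ContinuousLinearMap.compL ℝ FieldSpace ScalarL2 FieldSpace (component i)) ∘L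
    ((ContinuousLinearMap.compL ℝ FieldSpace ScalarL2 ScalarL2).flip
      (PiLp.proj 2 (fun _ : Idx => ScalarL2) j)) ∘L linfMul ∘L
      (ContinuousLinearMap.proj (R := ℝ) (φ := fun _ : Idx => RealLinf) j) ∘L
      (ContinuousLinearMap.proj (R := ℝ) (φ := fun _ : Idx => Idx → RealLinf) i))

theorem mulOp_apply (A : Idx → Idx → RealLinf) (u : FieldSpace) (i : Idx) :
    mulOp A u i = ∑ j, (A i j • u j : ScalarL2) := by
  have h : mulOp A u = ∑ i, ∑ j, component i (linfMul (A i j) (u j)) := by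
    simp [mulOp]
  have h2 : ∀ (s : Idx → FieldSpace), (∑ k, s k) i = ∑ k, s k i := by
    intro s
    simp
  rw [h, h2]
  simp_rw [h2, component_apply]
  rw [Finset.sum_comm]
  simp [linfMul_apply]

theorem coeFn_mulOp (A : Idx → Idx → RealLinf) (u : FieldSpace) :
    ∀ᵐ x : Space, ∀ i, mulOp A u i x = ∑ j, A i j x * u j x := by
  rw [ae_all_iff]
  intro i
  rw [mulOp_apply]
  have h1 : ∀ᵐ x : Space, ∀ j, (A i j • u j : ScalarL2) x = A i j x * u j x := by
    rw [ae_all_iff]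
    exact fun j => Lp.coeFn_lpSMul (r := 2) (A i j) (u j)
  filter_upwards [h1, Lp.coeFn_fun_finsetSum Finset.univ (fun j => (A i j • u j : ScalarL2))]
    with x h1 h2
  rw [h2]
  exact Finset.sum_congr rfl fun j _ => h1 j

theorem field_ext {u v : FieldSpace} (h : ∀ᵐ x : Space, ∀ i, u i x = v i x) : u = v := by
  ext1 i
  exact Lp.ext (h.mono fun x hx => hx i)

theorem integrable_coe_mul (v w : ScalarL2) : Integrable (fun x : Space => v x * w x) :=
  (Lp.memLp v).integrable_mul (Lp.memLp w)

theorem inner_eq_integral (u v : FieldSpace) :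
    inner ℝ u v = ∫ x : Space, ∑ i, u i x * v i x := by
  rw [PiLp.inner_apply, integral_finsetSum _ fun i _ => integrable_coe_mul _ _]
  refine Finset.sum_congr rfl fun i _ => ?_
  rw [L2.inner_def]
  congr 1; ext x
  simp [mul_comm]

theorem norm_sq_eq_integral (u : FieldSpace) : ‖u‖ ^ 2 = ∫ x : Space, ∑ i, u i x * u i x := by
  rw [← inner_eq_integral, real_inner_self_eq_norm_sq]

theorem ae_abs_le_norm (g : RealLinf) : ∀ᵐ x : Space, |g x| ≤ ‖g‖ := by
  have h : ∀ᵐ x : Space, ‖g x‖ₑ ≤ eLpNorm g ⊤ volume := by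
    rw [eLpNorm_exponent_top]
    exact ae_le_eLpNormEssSup
  filter_upwards [h] with x hx
  rw [← Real.norm_eq_abs, Lp.norm_def, ← toReal_enorm]
  exact ENNReal.toReal_mono (Lp.memLp g).2.ne hx

theorem integrable_linf_mul (g : RealLinf) {h : Space → ℝ} (hh : Integrable h) :
    Integrable (fun x : Space => g x * h x) :=
  hh.bdd_mul (Lp.aestronglyMeasurable g) (ae_abs_le_norm g)

theorem inner_mulOp (A : Idx → Idx → RealLinf) (u v : FieldSpace) :
    inner ℝ (mulOp A u) v = ∫ x : Space, ∑ i, ∑ j, A i j x * (u j x * v i x) := by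
  rw [inner_eq_integral]
  apply integral_congr_ae
  filter_upwards [coeFn_mulOp A u] with x hx
  refine Finset.sum_congr rfl fun i _ => ?_
  rw [hx, Finset.sum_mul]
  exact Finset.sum_congr rfl fun j _ => by ring

theorem inner_mulOp_eq_sum (A : Idx → Idx → RealLinf) (u v : FieldSpace) :
    inner ℝ (mulOp A u) v = ∑ i, ∑ j, ∫ x : Space, A i j x * (u j x * v i x) := by
  rw [inner_mulOp, integral_finsetSum]
  · refine Finset.sum_congr rfl fun i _ => ?_
    rw [integral_finsetSum]
    exact fun j _ => integrable_linf_mul _ (integrable_coe_mul _ _)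
  · exact fun i _ => integrable_finsetSum _ fun j _ =>
      integrable_linf_mul _ (integrable_coe_mul _ _)

/-- Multiplication of all components by the same bounded function. -/
def scalarOp (ψ : RealLinf) : FieldSpace →L[ℝ] FieldSpace :=
  mulOp fun i j => if i = j then ψ else 0

theorem coeFn_scalarOp (ψ : RealLinf) (u : FieldSpace) :
    ∀ᵐ x : Space, ∀ i, scalarOp ψ u i x = ψ x * u i x := by
  filter_upwards [coeFn_mulOp (fun i j => if i = j then ψ else 0) u,
    Lp.coeFn_zero ℝ ⊤ (volume : Measure Space)] with x hx h0 i
  rw [scalarOp, hx, Finset.sum_eq_single i]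
  · simp
  · intro j _ hj
    rw [if_neg (Ne.symm hj), h0]
    simp
  · simp

theorem mulOp_scalarOp (A : Idx → Idx → RealLinf) (ψ : RealLinf) (u : FieldSpace) :
    mulOp A (scalarOp ψ u) = scalarOp ψ (mulOp A u) := by
  apply field_ext
  filter_upwards [coeFn_mulOp A u, coeFn_scalarOp ψ u, coeFn_mulOp A (scalarOp ψ u),
    coeFn_scalarOp ψ (mulOp A u)] with x h1 h2 h3 h4 i
  rw [h3, h4, h1, Finset.mul_sum]
  refine Finset.sum_congr rfl fun j _ => ?_
  rw [h2]; ring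

theorem inner_scalarOp (ψ : RealLinf) (u v : FieldSpace) :
    inner ℝ (scalarOp ψ u) v = ∫ x : Space, ψ x * ∑ i, u i x * v i x := by
  rw [inner_eq_integral]
  apply integral_congr_ae
  filter_upwards [coeFn_scalarOp ψ u] with x hx
  rw [Finset.mul_sum]
  exact Finset.sum_congr rfl fun i _ => by rw [hx]; ring

theorem inner_scalarOp_left (ψ : RealLinf) (u v : FieldSpace) :
    inner ℝ (scalarOp ψ u) v = inner ℝ u (scalarOp ψ v) := by
  rw [real_inner_comm (scalarOp ψ v), inner_scalarOp, inner_scalarOp]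
  simp_rw [mul_comm (v _ _)]

/-! ### Truncation of Schwartz functions and the Fourier transform -/

/-- A smooth cutoff: it equals one on `[-1, 1]` and vanishes outside `(-2, 2)`. -/
def cutoff : ContDiffBump (0 : ℝ) := ⟨1, 2, by norm_num, by norm_num⟩

/-- All derivatives of `cutoff - 1` are bounded and vanish near `0`, hence are `O(|y|)`. -/
theorem exists_norm_iteratedDeriv_cutoff_le (i : ℕ) :
    ∃ C, 0 ≤ C ∧ ∀ y : ℝ, ‖iteratedDeriv i (fun y => cutoff y - 1) y‖ ≤ C * |y| := by
  have hsm : ContDiff ℝ ∞ (fun y : ℝ => cutoff y - 1) := cutoff.contDiff.sub contDiff_const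
  have hcont : Continuous (iteratedDeriv i (fun y : ℝ => cutoff y - 1)) :=
    hsm.continuous_iteratedDeriv i (by exact_mod_cast le_top)
  obtain ⟨C, hC⟩ := (isCompact_Icc (a := (-2 : ℝ)) (b := 2)).exists_bound_of_continuousOn
    hcont.continuousOn
  have hin : ∀ y : ℝ, |y| < 1 → iteratedDeriv i (fun y : ℝ => cutoff y - 1) y = 0 := by
    intro y hy
    have : (fun y : ℝ => cutoff y - 1) =ᶠ[𝓝 y] fun _ => 0 := by
      filter_upwards [Metric.isOpen_ball.mem_nhds (show y ∈ Metric.ball (0 : ℝ) 1 by simpa using hy)]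
        with z hz
      rw [cutoff.one_of_mem_closedBall (Metric.ball_subset_closedBall hz), sub_self]
    rw [this.iteratedDeriv_eq i]
    simp [iteratedDeriv_fun_const_zero]
  have hout : ∀ y : ℝ, 2 < |y| → ‖iteratedDeriv i (fun y : ℝ => cutoff y - 1) y‖ ≤ 1 := by
    intro y hy
    have : (fun y : ℝ => cutoff y - 1) =ᶠ[𝓝 y] fun _ => -1 := by
      filter_upwards [(isOpen_lt continuous_const continuous_abs).mem_nhds hy] with z hz
      rw [cutoff.zero_of_le_dist (by rw [Real.dist_eq, sub_zero]; exact le_of_lt hz), zero_sub]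
    rw [this.iteratedDeriv_eq i, iteratedDeriv_const]
    split_ifs <;> simp
  refine ⟨max C 1, by positivity, fun y => ?_⟩
  rcases lt_or_ge |y| 1 with h1 | h1
  · rw [hin y h1, norm_zero]; positivity
  · refine le_trans ?_ (le_mul_of_one_le_right (by positivity) h1)
    rcases le_or_gt |y| 2 with h2 | h2
    · exact (hC y (abs_le.1 h2)).trans (le_max_left _ _)
    · exact (hout y h2).trans (le_max_right _ _)

/-- Truncating a Schwartz function far away does not change it much, in the Schwartz topology. -/
theorem tendsto_of_eq_cutoff_smul {φ : 𝓢(ℝ, ℂ)} {φn : ℕ → 𝓢(ℝ, ℂ)}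
    (h : ∀ n w, φn n w = cutoff (((n : ℝ) + 1)⁻¹ * w) • φ w) : Tendsto φn atTop (𝓝 φ) := by
  rw [(schwartz_withSeminorms ℂ ℝ ℂ).tendsto_nhds]
  rintro ⟨k, m⟩ ε hε
  choose C hC0 hC using exists_norm_iteratedDeriv_cutoff_le
  set B := ∑ i ∈ Finset.range (m + 1), (m.choose i : ℝ) * C i *
    SchwartzMap.seminorm ℂ (k + 1) (m - i) φ with hB
  have hB0 : 0 ≤ B := Finset.sum_nonneg fun i _ => by
    have := hC0 i
    positivity
  have hle : ∀ n, SchwartzMap.seminorm ℂ k m (φn n - φ) ≤ ((n : ℝ) + 1)⁻¹ * B := by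
    intro n
    set c : ℝ := ((n : ℝ) + 1)⁻¹ with hc
    have hc0 : 0 ≤ c := by positivity
    have hc1 : c ≤ 1 := inv_le_one_of_one_le₀ (by linarith [n.cast_nonneg (α := ℝ)])
    refine SchwartzMap.seminorm_le_bound ℂ k m _ (by positivity) fun x => ?_
    have hsm : ContDiff ℝ ∞ (fun y : ℝ => cutoff y - 1) := cutoff.contDiff.sub contDiff_const
    have hsmc : ContDiff ℝ ∞ (fun y : ℝ => cutoff (c * y) - 1) :=
      hsm.comp (contDiff_const.mul contDiff_id)
    have heq : (⇑(φn n - φ) : ℝ → ℂ) = fun y => (cutoff (c * y) - 1) • φ y := by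
      ext y
      rw [sub_apply, h n y, sub_smul, one_smul]
    rw [heq]
    have h1 := norm_iteratedFDeriv_smul_le (𝕜 := ℝ) hsmc (φ.smooth ⊤) x (n := m)
      (by exact_mod_cast le_top)
    calc ‖x‖ ^ k * ‖iteratedFDeriv ℝ m (fun y => (cutoff (c * y) - 1) • φ y) x‖
        ≤ ‖x‖ ^ k * ∑ i ∈ Finset.range (m + 1), (m.choose i : ℝ) *
          ‖iteratedFDeriv ℝ i (fun y : ℝ => cutoff (c * y) - 1) x‖ *
          ‖iteratedFDeriv ℝ (m - i) φ x‖ := by gcongr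
      _ = ∑ i ∈ Finset.range (m + 1), (m.choose i : ℝ) *
          ‖iteratedFDeriv ℝ i (fun y : ℝ => cutoff (c * y) - 1) x‖ *
          (‖x‖ ^ k * ‖iteratedFDeriv ℝ (m - i) φ x‖) := by
        rw [Finset.mul_sum]
        exact Finset.sum_congr rfl fun i _ => by ring
      _ ≤ ∑ i ∈ Finset.range (m + 1), (m.choose i : ℝ) * (C i * (c * ‖x‖)) *
          (‖x‖ ^ k * ‖iteratedFDeriv ℝ (m - i) φ x‖) := by
        gcongr with i _
        rw [norm_iteratedFDeriv_eq_norm_iteratedDeriv,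
          iteratedDeriv_comp_const_mul (f := fun y : ℝ => cutoff y - 1)
            (hsm.of_le (by exact_mod_cast le_top)) c, norm_mul, norm_pow,
          Real.norm_of_nonneg hc0]
        calc c ^ i * ‖iteratedDeriv i (fun y : ℝ => cutoff y - 1) (c * x)‖
            ≤ 1 * (C i * |c * x|) := by
              gcongr
              · exact pow_le_one₀ hc0 hc1
              · exact hC i _
          _ = C i * (c * ‖x‖) := by rw [one_mul, abs_mul, abs_of_nonneg hc0, Real.norm_eq_abs]
      _ = c * ∑ i ∈ Finset.range (m + 1), (m.choose i : ℝ) * C i *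
          (‖x‖ ^ (k + 1) * ‖iteratedFDeriv ℝ (m - i) φ x‖) := by
        rw [Finset.mul_sum]
        exact Finset.sum_congr rfl fun i _ => by ring
      _ ≤ c * B := by
        rw [hB]
        gcongr with i _
        · exact mul_nonneg (Nat.cast_nonneg _) (hC0 i)
        · exact SchwartzMap.le_seminorm ℂ (k + 1) (m - i) φ x
  have hlim : Tendsto (fun n : ℕ => ((n : ℝ) + 1)⁻¹ * B) atTop (𝓝 0) := by
    have := (tendsto_one_div_add_atTop_nhds_zero_nat (𝕜 := ℝ)).mul_const B
    simpa using this
  filter_upwards [hlim.eventually (gt_mem_nhds hε)] with n hn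
  exact (hle n).trans_lt hn

theorem hasCompactSupport_cutoff_smul (φ : ℝ → ℂ) (n : ℕ) :
    HasCompactSupport fun w => cutoff (((n : ℝ) + 1)⁻¹ * w) • φ w := by
  refine HasCompactSupport.intro (isCompact_Icc (a := -(2 * ((n : ℝ) + 1))) (b := 2 * (n + 1)))
    fun w hw => ?_
  have hn : (0 : ℝ) < n + 1 := by positivity
  have h : 2 ≤ dist (((n : ℝ) + 1)⁻¹ * w) 0 := by
    rw [Real.dist_eq, sub_zero, abs_mul, abs_of_pos (inv_pos.2 hn), le_inv_mul_iff₀ hn, mul_comm]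
    by_contra hlt
    exact hw (abs_le.1 (not_le.1 hlt).le)
  rw [cutoff.zero_of_le_dist h, zero_smul]

theorem contDiff_cutoff_smul (φ : 𝓢(ℝ, ℂ)) (n : ℕ) :
    ContDiff ℝ ∞ fun w => cutoff (((n : ℝ) + 1)⁻¹ * w) • φ w := by
  have h : ContDiff ℝ ∞ fun w : ℝ => cutoff (((n : ℝ) + 1)⁻¹ * w) :=
    ContDiff.comp (g := (cutoff : ℝ → ℝ)) cutoff.contDiff (contDiff_const.mul contDiff_id)
  exact h.smul (φ.smooth ⊤)

/-- The truncated Schwartz function `w ↦ cutoff (w / (n + 1)) φ(w)`. -/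
def truncate (φ : 𝓢(ℝ, ℂ)) (n : ℕ) : 𝓢(ℝ, ℂ) :=
  (hasCompactSupport_cutoff_smul φ n).toSchwartzMap (contDiff_cutoff_smul φ n)

theorem truncate_apply (φ : 𝓢(ℝ, ℂ)) (n : ℕ) (w : ℝ) :
    truncate φ n w = cutoff (((n : ℝ) + 1)⁻¹ * w) • φ w := rfl

theorem hasCompactSupport_truncate (φ : 𝓢(ℝ, ℂ)) (n : ℕ) : HasCompactSupport (truncate φ n) :=
  hasCompactSupport_cutoff_smul φ n

theorem tendsto_truncate (φ : 𝓢(ℝ, ℂ)) : Tendsto (truncate φ) atTop (𝓝 φ) :=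
  tendsto_of_eq_cutoff_smul fun n w => truncate_apply φ n w

/-- The dilation `φ ↦ φ(r ·)` of Schwartz functions. -/
def dilate (r : ℝ) (hr : r ≠ 0) : 𝓢(ℝ, ℂ) →L[ℂ] 𝓢(ℝ, ℂ) :=
  SchwartzMap.compCLMOfContinuousLinearEquiv ℂ
    (ContinuousLinearEquiv.unitsEquivAut ℝ (Units.mk0 r hr))

/-- The unitary Fourier transform in angular frequency `φ ↦ (2π)^{-1/2} ∫ φ(w) e^{iwt} dw`. -/
def angularFourier : 𝓢(ℝ, ℂ) →L[ℂ] 𝓢(ℝ, ℂ) :=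
  ((1 / Real.sqrt (2 * Real.pi) : ℝ) : ℂ) •
    (dilate (2 * Real.pi)⁻¹ (by positivity) ∘L FourierTransform.fourierInvCLM ℂ 𝓢(ℝ, ℂ))

open FourierTransform in
theorem angularFourier_apply (φ : 𝓢(ℝ, ℂ)) (t : ℝ) :
    angularFourier φ t = ((1 / Real.sqrt (2 * Real.pi) : ℝ) : ℂ) *
        ∫ w : ℝ, φ w * Complex.exp (Complex.I * w * t) := by
  have h : angularFourier φ t = ((1 / Real.sqrt (2 * Real.pi) : ℝ) : ℂ) *
      (𝓕⁻ φ) (t * (2 * Real.pi)⁻¹) := rfl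
  rw [h, SchwartzMap.fourierInv_coe, Real.fourierInv_eq']
  congr 1
  refine integral_congr_ae (Eventually.of_forall fun w => ?_)
  simp only [RCLike.inner_apply, conj_trivial, smul_eq_mul]
  rw [mul_comm]
  congr 2
  push_cast
  field_simp

open FourierTransform in
/-- The inverse of `angularFourier`. -/
def angularFourierInv (φ : 𝓢(ℝ, ℂ)) : 𝓢(ℝ, ℂ) :=
  ((1 / Real.sqrt (2 * Real.pi) : ℝ) : ℂ) • dilate (2 * Real.pi)⁻¹ (by positivity) (𝓕 φ)

open FourierTransform in
theorem angularFourierInv_apply (φ : 𝓢(ℝ, ℂ)) (w : ℝ) :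
    angularFourierInv φ w = ((1 / Real.sqrt (2 * Real.pi) : ℝ) : ℂ) *
      𝓕 (φ : ℝ → ℂ) (w * (2 * Real.pi)⁻¹) := rfl

open FourierTransform in
theorem angularFourier_angularFourierInv (φ : 𝓢(ℝ, ℂ)) :
    angularFourier (angularFourierInv φ) = φ := by
  ext t
  set κ : ℂ := ((1 / Real.sqrt (2 * Real.pi) : ℝ) : ℂ) with hκ
  have hκ2 : κ * κ * (2 * Real.pi : ℝ) = 1 := by
    have hs : Real.sqrt (2 * Real.pi) * Real.sqrt (2 * Real.pi) = 2 * Real.pi :=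
      Real.mul_self_sqrt (by positivity)
    have hne : Real.sqrt (2 * Real.pi) ≠ 0 := by positivity
    rw [hκ, ← Complex.ofReal_mul, ← Complex.ofReal_mul, ← Complex.ofReal_one]
    congr 1
    rw [div_mul_div_comm, hs]
    field_simp
  have hinv : φ t = ∫ ξ : ℝ, 𝓕 (φ : ℝ → ℂ) ξ * Complex.exp (Complex.I * (2 * Real.pi * ξ : ℝ) * t) := by
    conv_lhs => rw [← fourierInv_fourier_eq (F := 𝓢(ℝ, ℂ)) φ]
    rw [SchwartzMap.fourierInv_coe, Real.fourierInv_eq', SchwartzMap.fourier_coe]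
    refine integral_congr_ae (Eventually.of_forall fun w => ?_)
    simp only [RCLike.inner_apply, conj_trivial, smul_eq_mul]
    rw [mul_comm]
    congr 2
    push_cast
    ring
  have hsub := Measure.integral_comp_mul_right
    (fun ξ : ℝ => 𝓕 (φ : ℝ → ℂ) ξ * Complex.exp (Complex.I * (2 * Real.pi * ξ : ℝ) * t))
    (2 * Real.pi)⁻¹
  rw [angularFourier_apply, ← hκ]
  have hstep : ∀ w : ℝ, angularFourierInv φ w * Complex.exp (Complex.I * w * t)
      = κ * (𝓕 (φ : ℝ → ℂ) (w * (2 * Real.pi)⁻¹) *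
        Complex.exp (Complex.I * (2 * Real.pi * (w * (2 * Real.pi)⁻¹) : ℝ) * t)) := by
    intro w
    rw [angularFourierInv_apply, mul_assoc]
    congr 5
    field_simp
  simp_rw [hstep]
  rw [integral_const_mul, hsub, ← hinv, inv_inv, abs_of_pos (by positivity : (0:ℝ) < 2 * Real.pi),
    Complex.real_smul, ← mul_assoc, ← mul_assoc, hκ2, one_mul]

/-! ### Correlations of test functions -/

/-- The correlation `r ↦ ∫ a(t - r) b(t) dt` of two functions of time. -/
def correlation (a b : ℝ → ℝ) (r : ℝ) : ℝ := ∫ t, a (t - r) * b t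

theorem correlation_eq_convolution (a b : ℝ → ℝ) :
    correlation a b = convolution b (fun s => a (-s)) (ContinuousLinearMap.mul ℝ ℝ) volume := by
  ext r
  simp only [correlation, convolution_def, ContinuousLinearMap.mul_apply']
  congr 1; ext t
  rw [neg_sub, mul_comm]

theorem hasCompactSupport_comp_neg {a : ℝ → ℝ} (ha : HasCompactSupport a) :
    HasCompactSupport fun s => a (-s) :=
  ha.comp_homeomorph (Homeomorph.neg ℝ)

theorem hasCompactSupport_correlation {a b : ℝ → ℝ} (ha : HasCompactSupport a)
    (hb : HasCompactSupport b) : HasCompactSupport (correlation a b) := by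
  rw [correlation_eq_convolution]
  exact hb.convolution _ (hasCompactSupport_comp_neg ha)

theorem contDiff_correlation {a b : ℝ → ℝ} (ha : HasCompactSupport a) (ha' : ContDiff ℝ ∞ a)
    (hb : HasCompactSupport b) (hb' : ContDiff ℝ ∞ b) : ContDiff ℝ ∞ (correlation a b) := by
  rw [correlation_eq_convolution]
  exact (hasCompactSupport_comp_neg ha).contDiff_convolution_right _
    (hb'.continuous.integrable_of_hasCompactSupport hb).locallyIntegrable
    (ha'.comp contDiff_neg)

open FourierTransform in
theorem fourier_comp_neg_ofReal (a : ℝ → ℝ) (ξ : ℝ) :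
    𝓕 (fun s => (a (-s) : ℂ)) ξ = (starRingEnd ℂ) (𝓕 (fun s => (a s : ℂ)) ξ) := by
  have h := congrFun (Real.fourierInv_eq_fourier_comp_neg (fun s : ℝ => (a s : ℂ))) ξ
  rw [← h, Real.fourierInv_eq', Real.fourier_eq', ← integral_conj]
  congr 1; ext v
  simp only [smul_eq_mul, map_mul, Complex.conj_ofReal, ← Complex.exp_conj]
  congr 2
  push_cast
  simp

open FourierTransform in
theorem fourier_correlation {a b : ℝ → ℝ} (ha : Integrable a) (hb : Integrable b) (ξ : ℝ) :
    𝓕 (fun r => (correlation a b r : ℂ)) ξ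
      = (starRingEnd ℂ) (𝓕 (fun s => (a s : ℂ)) ξ) * 𝓕 (fun s => (b s : ℂ)) ξ := by
  have h : (fun r => (correlation a b r : ℂ)) =
      convolution (fun s => (b s : ℂ)) (fun s => (a (-s) : ℂ)) (ContinuousLinearMap.mul ℂ ℂ)
        volume := by
    ext r
    simp only [correlation, convolution_def, ContinuousLinearMap.mul_apply']
    rw [← integral_complex_ofReal]
    congr 1; ext t
    rw [neg_sub]; push_cast; ring
  rw [h, ← fourier_comp_neg_ofReal, mul_comm]
  exact Real.fourier_mul_convolution_eq (R := ℂ) hb.ofReal ha.comp_neg.ofReal ξ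

/-- The correlation of two test functions, as a complex Schwartz function. -/
def correlationSchwartz {a b : ℝ → ℝ} (ha : HasCompactSupport a) (ha' : ContDiff ℝ ∞ a)
    (hb : HasCompactSupport b) (hb' : ContDiff ℝ ∞ b) : 𝓢(ℝ, ℂ) :=
  HasCompactSupport.toSchwartzMap (f := fun r => (correlation a b r : ℂ))
    ((hasCompactSupport_correlation ha hb).comp_left (g := fun s : ℝ => (s : ℂ)) Complex.ofReal_zero)
    (Complex.ofRealCLM.contDiff.comp (contDiff_correlation ha ha' hb hb'))

/-! ### Positivity of a passive kernel on separated test fields -/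

theorem ae_norm_le_norm_complex (g : ComplexLinf) : ∀ᵐ x : Space, ‖g x‖ ≤ ‖g‖ := by
  have h : ∀ᵐ x : Space, ‖g x‖ₑ ≤ eLpNorm g ⊤ volume := by
    rw [eLpNorm_exponent_top]
    exact ae_le_eLpNormEssSup
  filter_upwards [h] with x hx
  rw [Lp.norm_def, ← toReal_enorm]
  exact ENNReal.toReal_mono (Lp.memLp g).2.ne hx

theorem integrable_complexLinf_mul (g : ComplexLinf) (v w : ScalarL2) :
    Integrable (fun x : Space => g x * ((v x * w x : ℝ) : ℂ)) :=
  (integrable_coe_mul v w).ofReal.bdd_mul (Lp.aestronglyMeasurable g) (ae_norm_le_norm_complex g)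

/-- The functional `g ↦ ∫ g v w` on `L^∞(ℝ³)` attached to two functions of `L²(ℝ³)`. -/
def linfPairing (v w : ScalarL2) : ComplexLinf →L[ℂ] ℂ :=
  LinearMap.mkContinuous
    { toFun := fun g => ∫ x : Space, g x * ((v x * w x : ℝ) : ℂ)
      map_add' := fun g h => by
        rw [← integral_add (integrable_complexLinf_mul g v w) (integrable_complexLinf_mul h v w)]
        apply integral_congr_ae
        filter_upwards [Lp.coeFn_add g h] with x hx
        rw [hx, Pi.add_apply, add_mul]
      map_smul' := fun c g => by
        rw [RingHom.id_apply, smul_eq_mul, ← integral_const_mul]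
        apply integral_congr_ae
        filter_upwards [Lp.coeFn_smul c g] with x hx
        rw [hx, Pi.smul_apply, smul_eq_mul, mul_assoc] }
    (∫ x : Space, |v x * w x|) (fun g => by
      rw [mul_comm, ← integral_const_mul]
      refine norm_integral_le_of_norm_le ((integrable_coe_mul v w).abs.const_mul _) ?_
      filter_upwards [ae_norm_le_norm_complex g] with x hx
      rw [norm_mul, Complex.norm_real, Real.norm_eq_abs]
      gcongr)

theorem linfPairing_apply (v w : ScalarL2) (g : ComplexLinf) :
    linfPairing v w g = ∫ x : Space, g x * ((v x * w x : ℝ) : ℂ) := rfl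

theorem linfPairing_complexify (v w : ScalarL2) (l : ℝ → RealLinf) (t : ℝ) :
    linfPairing v w (complexify l t) = ((∫ x : Space, l t x * (v x * w x) : ℝ) : ℂ) := by
  rw [linfPairing_apply, ← integral_complex_ofReal]
  apply integral_congr_ae
  filter_upwards [ContinuousLinearMap.coeFn_compLpL (p := ⊤) Complex.ofRealCLM (l t)] with x hx
  rw [complexify, hx]
  simp

theorem smul_complexify (c : ℝ) (l : ℝ → RealLinf) (t : ℝ) :
    (c : ℂ) • complexify l t
      = Complex.ofRealCLM.compLpL ⊤ (volume : Measure Space) (c • l t) := by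
  rw [ContinuousLinearMap.map_smul]
  apply Lp.ext
  filter_upwards [Lp.coeFn_smul (c : ℂ) (complexify l t),
    Lp.coeFn_smul c (complexify l t)] with x h1 h2
  rw [h1]
  refine Eq.trans ?_ h2.symm
  simp

theorem linfPairing_integral_smul_complexify {c : ℝ → ℝ} (hc : Continuous c)
    (hcs : HasCompactSupport c) {l : ℝ → RealLinf} (hl : LocallyIntegrable l) (v w : ScalarL2) :
    linfPairing v w (∫ t, (c t : ℂ) • complexify l t)
      = ((∫ t, c t * ∫ x : Space, l t x * (v x * w x) : ℝ) : ℂ) := by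
  have hi : Integrable fun t => c t • l t := hl.integrable_smul_left_of_hasCompactSupport hc hcs
  have hi' : Integrable fun t => (c t : ℂ) • complexify l t := by
    simp_rw [smul_complexify]
    exact ContinuousLinearMap.integrable_comp _ hi
  rw [← ContinuousLinearMap.integral_comp_comm _ hi', ← integral_complex_ofReal]
  congr 1; ext t
  rw [map_smul, linfPairing_complexify, smul_eq_mul]
  push_cast; rfl

theorem integrable_mul_integral_linf {c : ℝ → ℝ} (hc : Continuous c)
    (hcs : HasCompactSupport c) {l : ℝ → RealLinf} (hl : LocallyIntegrable l) (v w : ScalarL2) :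
    Integrable fun t => c t * ∫ x : Space, l t x * (v x * w x) := by
  have hi : Integrable fun t => c t • l t := hl.integrable_smul_left_of_hasCompactSupport hc hcs
  have hi' : Integrable fun t => (c t : ℂ) • complexify l t := by
    simp_rw [smul_complexify]
    exact ContinuousLinearMap.integrable_comp _ hi
  have := (ContinuousLinearMap.integrable_comp (linfPairing v w) hi').re
  refine this.congr (Eventually.of_forall fun t => ?_)
  simp only [map_smul, linfPairing_complexify, smul_eq_mul]
  rw [← Complex.ofReal_mul]
  exact Complex.ofReal_re _

/-- At a frequency where the symbol is passive, the quadratic form of the symbol is nonnegative on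
complex combinations of real fields. -/
theorem re_sum_linfPairing_nonneg {ι : Type*} [Fintype ι] (m : Idx → Idx → ComplexLinf)
    (hm : ∀ᵐ x : Space, ∀ X : Idx → ℂ,
      0 ≤ (∑ i, (∑ j, m i j x * X j) * (starRingEnd ℂ) (X i)).re)
    (z : ι → ℂ) (X : ι → FieldSpace) :
    0 ≤ (∑ k, ∑ l, ∑ i, ∑ j, (starRingEnd ℂ) (z k) * z l *
      linfPairing (X k j) (X l i) (m i j)).re := by
  have hint : ∀ k l i j, Integrable (fun x : Space => (starRingEnd ℂ) (z k) * z l *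
      (m i j x * ((X k j x * X l i x : ℝ) : ℂ))) :=
    fun k l i j => (integrable_complexLinf_mul (m i j) (X k j) (X l i)).const_mul _
  have h : ∑ k, ∑ l, ∑ i, ∑ j, (starRingEnd ℂ) (z k) * z l *
      linfPairing (X k j) (X l i) (m i j) = ∫ x : Space, ∑ k, ∑ l, ∑ i, ∑ j,
        (starRingEnd ℂ) (z k) * z l * (m i j x * ((X k j x * X l i x : ℝ) : ℂ)) := by
    rw [integral_finsetSum _ fun k _ => integrable_finsetSum _ fun l _ =>
      integrable_finsetSum _ fun i _ => integrable_finsetSum _ fun j _ => hint k l i j]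
    refine Finset.sum_congr rfl fun k _ => ?_
    rw [integral_finsetSum _ fun l _ => integrable_finsetSum _ fun i _ =>
      integrable_finsetSum _ fun j _ => hint k l i j]
    refine Finset.sum_congr rfl fun l _ => ?_
    rw [integral_finsetSum _ fun i _ => integrable_finsetSum _ fun j _ => hint k l i j]
    refine Finset.sum_congr rfl fun i _ => ?_
    rw [integral_finsetSum _ fun j _ => hint k l i j]
    refine Finset.sum_congr rfl fun j _ => ?_
    rw [integral_const_mul, linfPairing_apply]
  have hI : Integrable fun x : Space => ∑ k, ∑ l, ∑ i, ∑ j,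
        (starRingEnd ℂ) (z k) * z l * (m i j x * ((X k j x * X l i x : ℝ) : ℂ)) :=
    integrable_finsetSum _ fun k _ => integrable_finsetSum _ fun l _ =>
      integrable_finsetSum _ fun i _ => integrable_finsetSum _ fun j _ => hint k l i j
  rw [h]
  refine le_of_le_of_eq ?_ (integral_re hI)
  refine integral_nonneg_of_ae ?_
  filter_upwards [hm] with x hx
  -- the integrand is the passive form at the vector `∑ₖ conj(zₖ) Xₖ(x)`
  have h2 := hx fun j => ∑ k, (starRingEnd ℂ) (z k) * (X k j x : ℂ)
  refine h2.trans (le_of_eq ?_)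
  change _ = Complex.re _
  congr 1
  simp_rw [map_sum, map_mul, Complex.conj_conj, Complex.conj_ofReal, Finset.mul_sum,
    Finset.sum_mul]
  have e1 : ∀ i : Idx, ∑ l : ι, ∑ j : Idx, ∑ k : ι, m i j x * ((starRingEnd ℂ) (z k) * (X k j x : ℂ))
      * (z l * (X l i x : ℂ)) = ∑ k : ι, ∑ l : ι, ∑ j : Idx,
        (starRingEnd ℂ) (z k) * z l * (m i j x * ((X k j x * X l i x : ℝ) : ℂ)) := by
    intro i
    rw [Finset.sum_comm]
    conv_rhs => enter [2, k]; rw [Finset.sum_comm]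
    rw [Finset.sum_comm' (t' := Finset.univ) (s' := fun _ => Finset.univ) (by simp)]
    simp_rw [Finset.sum_comm (s := (Finset.univ : Finset ι)) (t := (Finset.univ : Finset Idx))]
    refine Finset.sum_congr rfl fun j _ => ?_
    rw [Finset.sum_comm]
    refine Finset.sum_congr rfl fun k _ => Finset.sum_congr rfl fun l _ => ?_
    push_cast; ring
  simp_rw [e1]
  rw [Finset.sum_comm]
  refine Finset.sum_congr rfl fun k _ => ?_
  rw [Finset.sum_comm]

theorem integrable_linfPairing_mul {m : ℝ → ComplexLinf} (hm : LocallyIntegrable m)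
    (φ : 𝓢(ℝ, ℂ)) (hφ : HasCompactSupport φ) (v w : ScalarL2) :
    Integrable fun s => φ s * linfPairing v w (m s) := by
  have hi : Integrable fun s => φ s • m s :=
    hm.integrable_smul_left_of_hasCompactSupport φ.continuous hφ
  simpa using ContinuousLinearMap.integrable_comp (linfPairing v w) hi

/-- On the image of a compactly supported function under the Fourier transform, the tempered
distribution of `IsFourierTransform` is given by the symbol `m`. -/
theorem linfPairing_fourierTransform {m : ℝ → ComplexLinf} {S : 𝓢(ℝ, ℂ) →L[ℂ] ComplexLinf}
    (hS : ∀ φ ψ : 𝓢(ℝ, ℂ), HasCompactSupport φ →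
      (∀ t : ℝ, ψ t = ((1 / Real.sqrt (2 * Real.pi) : ℝ) : ℂ) *
        ∫ w : ℝ, φ w * Complex.exp (Complex.I * w * t)) →
      S ψ = ∫ w : ℝ, φ w • m w) (hm : LocallyIntegrable m)
    (φ : 𝓢(ℝ, ℂ)) (hφ : HasCompactSupport φ) (v w : ScalarL2) :
    linfPairing v w (S (angularFourier φ)) = ∫ s, φ s * linfPairing v w (m s) := by
  have hi : Integrable fun s => φ s • m s :=
    hm.integrable_smul_left_of_hasCompactSupport φ.continuous hφ
  rw [hS φ _ hφ (angularFourier_apply φ), ← ContinuousLinearMap.integral_comp_comm _ hi]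
  simp

open FourierTransform in
/-- A passive kernel is of positive type, tested on finite sums of test functions of time with
values in `L²(ℝ³)⁶`. On the frequency side each truncation of the quadratic form is the integral of
a nonnegative function, and truncation is continuous for tempered distributions. -/
theorem sum_integral_correlation_nonneg {ι : Type*} [Fintype ι]
    {Λ : Idx → Idx → ℝ → RealLinf} {Λhat : Idx → Idx → ℝ → ComplexLinf}
    (hΛ : ∀ i j, LocallyIntegrable (Λ i j) volume)
    (hΛhat : ∀ i j, LocallyIntegrable (Λhat i j) volume)
    (hfourier : ∀ i j, IsFourierTransform (complexify (Λ i j)) (Λhat i j))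
    (hpassive : IsPassive Λhat) {a : ι → ℝ → ℝ} (ha : ∀ k, HasCompactSupport (a k))
    (ha' : ∀ k, ContDiff ℝ ∞ (a k)) (X : ι → FieldSpace) :
    0 ≤ ∑ k, ∑ l, ∫ r, correlation (a k) (a l) r *
      inner ℝ (mulOp (fun i j => Λ i j r) (X k)) (X l) := by
  choose S hS1 hS2 using hfourier
  set A : ι → ι → 𝓢(ℝ, ℂ) := fun k l => correlationSchwartz (ha k) (ha' k) (ha l) (ha' l) with hA
  have hAc : ∀ k l, HasCompactSupport (A k l) := fun k l =>
    (hasCompactSupport_correlation (ha k) (ha l)).comp_left (g := fun s : ℝ => (s : ℂ))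
      Complex.ofReal_zero
  have hcc : ∀ k l, Continuous (correlation (a k) (a l)) := fun k l =>
    (contDiff_correlation (ha k) (ha' k) (ha l) (ha' l)).continuous
  -- the quadratic form in terms of the tempered distributions `S`
  have htime : ((∑ k, ∑ l, ∫ r, correlation (a k) (a l) r *
      inner ℝ (mulOp (fun i j => Λ i j r) (X k)) (X l) : ℝ) : ℂ)
      = ∑ k, ∑ l, ∑ i, ∑ j, linfPairing (X k j) (X l i) (S i j (A k l)) := by
    push_cast
    refine Finset.sum_congr rfl fun k _ => Finset.sum_congr rfl fun l _ => ?_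
    have e : ∀ i j, linfPairing (X k j) (X l i) (S i j (A k l))
        = ((∫ r, correlation (a k) (a l) r *
            ∫ x : Space, Λ i j r x * (X k j x * X l i x) : ℝ) : ℂ) := by
      intro i j
      rw [hS1 i j _ (hAc k l), ← linfPairing_integral_smul_complexify (hcc k l)
        (hasCompactSupport_correlation (ha k) (ha l)) (hΛ i j)]
      rfl
    simp_rw [e]
    simp only [← Complex.ofReal_sum]
    congr 1
    simp_rw [inner_mulOp_eq_sum, Finset.mul_sum]
    have hi : ∀ i j, Integrable fun r => correlation (a k) (a l) r *
        ∫ x : Space, Λ i j r x * (X k j x * X l i x) := fun i j =>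
      integrable_mul_integral_linf (hcc k l) (hasCompactSupport_correlation (ha k) (ha l))
        (hΛ i j) _ _
    rw [integral_finsetSum _ fun i _ => integrable_finsetSum _ fun j _ => hi i j]
    refine Finset.sum_congr rfl fun i _ => ?_
    rw [integral_finsetSum _ fun j _ => hi i j]
  -- truncation in frequency
  set Φ : ι → ι → ℕ → 𝓢(ℝ, ℂ) := fun k l n => truncate (angularFourierInv (A k l)) n with hΦ
  have hlim : Tendsto (fun n => (∑ k, ∑ l, ∑ i, ∑ j,
      linfPairing (X k j) (X l i) (S i j (angularFourier (Φ k l n)))).re) atTop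
      (𝓝 (∑ k, ∑ l, ∑ i, ∑ j, linfPairing (X k j) (X l i) (S i j (A k l))).re) := by
    refine (Complex.continuous_re.tendsto _).comp ?_
    refine tendsto_finsetSum _ fun k _ => tendsto_finsetSum _ fun l _ =>
      tendsto_finsetSum _ fun i _ => tendsto_finsetSum _ fun j _ => ?_
    have h1 : Tendsto (fun n => angularFourier (Φ k l n)) atTop (𝓝 (A k l)) := by
      have := (angularFourier.continuous.tendsto _).comp
        (tendsto_truncate (angularFourierInv (A k l)))
      rwa [angularFourier_angularFourierInv] at this
    exact ((linfPairing (X k j) (X l i)).continuous.tendsto _).comp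
      (((S i j).continuous.tendsto _).comp h1)
  rw [← Complex.ofReal_re (∑ k, ∑ l, ∫ r, correlation (a k) (a l) r *
      inner ℝ (mulOp (fun i j => Λ i j r) (X k)) (X l)), htime]
  refine ge_of_tendsto' hlim fun n => ?_
  have hint : ∀ k l i j, Integrable fun s => Φ k l n s *
      linfPairing (X k j) (X l i) (Λhat i j s) := fun k l i j =>
    integrable_linfPairing_mul (hΛhat i j) _ (hasCompactSupport_truncate _ n) _ _
  have hfreq : ∑ k, ∑ l, ∑ i, ∑ j,
      linfPairing (X k j) (X l i) (S i j (angularFourier (Φ k l n)))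
      = ∫ s, ∑ k, ∑ l, ∑ i, ∑ j, Φ k l n s * linfPairing (X k j) (X l i) (Λhat i j s) := by
    rw [integral_finsetSum _ fun k _ => integrable_finsetSum _ fun l _ =>
      integrable_finsetSum _ fun i _ => integrable_finsetSum _ fun j _ => hint k l i j]
    refine Finset.sum_congr rfl fun k _ => ?_
    rw [integral_finsetSum _ fun l _ => integrable_finsetSum _ fun i _ =>
      integrable_finsetSum _ fun j _ => hint k l i j]
    refine Finset.sum_congr rfl fun l _ => ?_
    rw [integral_finsetSum _ fun i _ => integrable_finsetSum _ fun j _ => hint k l i j]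
    refine Finset.sum_congr rfl fun i _ => ?_
    rw [integral_finsetSum _ fun j _ => hint k l i j]
    refine Finset.sum_congr rfl fun j _ => ?_
    exact linfPairing_fourierTransform (hS2 i j) (hΛhat i j) _ (hasCompactSupport_truncate _ n) _ _
  have hI : Integrable fun s => ∑ k, ∑ l, ∑ i, ∑ j,
      Φ k l n s * linfPairing (X k j) (X l i) (Λhat i j s) :=
    integrable_finsetSum _ fun k _ => integrable_finsetSum _ fun l _ =>
      integrable_finsetSum _ fun i _ => integrable_finsetSum _ fun j _ => hint k l i j
  rw [hfreq]
  refine le_of_le_of_eq ?_ (integral_re hI)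
  refine integral_nonneg_of_ae ?_
  filter_upwards [hpassive] with s hs
  -- the Fourier transform of a correlation is a product, so that the form is `∑ conj(zₖ) zₗ ...`
  set z : ι → ℂ := fun k => 𝓕 (fun t => (a k t : ℂ)) (s * (2 * Real.pi)⁻¹) with hz
  have hΦs : ∀ k l, Φ k l n s = ((cutoff (((n : ℝ) + 1)⁻¹ * s) *
      (1 / Real.sqrt (2 * Real.pi)) : ℝ) : ℂ) * ((starRingEnd ℂ) (z k) * z l) := by
    intro k l
    have hai : ∀ k, Integrable (a k) := fun k =>
      (ha' k).continuous.integrable_of_hasCompactSupport (ha k)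
    have hc : (A k l : ℝ → ℂ) = fun r => (correlation (a k) (a l) r : ℂ) := rfl
    rw [hΦ, truncate_apply, angularFourierInv_apply, hc, fourier_correlation (hai k) (hai l),
      Complex.real_smul]
    push_cast
    ring
  have hpos := re_sum_linfPairing_nonneg (fun i j => Λhat i j s) hs z X
  simp_rw [← Finset.mul_sum] at hpos
  change 0 ≤ Complex.re _
  simp_rw [hΦs, mul_assoc _ ((starRingEnd ℂ) _ * _), ← Finset.mul_sum]
  rw [Complex.re_ofReal_mul]
  exact mul_nonneg (mul_nonneg cutoff.nonneg (by positivity)) hpos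

/-! ### Kernels of positive type on continuous fields -/

/-- Smooth functions of time, supported in `[0, s]`, which increase to the indicator of `(0, s)`. -/
def timeCutoff (s : ℝ) (n : ℕ) (t : ℝ) : ℝ :=
  Real.smoothTransition (n * t) * Real.smoothTransition (n * (s - t))

theorem contDiff_timeCutoff (s : ℝ) (n : ℕ) : ContDiff ℝ ∞ (timeCutoff s n) := by
  unfold timeCutoff
  exact (Real.smoothTransition.contDiff.comp (contDiff_const.mul contDiff_id)).mul
    (Real.smoothTransition.contDiff.comp (contDiff_const.mul (contDiff_const.sub contDiff_id)))

theorem timeCutoff_eq_zero {s : ℝ} {t : ℝ} (n : ℕ) (ht : t ∉ Ioo 0 s) : timeCutoff s n t = 0 := by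
  unfold timeCutoff
  by_cases h : t ≤ 0
  · rw [Real.smoothTransition.zero_of_nonpos (mul_nonpos_of_nonneg_of_nonpos n.cast_nonneg h),
      zero_mul]
  · have h2 : s - t ≤ 0 := by
      by_contra h3
      exact ht ⟨not_le.1 h, by linarith⟩
    rw [Real.smoothTransition.zero_of_nonpos (x := n * (s - t))
      (mul_nonpos_of_nonneg_of_nonpos n.cast_nonneg h2), mul_zero]

theorem abs_timeCutoff_le_one (s : ℝ) (n : ℕ) (t : ℝ) : |timeCutoff s n t| ≤ 1 := by
  unfold timeCutoff
  rw [abs_mul, abs_of_nonneg (Real.smoothTransition.nonneg _),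
    abs_of_nonneg (Real.smoothTransition.nonneg _)]
  exact mul_le_one₀ (Real.smoothTransition.le_one _) (Real.smoothTransition.nonneg _)
    (Real.smoothTransition.le_one _)

theorem eventually_timeCutoff_eq_one {s t : ℝ} (ht : t ∈ Ioo 0 s) :
    ∀ᶠ n : ℕ in atTop, timeCutoff s n t = 1 := by
  have h1 := (tendsto_natCast_atTop_atTop (R := ℝ)).atTop_mul_const ht.1
  have h2 := (tendsto_natCast_atTop_atTop (R := ℝ)).atTop_mul_const (sub_pos.2 ht.2)
  filter_upwards [h1.eventually_ge_atTop 1, h2.eventually_ge_atTop 1] with n h1 h2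
  rw [timeCutoff, Real.smoothTransition.one_of_one_le h1, Real.smoothTransition.one_of_one_le h2,
    one_mul]

section PositiveType

variable {H : Type*} [NormedAddCommGroup H] [InnerProductSpace ℝ H]

theorem aestronglyMeasurable_inner_kernel {K : ℝ → H →L[ℝ] H} (hK : Integrable K) {w : ℝ → H}
    (hw : AEStronglyMeasurable w) :
    AEStronglyMeasurable (fun z : ℝ × ℝ => inner ℝ (K z.2 (w (z.1 - z.2))) (w z.1))
      (volume.prod volume) := by
  have h : AEStronglyMeasurable (fun z : ℝ × ℝ => K z.2 (w (z.1 - z.2))) (volume.prod volume) :=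
    AEStronglyMeasurable.convolution_integrand (ContinuousLinearMap.id ℝ (H →L[ℝ] H))
      hK.aestronglyMeasurable hw
  exact h.inner hw.comp_fst

theorem norm_inner_kernel_le (K : ℝ → H →L[ℝ] H) {w : ℝ → H} {C s : ℝ}
    (hC : ∀ t, ‖w t‖ ≤ C) (hw : ∀ t, t ∉ Ioo 0 s → w t = 0) (z : ℝ × ℝ) :
    ‖inner ℝ (K z.2 (w (z.1 - z.2))) (w z.1)‖ ≤ (Ioo 0 s).indicator (fun _ => C * C) z.1 * ‖K z.2‖ := by
  have hC0 : 0 ≤ C := (norm_nonneg _).trans (hC 0)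
  by_cases h : z.1 ∈ Ioo 0 s
  · rw [indicator_of_mem h]
    calc ‖inner ℝ (K z.2 (w (z.1 - z.2))) (w z.1)‖ ≤ ‖K z.2 (w (z.1 - z.2))‖ * ‖w z.1‖ :=
          norm_inner_le_norm _ _
      _ ≤ (‖K z.2‖ * C) * C := by
          gcongr
          · exact (ContinuousLinearMap.le_opNorm _ _).trans (by gcongr; exact hC _)
          · exact hC _
      _ = C * C * ‖K z.2‖ := by ring
  · rw [indicator_of_notMem h, hw _ h, inner_zero_right, norm_zero, zero_mul]

theorem integrable_indicator_mul_norm {K : ℝ → H →L[ℝ] H} (hK : Integrable K) (C s : ℝ) :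
    Integrable (fun z : ℝ × ℝ => (Ioo 0 s).indicator (fun _ => C * C) z.1 * ‖K z.2‖)
      (volume.prod volume) := by
  apply Integrable.mul_prod (f := fun t => (Ioo (0 : ℝ) s).indicator (fun _ => C * C) t)
    (g := fun r => ‖K r‖) _ hK.norm
  rw [integrable_indicator_iff measurableSet_Ioo]
  exact integrableOn_const (by simp)

/-- The quadratic form of a kernel on a finite sum of test functions, in terms of correlations. -/
theorem integral_inner_kernel_sum {ι : Type*} [Fintype ι] {K : ℝ → H →L[ℝ] H} (hK : Integrable K)
    {a : ι → ℝ → ℝ} (ha : ∀ k, HasCompactSupport (a k)) (ha' : ∀ k, Continuous (a k)) (X : ι → H) :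
    ∫ z : ℝ × ℝ, inner ℝ (K z.2 (∑ k, a k (z.1 - z.2) • X k)) (∑ l, a l z.1 • X l)
      = ∑ k, ∑ l, ∫ r, correlation (a k) (a l) r * inner ℝ (K r (X k)) (X l) := by
  have hg : ∀ k l, Integrable fun r => inner ℝ (K r (X k)) (X l) := by
    intro k l
    have h1 : Integrable fun r => K r (X k) := by
      simpa using ContinuousLinearMap.integrable_comp (ContinuousLinearMap.apply ℝ H (X k)) hK
    simpa [real_inner_comm] using ContinuousLinearMap.integrable_comp (innerSL ℝ (X l)) h1
  have hint : ∀ k l, Integrable (fun z : ℝ × ℝ => a k (z.1 - z.2) *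
      (a l z.1 * inner ℝ (K z.2 (X k)) (X l))) (volume.prod volume) := by
    intro k l
    obtain ⟨C, hC⟩ := (ha' k).bounded_above_of_compact_support (ha k)
    have h2 : Integrable (fun z : ℝ × ℝ => a l z.1 * inner ℝ (K z.2 (X k)) (X l))
        (volume.prod volume) :=
      Integrable.mul_prod ((ha' l).integrable_of_hasCompactSupport (ha l)) (hg k l)
    refine h2.bdd_mul (c := C) ?_ (Eventually.of_forall fun z => hC _)
    exact ((ha' k).comp (continuous_fst.sub continuous_snd)).aestronglyMeasurable
  have hexp : ∀ z : ℝ × ℝ, inner ℝ (K z.2 (∑ k, a k (z.1 - z.2) • X k)) (∑ l, a l z.1 • X l)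
      = ∑ k, ∑ l, a k (z.1 - z.2) * (a l z.1 * inner ℝ (K z.2 (X k)) (X l)) := by
    intro z
    rw [map_sum, sum_inner]
    refine Finset.sum_congr rfl fun k _ => ?_
    rw [inner_sum]
    refine Finset.sum_congr rfl fun l _ => ?_
    rw [map_smul, real_inner_smul_left, real_inner_smul_right]
  simp_rw [hexp]
  rw [Measure.volume_eq_prod, integral_finsetSum _ fun k _ => integrable_finsetSum _ fun l _ => hint k l]
  refine Finset.sum_congr rfl fun k _ => ?_
  rw [integral_finsetSum _ fun l _ => hint k l]
  refine Finset.sum_congr rfl fun l _ => ?_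
  rw [integral_prod_symm _ (hint k l)]
  congr 1; ext r
  rw [correlation, ← integral_mul_const]
  congr 1; ext t
  ring

/-- If the quadratic form of an operator-valued kernel is nonnegative on finite sums of test
functions supported in `[0, s]`, it is nonnegative on continuous functions: approximate by
Bernstein polynomials, truncated in time. -/
theorem integral_inner_kernel_nonneg {K : ℝ → H →L[ℝ] H} (hK : Integrable K) {s : ℝ} (hs : 0 < s)
    (hpos : ∀ (n : ℕ) (a : Fin (n + 1) → ℝ → ℝ) (X : Fin (n + 1) → H),
      (∀ k, HasCompactSupport (a k)) → (∀ k, ContDiff ℝ ∞ (a k)) →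
      (∀ k t, t ∉ Ioo 0 s → a k t = 0) →
      0 ≤ ∑ k, ∑ l, ∫ r, correlation (a k) (a l) r * inner ℝ (K r (X k)) (X l))
    {W : ℝ → H} (hW : Continuous W) :
    0 ≤ ∫ z : ℝ × ℝ, inner ℝ (K z.2 ((Ioo 0 s).indicator W (z.1 - z.2)))
      ((Ioo 0 s).indicator W z.1) := by
  -- Bernstein approximation of `W` on `[0, s]`, made a test function of time by the cutoff
  let f : C(unitInterval, H) := ⟨fun x => W (s * x), by fun_prop⟩
  let a : (n : ℕ) → Fin (n + 1) → ℝ → ℝ := fun n k t =>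
    timeCutoff s n t * (bernsteinPolynomial ℝ n k).eval (t / s)
  let w : ℕ → ℝ → H := fun n t => ∑ k, a n k t • f (bernstein.z k)
  have ha0 : ∀ n k t, t ∉ Ioo 0 s → a n k t = 0 := fun n k t ht => by
    simp only [a]; rw [timeCutoff_eq_zero n ht, zero_mul]
  have hac : ∀ n k, HasCompactSupport (a n k) := fun n k =>
    HasCompactSupport.intro (isCompact_Icc (a := 0) (b := s)) fun t ht =>
      ha0 n k t fun h => ht (Ioo_subset_Icc_self h)
  have had : ∀ n k, ContDiff ℝ ∞ (a n k) := fun n k => by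
    refine (contDiff_timeCutoff s n).mul ?_
    have h2 : ContDiff ℝ ∞ fun x : ℝ => (bernsteinPolynomial ℝ n k).eval x :=
      (bernsteinPolynomial ℝ n k).contDiff_aeval ∞
    exact h2.comp (contDiff_id.div_const s)
  have hwc : ∀ n, Continuous (w n) := fun n =>
    continuous_finsetSum _ fun k _ => (had n k).continuous.smul continuous_const
  have hw0 : ∀ n t, t ∉ Ioo 0 s → w n t = 0 := fun n t ht =>
    Finset.sum_eq_zero fun k _ => by rw [ha0 n k t ht, zero_smul]
  have hmem : ∀ t ∈ Ioo 0 s, t / s ∈ unitInterval := fun t ht =>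
    ⟨div_nonneg ht.1.le hs.le, (div_le_one hs).2 ht.2.le⟩
  have hwB : ∀ n t (ht : t ∈ Ioo 0 s),
      w n t = timeCutoff s n t • bernsteinApproximation n f ⟨t / s, hmem t ht⟩ := by
    intro n t ht
    rw [bernsteinApproximation.apply, Finset.smul_sum]
    refine Finset.sum_congr rfl fun k _ => ?_
    rw [smul_smul]
    rfl
  have hB := bernsteinApproximation_uniform f
  obtain ⟨C, hC⟩ : ∃ C, ∀ n t, ‖w n t‖ ≤ C := by
    obtain ⟨C, hC⟩ := (Metric.isBounded_range_of_tendsto _ hB).exists_norm_le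
    have hC0 : 0 ≤ C := (norm_nonneg _).trans (hC _ (mem_range_self 0))
    refine ⟨C, fun n t => ?_⟩
    by_cases ht : t ∈ Ioo 0 s
    · rw [hwB n t ht, norm_smul, Real.norm_eq_abs]
      calc |timeCutoff s n t| * ‖bernsteinApproximation n f ⟨t / s, hmem t ht⟩‖
          ≤ 1 * C := by
            gcongr
            · exact abs_timeCutoff_le_one s n t
            · exact (ContinuousMap.norm_coe_le_norm _ _).trans (hC _ (mem_range_self n))
        _ = C := one_mul C
    · rw [hw0 n t ht, norm_zero]; exact hC0
  have hlim : ∀ t, Tendsto (fun n => w n t) atTop (𝓝 ((Ioo 0 s).indicator W t)) := by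
    intro t
    by_cases ht : t ∈ Ioo 0 s
    · rw [indicator_of_mem ht]
      have h1 : Tendsto (fun n => bernsteinApproximation n f ⟨t / s, hmem t ht⟩) atTop (𝓝 (W t)) := by
        have := ((continuous_eval_const (F := C(unitInterval, H))
          (⟨t / s, hmem t ht⟩ : unitInterval)).tendsto f).comp hB
        have hf : f ⟨t / s, hmem t ht⟩ = W t := by
          change W (s * (t / s)) = W t
          rw [mul_div_cancel₀ _ hs.ne']
        rwa [hf] at this
      refine h1.congr' ?_
      filter_upwards [eventually_timeCutoff_eq_one ht] with n hn
      rw [hwB n t ht, hn, one_smul]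
    · rw [indicator_of_notMem ht]
      simp_rw [hw0 _ t ht]
      exact tendsto_const_nhds
  have hI : Tendsto (fun n => ∫ z : ℝ × ℝ, inner ℝ (K z.2 (w n (z.1 - z.2))) (w n z.1)) atTop
      (𝓝 (∫ z : ℝ × ℝ, inner ℝ (K z.2 ((Ioo 0 s).indicator W (z.1 - z.2)))
      ((Ioo 0 s).indicator W z.1))) := by
    refine tendsto_integral_of_dominated_convergence
      (fun z : ℝ × ℝ => (Ioo 0 s).indicator (fun _ => C * C) z.1 * ‖K z.2‖)
      (fun n => aestronglyMeasurable_inner_kernel hK (hwc n).aestronglyMeasurable)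
      (integrable_indicator_mul_norm hK C s)
      (fun n => Eventually.of_forall (norm_inner_kernel_le K (hC n) (hw0 n)))
      (Eventually.of_forall fun z => ?_)
    exact (((K z.2).continuous.tendsto _).comp (hlim _)).inner (hlim _)
  refine ge_of_tendsto' hI fun n => ?_
  rw [integral_inner_kernel_sum hK (hac n) (fun k => (had n k).continuous)]
  exact hpos n (a n) _ (hac n) (had n) (ha0 n)

/-- The quadratic form of a causal kernel on `(0,s)` only involves the values of `W` there, so that
the truncated and the untruncated forms agree. -/
theorem integral_inner_timeConv_nonneg [CompleteSpace H] {K : ℝ → H →L[ℝ] H} (hK : Integrable K)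
    (hK0 : ∀ t ≤ 0, K t = 0) {s : ℝ} (hs : 0 ≤ s)
    (hpos : ∀ (n : ℕ) (a : Fin (n + 1) → ℝ → ℝ) (X : Fin (n + 1) → H),
      (∀ k, HasCompactSupport (a k)) → (∀ k, ContDiff ℝ ∞ (a k)) →
      (∀ k t, t ∉ Ioo 0 s → a k t = 0) →
      0 ≤ ∑ k, ∑ l, ∫ r, correlation (a k) (a l) r * inner ℝ (K r (X k)) (X l))
    {W : ℝ → H} (hW : Continuous W) (hW0 : ∀ t ≤ 0, W t = 0) :
    0 ≤ ∫ t in (0 : ℝ)..s, inner ℝ (timeConv K W t) (W t) := by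
  rcases hs.eq_or_lt with rfl | hs
  · simp
  have h := integral_inner_kernel_nonneg hK hs hpos hW
  set w := (Ioo 0 s).indicator W with hw
  obtain ⟨C, hC⟩ : ∃ C, ∀ t, ‖w t‖ ≤ C := by
    obtain ⟨C, hC⟩ := (isCompact_Icc (a := 0) (b := s)).exists_bound_of_continuousOn hW.continuousOn
    refine ⟨C, fun t => ?_⟩
    by_cases ht : t ∈ Ioo 0 s
    · rw [hw, indicator_of_mem ht]; exact hC t (Ioo_subset_Icc_self ht)
    · rw [hw, indicator_of_notMem ht, norm_zero]
      exact (norm_nonneg _).trans (hC 0 (left_mem_Icc.2 hs.le))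
  have hwm : AEStronglyMeasurable w := hW.aestronglyMeasurable.indicator measurableSet_Ioo
  have hint : Integrable (fun z : ℝ × ℝ => inner ℝ (K z.2 (w (z.1 - z.2))) (w z.1))
      (volume.prod volume) :=
    (integrable_indicator_mul_norm hK C s).mono' (aestronglyMeasurable_inner_kernel hK hwm)
      (Eventually.of_forall (norm_inner_kernel_le K hC fun t ht => indicator_of_notMem ht _))
  rw [Measure.volume_eq_prod, integral_prod _ hint] at h
  refine h.trans (le_of_eq ?_)
  rw [intervalIntegral.integral_of_le hs.le, integral_Ioc_eq_integral_Ioo,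
    ← integral_indicator measurableSet_Ioo]
  congr 1; ext t
  by_cases ht : t ∈ Ioo 0 s
  · rw [indicator_of_mem ht]
    have hwt : w t = W t := indicator_of_mem ht _
    have hKw : ∀ r, K r (w (t - r)) = K r (W (t - r)) := by
      intro r
      rcases le_or_gt r 0 with hr | hr
      · simp [hK0 r hr]
      · by_cases h1 : t - r ∈ Ioo 0 s
        · rw [hw, indicator_of_mem h1]
        · rw [hw, indicator_of_notMem h1, hW0]
          by_contra h2
          exact h1 ⟨not_le.1 h2, by linarith [ht.2]⟩
    have hi : Integrable fun r => K r (w (t - r)) := by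
      have hm : AEStronglyMeasurable (fun r => K r (w (t - r))) volume :=
        AEStronglyMeasurable.convolution_integrand_snd (ContinuousLinearMap.id ℝ (H →L[ℝ] H))
          hK.aestronglyMeasurable hwm t
      refine (hK.norm.mul_const C).mono' hm (Eventually.of_forall fun r => ?_)
      exact (ContinuousLinearMap.le_opNorm _ _).trans (by gcongr; exact hC _)
    simp only [hwt]
    simp_rw [real_inner_comm (W t)]
    rw [integral_inner hi]
    simp_rw [hKw]
    rfl
  · rw [indicator_of_notMem ht, hw]
    simp [indicator_of_notMem ht]

end PositiveType

/-! ### The memory operator -/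

/-- The operator-valued memory kernel, cut off to the time interval `(0,T)`; the cutoff makes it
integrable on `ℝ` and does not change the memory term on `(0,T)`. -/
def memoryKernel (Λ : Idx → Idx → ℝ → RealLinf) (T : ℝ) : ℝ → FieldSpace →L[ℝ] FieldSpace :=
  (Ioo 0 T).indicator fun t => mulOp fun i j => Λ i j t

theorem memoryKernel_of_nonpos (Λ : Idx → Idx → ℝ → RealLinf) (T : ℝ) {t : ℝ} (ht : t ≤ 0) :
    memoryKernel Λ T t = 0 :=
  indicator_of_notMem (fun h => absurd h.1 (not_lt.2 ht)) _

theorem integrable_memoryKernel {Λ : Idx → Idx → ℝ → RealLinf}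
    (hΛ : ∀ i j, LocallyIntegrable (Λ i j) volume) (T : ℝ) :
    Integrable (memoryKernel Λ T) := by
  have h : IntegrableOn (fun t i j => Λ i j t) (Ioo 0 T) := by
    refine Integrable.of_eval fun i => Integrable.of_eval fun j => ?_
    exact ((hΛ i j).integrableOn_isCompact (isCompact_Icc (a := 0) (b := T))).mono_set
      Ioo_subset_Icc_self
  exact (integrable_indicator_iff measurableSet_Ioo).2 (ContinuousLinearMap.integrable_comp mulOp h)

theorem integrableOn_mulOp_apply {Λ : Idx → Idx → ℝ → RealLinf}
    (hΛ : ∀ i j, LocallyIntegrable (Λ i j) volume) (s : ℝ) (i j : Idx) {g : ℝ → ScalarL2} {C : ℝ}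
    (hg : AEStronglyMeasurable g) (hC : ∀ᵐ t, ‖g t‖ ≤ C) (t : ℝ) :
    IntegrableOn (fun r => linfMul (Λ i j r) (g (t - r))) (Ioo 0 s) := by
  have h1 : IntegrableOn (Λ i j) (Ioo 0 s) :=
    ((hΛ i j).integrableOn_isCompact (isCompact_Icc (a := 0) (b := s))).mono_set Ioo_subset_Icc_self
  have hqm : Measure.QuasiMeasurePreserving (fun r : ℝ => t - r) volume volume :=
    quasiMeasurePreserving_sub_left volume t
  have hm : AEStronglyMeasurable (fun r => linfMul (Λ i j r) (g (t - r)))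
      (volume.restrict (Ioo 0 s)) :=
    linfMul.aestronglyMeasurable_comp₂ h1.aestronglyMeasurable
      (hg.comp_quasiMeasurePreserving hqm).restrict
  refine (h1.norm.mul_const C |>.const_mul ‖linfMul‖).mono' hm ?_
  filter_upwards [ae_restrict_of_ae (hqm.ae hC)] with r hr
  calc ‖linfMul (Λ i j r) (g (t - r))‖ ≤ ‖linfMul‖ * ‖Λ i j r‖ * ‖g (t - r)‖ :=
        linfMul.le_opNorm₂ _ _
    _ ≤ ‖linfMul‖ * ‖Λ i j r‖ * C := by gcongr
    _ = ‖linfMul‖ * (‖Λ i j r‖ * C) := by ring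

/-- On `(0,T)` the memory term is the convolution of the truncated kernel with the field extended by
zero. -/
theorem memory_eq_timeConv {Λ : Idx → Idx → ℝ → RealLinf}
    (hΛ : ∀ i j, LocallyIntegrable (Λ i j) volume) {T : ℝ} {u : ℝ → FieldSpace} {C : ℝ}
    (hu : AEStronglyMeasurable ((Ioo 0 T).indicator u))
    (hC : ∀ᵐ t, ‖(Ioo 0 T).indicator u t‖ ≤ C) {t : ℝ} (ht : t ∈ Ioo 0 T) :
    memory Λ u t = timeConv (memoryKernel Λ T) ((Ioo 0 T).indicator u) t := by
  set v := (Ioo 0 T).indicator u with hv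
  have hint : Integrable fun r => memoryKernel Λ T r (v (t - r)) := by
    have hm : AEStronglyMeasurable (fun r => memoryKernel Λ T r (v (t - r))) volume :=
      AEStronglyMeasurable.convolution_integrand_snd
        (ContinuousLinearMap.id ℝ (FieldSpace →L[ℝ] FieldSpace))
        (integrable_memoryKernel hΛ T).aestronglyMeasurable hu t
    refine ((integrable_memoryKernel hΛ T).norm.mul_const C).mono' hm ?_
    filter_upwards [(quasiMeasurePreserving_sub_left volume t).ae hC] with r hr
    exact (ContinuousLinearMap.le_opNorm _ _).trans (by gcongr)
  have hpt : ∀ r, memoryKernel Λ T r (v (t - r))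
      = (Ioo 0 t).indicator (fun r => mulOp (fun i j => Λ i j r) (v (t - r))) r := by
    intro r
    by_cases hr : r ∈ Ioo 0 t
    · rw [indicator_of_mem hr, memoryKernel,
        indicator_of_mem (show r ∈ Ioo 0 T from ⟨hr.1, hr.2.trans ht.2⟩)]
    · rw [indicator_of_notMem hr]
      by_cases h0 : 0 < r
      · have : v (t - r) = 0 := indicator_of_notMem (fun h => hr ⟨h0, by linarith [h.1]⟩) _
        rw [this, map_zero]
      · rw [memoryKernel_of_nonpos Λ T (not_lt.1 h0)]; rfl
  ext1 i
  have hproj : timeConv (memoryKernel Λ T) v t i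
      = ∫ r, (memoryKernel Λ T r (v (t - r))) i :=
    (ContinuousLinearMap.integral_comp_comm
      (PiLp.proj (𝕜 := ℝ) 2 (fun _ : Idx => ScalarL2) i) hint).symm
  rw [hproj]
  have hvj : ∀ j, AEStronglyMeasurable (fun r => v r j) volume := fun j =>
    (PiLp.proj (𝕜 := ℝ) 2 (fun _ : Idx => ScalarL2) j).continuous.comp_aestronglyMeasurable hu
  have hCj : ∀ j, ∀ᵐ r, ‖v r j‖ ≤ C := fun j => by
    filter_upwards [hC] with r hr using (PiLp.norm_apply_le (v r) j).trans hr
  have e1 : ∀ r, (memoryKernel Λ T r (v (t - r))) i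
      = (Ioo 0 t).indicator (fun r => ∑ j, linfMul (Λ i j r) (v (t - r) j)) r := by
    intro r
    rw [hpt]
    by_cases hr : r ∈ Ioo 0 t
    · rw [indicator_of_mem hr, indicator_of_mem hr, mulOp_apply]
      simp_rw [linfMul_apply]
    · rw [indicator_of_notMem hr, indicator_of_notMem hr]; rfl
  simp_rw [e1]
  rw [integral_indicator measurableSet_Ioo, integral_finsetSum _ fun j _ =>
    integrableOn_mulOp_apply hΛ t i j (hvj j) (hCj j) t]
  change ∑ j, ∫ τ in (0 : ℝ)..t, (Λ i j (t - τ) • u τ j : ScalarL2) = _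
  refine Finset.sum_congr rfl fun j _ => ?_
  have e2 : ∫ τ in (0 : ℝ)..t, (Λ i j (t - τ) • u τ j : ScalarL2)
      = ∫ τ in (0 : ℝ)..t, linfMul (Λ i j (t - τ)) (v (t - (t - τ)) j) := by
    rw [intervalIntegral.integral_of_le ht.1.le, intervalIntegral.integral_of_le ht.1.le,
      integral_Ioc_eq_integral_Ioo, integral_Ioc_eq_integral_Ioo]
    refine setIntegral_congr_fun measurableSet_Ioo fun τ hτ => ?_
    have : v τ = u τ := indicator_of_mem (show τ ∈ Ioo 0 T from ⟨hτ.1, hτ.2.trans ht.2⟩) _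
    simp only [sub_sub_cancel, this, linfMul_apply]
  rw [e2, intervalIntegral.integral_comp_sub_left (fun r => linfMul (Λ i j r) (v (t - r) j)) t,
    sub_self, sub_zero, intervalIntegral.integral_of_le ht.1.le, integral_Ioc_eq_integral_Ioo]

/-- The memory term dissipates energy: for a passive causal kernel, `∫₀ˢ ⟨Λ ⋆ W, W⟩ ≥ 0`. -/
theorem integral_inner_memoryKernel_nonneg
    {Λ : Idx → Idx → ℝ → RealLinf} {Λhat : Idx → Idx → ℝ → ComplexLinf}
    (hΛ : ∀ i j, LocallyIntegrable (Λ i j) volume)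
    (hΛhat : ∀ i j, LocallyIntegrable (Λhat i j) volume)
    (hfourier : ∀ i j, IsFourierTransform (complexify (Λ i j)) (Λhat i j))
    (hcausal : IsCausal Λ) (hpassive : IsPassive Λhat) {s T : ℝ} (hs : 0 ≤ s) (hsT : s < T)
    {W : ℝ → FieldSpace} (hW : Continuous W) (hW0 : ∀ t ≤ 0, W t = 0) :
    0 ≤ ∫ t in (0 : ℝ)..s, inner ℝ (timeConv (memoryKernel Λ T) W t) (W t) := by
  refine integral_inner_timeConv_nonneg (integrable_memoryKernel hΛ T)
    (fun t ht => memoryKernel_of_nonpos Λ T ht) hs (fun n a X ha ha' ha0 => ?_) hW hW0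
  have h := sum_integral_correlation_nonneg hΛ hΛhat hfourier hpassive ha ha' X
  refine h.trans (le_of_eq ?_)
  refine Finset.sum_congr rfl fun k _ => Finset.sum_congr rfl fun l _ => ?_
  have hcaus : ∀ᵐ t : ℝ, t < 0 → ∀ i j, Λ i j t = 0 := by
    have : ∀ᵐ t : ℝ, ∀ i j, t < 0 → Λ i j t = 0 :=
      ae_all_iff.2 fun i => ae_all_iff.2 fun j => hcausal i j
    filter_upwards [this] with t ht h i j using ht i j h
  apply integral_congr_ae
  filter_upwards [hcaus, Measure.ae_ne volume (0 : ℝ)] with r hr hr0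
  by_cases hrT : r ∈ Ioo 0 T
  · rw [memoryKernel, indicator_of_mem hrT]
  · rcases lt_or_gt_of_ne hr0 with h1 | h1
    · have : (fun i j => Λ i j r) = 0 := by
        ext1 i; ext1 j; exact hr h1 i j
      rw [this, map_zero, memoryKernel_of_nonpos Λ T h1.le]
    · -- at times `r ≥ T > s` the correlations of functions supported in `(0,s)` vanish
      have hc : correlation (a k) (a l) r = 0 := by
        unfold correlation
        refine integral_eq_zero_of_ae (Eventually.of_forall fun t => ?_)
        by_cases ht : t ∈ Ioo 0 s
        · have : a k (t - r) = 0 := ha0 k _ fun h2 => hrT ⟨h1, by linarith [h2.1, ht.2]⟩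
          simp [this]
        · simp [ha0 l t ht]
      rw [hc, zero_mul, zero_mul]

theorem timeConv_memoryKernel_scalarOp {Λ : Idx → Idx → ℝ → RealLinf}
    (hΛ : ∀ i j, LocallyIntegrable (Λ i j) volume) (T : ℝ) (ψ : RealLinf) {W : ℝ → FieldSpace}
    (hW : Continuous W) (hW0 : ∀ t ≤ 0, W t = 0) (t : ℝ) :
    timeConv (memoryKernel Λ T) (fun r => scalarOp ψ (W r)) t
      = scalarOp ψ (timeConv (memoryKernel Λ T) W t) := by
  obtain ⟨C, hC⟩ := (isCompact_Icc (a := 0) (b := t)).exists_bound_of_continuousOn hW.continuousOn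
  have hint : Integrable fun r => memoryKernel Λ T r (W (t - r)) := by
    have hm : AEStronglyMeasurable (fun r => memoryKernel Λ T r (W (t - r))) volume :=
      AEStronglyMeasurable.convolution_integrand_snd
        (ContinuousLinearMap.id ℝ (FieldSpace →L[ℝ] FieldSpace))
        (integrable_memoryKernel hΛ T).aestronglyMeasurable hW.aestronglyMeasurable t
    refine ((integrable_memoryKernel hΛ T).norm.mul_const |C|).mono' hm (Eventually.of_forall fun r => ?_)
    rcases le_or_gt r 0 with hr | hr
    · simp [memoryKernel_of_nonpos Λ T hr]
    rcases le_or_gt t r with h | h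
    · rw [hW0 _ (by linarith), map_zero, norm_zero]
      positivity
    · exact (ContinuousLinearMap.le_opNorm _ _).trans
        (by gcongr; exact (hC _ ⟨by linarith, by linarith⟩).trans (le_abs_self C))
  unfold timeConv
  rw [← ContinuousLinearMap.integral_comp_comm _ hint]
  congr 1; ext1 r
  by_cases hr : r ∈ Ioo 0 T
  · rw [memoryKernel, indicator_of_mem hr, mulOp_scalarOp]
  · rw [memoryKernel, indicator_of_notMem hr]; simp

/-- The memory term also dissipates energy locally: a nonnegative weight in space is the square of
another one, which commutes with the kernel. -/
theorem integral_inner_memoryKernel_weight_nonneg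
    {Λ : Idx → Idx → ℝ → RealLinf} {Λhat : Idx → Idx → ℝ → ComplexLinf}
    (hΛ : ∀ i j, LocallyIntegrable (Λ i j) volume)
    (hΛhat : ∀ i j, LocallyIntegrable (Λhat i j) volume)
    (hfourier : ∀ i j, IsFourierTransform (complexify (Λ i j)) (Λhat i j))
    (hcausal : IsCausal Λ) (hpassive : IsPassive Λhat) {s T : ℝ} (hs : 0 ≤ s) (hsT : s < T)
    {W : ℝ → FieldSpace} (hW : Continuous W) (hW0 : ∀ t ≤ 0, W t = 0) {ψ χ : RealLinf}
    (hψ : ∀ᵐ x : Space, ψ x = χ x * χ x) :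
    0 ≤ ∫ t in (0 : ℝ)..s, inner ℝ (timeConv (memoryKernel Λ T) W t) (scalarOp ψ (W t)) := by
  have h := integral_inner_memoryKernel_nonneg hΛ hΛhat hfourier hcausal hpassive hs hsT
    (W := fun t => scalarOp χ (W t)) ((scalarOp χ).continuous.comp hW)
    (fun t ht => by rw [hW0 t ht, map_zero])
  have hsq : ∀ w, scalarOp ψ w = scalarOp χ (scalarOp χ w) := by
    intro w
    apply field_ext
    filter_upwards [hψ, coeFn_scalarOp ψ w, coeFn_scalarOp χ w, coeFn_scalarOp χ (scalarOp χ w)]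
      with x h1 h2 h3 h4 i
    rw [h2, h4, h3, h1, mul_assoc]
  refine h.trans (le_of_eq ?_)
  congr 1; ext t
  rw [timeConv_memoryKernel_scalarOp hΛ T χ hW hW0, inner_scalarOp_left, hsq]

/-! ### The weak curl -/

theorem integrable_coe_mul_continuous (w : ScalarL2) {c : Space → ℝ} (hc : Continuous c)
    (hcs : HasCompactSupport c) : Integrable (fun x : Space => w x * c x) :=
  (Lp.memLp w).integrable_mul (hc.memLp_of_hasCompactSupport (p := 2) hcs)

theorem contDiff_partialDeriv {φ : Space → Space} (hφ : ContDiff ℝ ∞ φ) (j i : Fin 3) :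
    ContDiff ℝ ∞ (partialDeriv φ j i) := by
  have h : ContDiff ℝ ∞ (fun x => fderiv ℝ φ x (EuclideanSpace.single j 1)) :=
    (hφ.fderiv_right (m := ∞) (by simp)).clm_apply contDiff_const
  exact (EuclideanSpace.proj (𝕜 := ℝ) (i : Fin 3)).contDiff.comp h

theorem hasCompactSupport_partialDeriv {φ : Space → Space} (hφ : HasCompactSupport φ)
    (j i : Fin 3) : HasCompactSupport (partialDeriv φ j i) := by
  have h : HasCompactSupport (fun x => fderiv ℝ φ x) := hφ.fderiv ℝ
  exact h.comp_left (g := fun L : Space →L[ℝ] Space => (L (EuclideanSpace.single j 1)) i) (by simp)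

theorem contDiff_curl {φ : Space → Space} (hφ : ContDiff ℝ ∞ φ) (i : Fin 3) :
    ContDiff ℝ ∞ (fun x => curl φ x i) := by
  fin_cases i <;>
  exact (contDiff_partialDeriv hφ _ _).sub (contDiff_partialDeriv hφ _ _)

theorem hasCompactSupport_curl {φ : Space → Space} (hφ : HasCompactSupport φ) (i : Fin 3) :
    HasCompactSupport (fun x => curl φ x i) := by
  fin_cases i <;>
  exact (hasCompactSupport_partialDeriv hφ _ _).sub (hasCompactSupport_partialDeriv hφ _ _)

theorem contDiff_coord {φ : Space → Space} (hφ : ContDiff ℝ ∞ φ) (i : Fin 3) :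
    ContDiff ℝ ∞ (fun x => φ x i) :=
  (EuclideanSpace.proj (𝕜 := ℝ) (i : Fin 3)).contDiff.comp hφ

theorem hasCompactSupport_coord {φ : Space → Space} (hφ : HasCompactSupport φ) (i : Fin 3) :
    HasCompactSupport (fun x => φ x i) :=
  hφ.comp_left (g := fun v : Space => v i) (by simp)

theorem integral_partialDeriv_mul {φ χ : Space → Space} (hφ : ContDiff ℝ ∞ φ)
    (hφc : HasCompactSupport φ) (hχ : ContDiff ℝ ∞ χ) (j i k : Fin 3) :
    ∫ x, φ x i * partialDeriv χ j k x = -∫ x, partialDeriv φ j i x * χ x k := by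
  have hd : ∀ {φ : Space → Space}, ContDiff ℝ ∞ φ → ∀ i x,
      fderiv ℝ (fun x => φ x i) x (EuclideanSpace.single j 1) = partialDeriv φ j i x := by
    intro φ hφ i x
    have h1 := ((EuclideanSpace.proj (𝕜 := ℝ) (i : Fin 3)).hasFDerivAt.comp x
      (hφ.differentiable (by simp) x).hasFDerivAt).fderiv
    have h2 : (fun x => φ x i) = (EuclideanSpace.proj (𝕜 := ℝ) i : Space →L[ℝ] ℝ) ∘ φ := rfl
    rw [h2, h1]
    rfl
  have h := integral_mul_fderiv_eq_neg_fderiv_mul_of_integrable (μ := (volume : Measure Space))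
    (f := fun x => φ x i) (g := fun x => χ x k) (v := EuclideanSpace.single j 1) ?_ ?_ ?_
    (fun x _ => (contDiff_coord hφ i).differentiable (by simp) x)
    (fun x _ => (contDiff_coord hχ k).differentiable (by simp) x)
  · simpa only [hd hφ, hd hχ] using h
  · simp only [hd hφ]
    exact ((contDiff_partialDeriv hφ j i).continuous.mul
      (contDiff_coord hχ k).continuous).integrable_of_hasCompactSupport
      (hasCompactSupport_partialDeriv hφc j i).mul_right
  · simp only [hd hχ]
    exact ((contDiff_coord hφ i).continuous.mul
      (contDiff_partialDeriv hχ j k).continuous).integrable_of_hasCompactSupport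
      (hasCompactSupport_coord hφc i).mul_right
  · exact ((contDiff_coord hφ i).continuous.mul
      (contDiff_coord hχ k).continuous).integrable_of_hasCompactSupport
      (hasCompactSupport_coord hφc i).mul_right

theorem integral_sub_add_sub_add_sub {a₁ a₂ b₁ b₂ c₁ c₂ : Space → ℝ} (ha₁ : Integrable a₁)
    (ha₂ : Integrable a₂) (hb₁ : Integrable b₁) (hb₂ : Integrable b₂) (hc₁ : Integrable c₁)
    (hc₂ : Integrable c₂) :
    ∫ x, (a₁ x - a₂ x) + (b₁ x - b₂ x) + (c₁ x - c₂ x)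
      = (∫ x, a₁ x) - (∫ x, a₂ x) + ((∫ x, b₁ x) - ∫ x, b₂ x) + ((∫ x, c₁ x) - ∫ x, c₂ x) := by
  have e1 := integral_add ((ha₁.sub ha₂).add (hb₁.sub hb₂)) (hc₁.sub hc₂)
  have e2 := integral_add (ha₁.sub ha₂) (hb₁.sub hb₂)
  have e3 := integral_sub ha₁ ha₂
  have e4 := integral_sub hb₁ hb₂
  have e5 := integral_sub hc₁ hc₂
  simp only [Pi.add_apply, Pi.sub_apply] at e1 e2
  rw [e1, e2, e3, e4, e5]

/-- The curl is symmetric on test fields. -/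
theorem integral_dotProduct_curl {φ χ : Space → Space} (hφ : ContDiff ℝ ∞ φ)
    (hφc : HasCompactSupport φ) (hχ : ContDiff ℝ ∞ χ) :
    ∫ x, (φ x).ofLp ⬝ᵥ curl χ x = ∫ x, curl φ x ⬝ᵥ (χ x).ofLp := by
  have i1 : ∀ i j k, Integrable fun x => φ x i * partialDeriv χ j k x := fun i j k =>
    ((contDiff_coord hφ i).continuous.mul
      (contDiff_partialDeriv hχ j k).continuous).integrable_of_hasCompactSupport
      (hasCompactSupport_coord hφc i).mul_right
  have i2 : ∀ i j k, Integrable fun x => partialDeriv φ j i x * χ x k := fun i j k =>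
    ((contDiff_partialDeriv hφ j i).continuous.mul
      (contDiff_coord hχ k).continuous).integrable_of_hasCompactSupport
      (hasCompactSupport_partialDeriv hφc j i).mul_right
  have e1 : ∀ x, (φ x).ofLp ⬝ᵥ curl χ x
      = (φ x 0 * partialDeriv χ 1 2 x - φ x 0 * partialDeriv χ 2 1 x)
        + (φ x 1 * partialDeriv χ 2 0 x - φ x 1 * partialDeriv χ 0 2 x)
        + (φ x 2 * partialDeriv χ 0 1 x - φ x 2 * partialDeriv χ 1 0 x) := by
    intro x
    simp [dotProduct, Fin.sum_univ_three, curl]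
    ring
  have e2 : ∀ x, curl φ x ⬝ᵥ (χ x).ofLp
      = (partialDeriv φ 1 2 x * χ x 0 - partialDeriv φ 2 1 x * χ x 0)
        + (partialDeriv φ 2 0 x * χ x 1 - partialDeriv φ 0 2 x * χ x 1)
        + (partialDeriv φ 0 1 x * χ x 2 - partialDeriv φ 1 0 x * χ x 2) := by
    intro x
    simp [dotProduct, Fin.sum_univ_three, curl]
    ring
  simp_rw [e1, e2]
  rw [integral_sub_add_sub_add_sub (i1 0 1 2) (i1 0 2 1) (i1 1 2 0) (i1 1 0 2) (i1 2 0 1)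
    (i1 2 1 0), integral_sub_add_sub_add_sub (i2 2 1 0) (i2 1 2 0) (i2 0 2 1) (i2 2 0 1) (i2 1 0 2)
    (i2 0 1 2)]
  simp only [integral_partialDeriv_mul hφ hφc hχ]
  ring

/-- The gradient of a scalar function, as a coordinate vector. -/
def gradient (ψ : Space → ℝ) (x : Space) : Fin 3 → ℝ :=
  fun j => fderiv ℝ ψ x (EuclideanSpace.single j 1)

theorem crossProduct_apply_eq (a b : Fin 3 → ℝ) (i : Fin 3) :
    crossProduct a b i = a (i + 1) * b (i + 2) - a (i + 2) * b (i + 1) := by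
  rw [cross_apply]
  fin_cases i <;> rfl

theorem curl_smul {ψ : Space → ℝ} {φ : Space → Space} (hψ : ContDiff ℝ ∞ ψ) (hφ : ContDiff ℝ ∞ φ)
    (x : Space) : curl (fun x => ψ x • φ x) x
      = ψ x • curl φ x + crossProduct (gradient ψ x) (φ x).ofLp := by
  have h : ∀ j i, partialDeriv (fun x => ψ x • φ x) j i x
      = ψ x * partialDeriv φ j i x + gradient ψ x j * φ x i := by
    intro j i
    unfold partialDeriv
    rw [fderiv_fun_smul (hψ.differentiable (by simp) x) (hφ.differentiable (by simp) x)]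
    simp [gradient]
  rw [cross_apply]
  ext i
  fin_cases i <;> simp [curl, h] <;> ring

theorem contDiff_gradient {ψ : Space → ℝ} (hψ : ContDiff ℝ ∞ ψ) (j : Fin 3) :
    ContDiff ℝ ∞ (fun x => gradient ψ x j) :=
  (hψ.fderiv_right (m := ∞) (by simp)).clm_apply contDiff_const

theorem hasCompactSupport_gradient {ψ : Space → ℝ} (hψ : HasCompactSupport ψ) (j : Fin 3) :
    HasCompactSupport (fun x => gradient ψ x j) :=
  (hψ.fderiv ℝ).comp_left (g := fun L : Space →L[ℝ] ℝ => L (EuclideanSpace.single j 1)) (by simp)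

theorem integrable_dotProduct (w : Fin 3 → ScalarL2) {c : Space → Fin 3 → ℝ}
    (hc : ∀ i, Continuous fun x => c x i) (hcs : ∀ i, HasCompactSupport fun x => c x i) :
    Integrable fun x : Space => (fun i => w i x) ⬝ᵥ c x :=
  integrable_finsetSum _ fun i _ => integrable_coe_mul_continuous (w i) (hc i) (hcs i)

/-- Product rule for the weak curl and a smooth compactly supported weight: it needs no
regularization, as the weight can be moved onto the test field. -/
theorem HasWeakCurl.mul {w g w' g' : Fin 3 → ScalarL2} (h : HasWeakCurl w g) {ψ : Space → ℝ}
    (hψ : ContDiff ℝ ∞ ψ) (hw' : ∀ᵐ x : Space, ∀ i, w' i x = ψ x * w i x)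
    (hg' : ∀ᵐ x : Space, ∀ i, g' i x
      = ψ x * g i x + crossProduct (gradient ψ x) (fun i => w i x) i) :
    HasWeakCurl w' g' := by
  intro φ hφ hφc
  have hψφc : HasCompactSupport fun x => ψ x • φ x := HasCompactSupport.intro hφc fun x hx => by
    rw [image_eq_zero_of_notMem_tsupport hx, smul_zero]
  have h1 := h (fun x => ψ x • φ x) (hψ.smul hφ) hψφc
  have hsm : ∀ i, ContDiff ℝ ∞ fun x => crossProduct (gradient ψ x) (φ x).ofLp i := by
    intro i
    simp only [crossProduct_apply_eq]
    exact ((contDiff_gradient hψ _).mul (contDiff_coord hφ _)).sub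
      ((contDiff_gradient hψ _).mul (contDiff_coord hφ _))
  have hcs : ∀ i, HasCompactSupport fun x => crossProduct (gradient ψ x) (φ x).ofLp i := by
    intro i
    refine HasCompactSupport.intro hφc fun x hx => ?_
    rw [image_eq_zero_of_notMem_tsupport hx, WithLp.ofLp_zero, map_zero, Pi.zero_apply]
  have i1 := integrable_dotProduct w (c := fun x => curl (fun x => ψ x • φ x) x)
    (fun i => (contDiff_curl (hψ.smul hφ) i).continuous)
    (fun i => hasCompactSupport_curl hψφc i)
  have i2 := integrable_dotProduct w (c := fun x => crossProduct (gradient ψ x) (φ x).ofLp)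
    (fun i => (hsm i).continuous) hcs
  have i3 := integrable_dotProduct g (c := fun x => (ψ x • φ x).ofLp)
    (fun i => (contDiff_coord (hψ.smul hφ) i).continuous)
    (fun i => hasCompactSupport_coord hψφc i)
  have e1 : ∫ x : Space, (fun i => w' i x) ⬝ᵥ curl φ x
      = ∫ x : Space, ((fun i => w i x) ⬝ᵥ curl (fun x => ψ x • φ x) x
        - (fun i => w i x) ⬝ᵥ crossProduct (gradient ψ x) (φ x).ofLp) := by
    apply integral_congr_ae
    filter_upwards [hw'] with x hx
    rw [curl_smul hψ hφ, dotProduct_add, add_sub_cancel_right]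
    simp only [dotProduct, hx, Pi.smul_apply, smul_eq_mul]
    exact Finset.sum_congr rfl fun i _ => by ring
  have e2 : ∫ x : Space, (fun i => g' i x) ⬝ᵥ (φ x).ofLp
      = ∫ x : Space, ((fun i => g i x) ⬝ᵥ (ψ x • φ x).ofLp
        - (fun i => w i x) ⬝ᵥ crossProduct (gradient ψ x) (φ x).ofLp) := by
    apply integral_congr_ae
    filter_upwards [hg'] with x hx
    simp only [dotProduct, hx, Fin.sum_univ_three, crossProduct_apply_eq, PiLp.smul_apply,
      smul_eq_mul]
    have e21 : (2 : Fin 3) + 1 = 0 := rfl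
    have e22 : (2 : Fin 3) + 2 = 1 := rfl
    have e12 : (1 : Fin 3) + 2 = 0 := rfl
    have e11 : (1 : Fin 3) + 1 = 2 := rfl
    simp only [e21, e22, e12, e11, zero_add]
    ring
  rw [e1, e2, integral_sub i1 i2, integral_sub i3 i2, h1]

/-- A test field as an element of `L²(ℝ³)³`. -/
def testL2 {φ : Space → Space} (hφ : ContDiff ℝ ∞ φ) (hφc : HasCompactSupport φ) (i : Fin 3) :
    ScalarL2 :=
  ((contDiff_coord hφ i).continuous.memLp_of_hasCompactSupport (p := 2)
    (hasCompactSupport_coord hφc i)).toLp _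

/-- The curl of a test field as an element of `L²(ℝ³)³`. -/
def curlL2 {φ : Space → Space} (hφ : ContDiff ℝ ∞ φ) (hφc : HasCompactSupport φ) (i : Fin 3) :
    ScalarL2 :=
  ((contDiff_curl hφ i).continuous.memLp_of_hasCompactSupport (p := 2)
    (hasCompactSupport_curl hφc i)).toLp _

theorem coeFn_testL2 {φ : Space → Space} (hφ : ContDiff ℝ ∞ φ) (hφc : HasCompactSupport φ) :
    ∀ᵐ x : Space, ∀ i, testL2 hφ hφc i x = φ x i :=
  ae_all_iff.2 fun _ => MemLp.coeFn_toLp _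

theorem coeFn_curlL2 {φ : Space → Space} (hφ : ContDiff ℝ ∞ φ) (hφc : HasCompactSupport φ) :
    ∀ᵐ x : Space, ∀ i, curlL2 hφ hφc i x = curl φ x i :=
  ae_all_iff.2 fun _ => MemLp.coeFn_toLp _

theorem hasWeakCurl_testL2 {φ : Space → Space} (hφ : ContDiff ℝ ∞ φ) (hφc : HasCompactSupport φ) :
    HasWeakCurl (testL2 hφ hφc) (curlL2 hφ hφc) := by
  intro χ hχ _
  have h := integral_dotProduct_curl hφ hφc hχ
  refine Eq.trans ?_ (h.trans ?_)
  · apply integral_congr_ae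
    filter_upwards [coeFn_testL2 hφ hφc] with x hx
    simp only [hx]
  · apply integral_congr_ae
    filter_upwards [coeFn_curlL2 hφ hφc] with x hx
    simp only [hx]

theorem ae_zero : ∀ᵐ x : Space, ∀ i : Fin 3, (0 : Fin 3 → ScalarL2) i x = 0 :=
  ae_all_iff.2 fun _ => Lp.coeFn_zero ℝ 2 (volume : Measure Space)

theorem hasWeakCurl_zero : HasWeakCurl 0 0 := by
  intro φ _ _
  trans (0 : ℝ)
  · refine integral_eq_zero_of_ae ?_
    filter_upwards [ae_zero] with x hx
    exact Finset.sum_eq_zero fun i _ => mul_eq_zero_of_left (hx i) _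
  · symm
    refine integral_eq_zero_of_ae ?_
    filter_upwards [ae_zero] with x hx
    exact Finset.sum_eq_zero fun i _ => mul_eq_zero_of_left (hx i) _

/-- The field with given electric and magnetic parts. -/
def fieldOf (e h : Fin 3 → ScalarL2) : FieldSpace := WithLp.toLp 2 (Sum.elim e h)

theorem electric_fieldOf (e h : Fin 3 → ScalarL2) : electric (fieldOf e h) = e := rfl

theorem magnetic_fieldOf (e h : Fin 3 → ScalarL2) : magnetic (fieldOf e h) = h := rfl

theorem inner_eq_integral_add (u v : FieldSpace) :
    inner ℝ u v = (∫ x : Space, ∑ i, electric u i x * electric v i x)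
      + ∫ x : Space, ∑ i, magnetic u i x * magnetic v i x := by
  rw [inner_eq_integral, ← integral_add
    (integrable_finsetSum _ fun i _ => integrable_coe_mul _ _)
    (integrable_finsetSum _ fun i _ => integrable_coe_mul _ _)]
  congr 1; ext x
  rw [Fintype.sum_sum_type]
  rfl

/-- A field which satisfies the weak form of `𝔸 W = -K` against the whole domain of the Maxwell
operator belongs to that domain. -/
theorem hasMaxwell_of_forall_inner {W K : FieldSpace}
    (h : ∀ v Av : FieldSpace, HasMaxwell v Av → inner ℝ K v = inner ℝ W Av) :
    HasMaxwell W (-K) := by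
  constructor
  · intro φ hφ hφc
    have h1 := h (fieldOf (testL2 hφ hφc) 0) (fieldOf 0 (-curlL2 hφ hφc))
      ⟨hasWeakCurl_zero, by
        rw [electric_fieldOf, magnetic_fieldOf, neg_neg]; exact hasWeakCurl_testL2 hφ hφc⟩
    rw [inner_eq_integral_add, inner_eq_integral_add] at h1
    simp only [electric_fieldOf, magnetic_fieldOf] at h1
    have e1 : ∫ x : Space, ∑ i, electric K i x * testL2 hφ hφc i x
        = -∫ x : Space, (fun i => electric (-K) i x) ⬝ᵥ (φ x).ofLp := by
      rw [← integral_neg]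
      apply integral_congr_ae
      have hn : ∀ᵐ x : Space, ∀ i, electric (-K) i x = -electric K i x :=
        ae_all_iff.2 fun i => Lp.coeFn_neg (electric K i)
      filter_upwards [coeFn_testL2 hφ hφc, hn] with x hx hn
      simp only [dotProduct, hx, hn, neg_mul, Finset.sum_neg_distrib, neg_neg]
    have e2 : ∫ x : Space, ∑ i, magnetic W i x * (-curlL2 hφ hφc) i x
        = -∫ x : Space, (fun i => magnetic W i x) ⬝ᵥ curl φ x := by
      rw [← integral_neg]
      apply integral_congr_ae
      have hn : ∀ᵐ x : Space, ∀ i, (-curlL2 hφ hφc) i x = -curlL2 hφ hφc i x :=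
        ae_all_iff.2 fun i => Lp.coeFn_neg (curlL2 hφ hφc i)
      filter_upwards [coeFn_curlL2 hφ hφc, hn] with x hx hn
      simp only [dotProduct, hx, hn, mul_neg, Finset.sum_neg_distrib]
    have e3 : ∀ w : Fin 3 → ScalarL2,
        ∫ x : Space, ∑ i, w i x * (0 : Fin 3 → ScalarL2) i x = 0 := by
      intro w
      refine integral_eq_zero_of_ae ?_
      filter_upwards [ae_zero] with x hx
      exact Finset.sum_eq_zero fun i _ => by rw [hx i, mul_zero]
    rw [e1, e2, e3, e3] at h1
    linarith
  · intro φ hφ hφc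
    have h1 := h (fieldOf 0 (testL2 hφ hφc)) (fieldOf (curlL2 hφ hφc) 0)
      ⟨hasWeakCurl_testL2 hφ hφc, by
        rw [electric_fieldOf, magnetic_fieldOf, neg_zero]; exact hasWeakCurl_zero⟩
    rw [inner_eq_integral_add, inner_eq_integral_add] at h1
    simp only [electric_fieldOf, magnetic_fieldOf] at h1
    have e1 : ∫ x : Space, ∑ i, magnetic K i x * testL2 hφ hφc i x
        = ∫ x : Space, (fun i => (-magnetic (-K)) i x) ⬝ᵥ (φ x).ofLp := by
      apply integral_congr_ae
      have hK : -magnetic (-K) = magnetic K := by ext1 i; exact neg_neg _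
      filter_upwards [coeFn_testL2 hφ hφc] with x hx
      simp only [dotProduct, hx, hK]
    have e2 : ∫ x : Space, ∑ i, electric W i x * curlL2 hφ hφc i x
        = ∫ x : Space, (fun i => electric W i x) ⬝ᵥ curl φ x := by
      apply integral_congr_ae
      filter_upwards [coeFn_curlL2 hφ hφc] with x hx
      simp only [dotProduct, hx]
    have e3 : ∀ w : Fin 3 → ScalarL2,
        ∫ x : Space, ∑ i, w i x * (0 : Fin 3 → ScalarL2) i x = 0 := by
      intro w
      refine integral_eq_zero_of_ae ?_
      filter_upwards [ae_zero] with x hx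
      exact Finset.sum_eq_zero fun i _ => by rw [hx i, mul_zero]
    rw [e1, e2, e3, e3] at h1
    linarith

/-! ### Localization of the Maxwell operator -/

open Classical in
/-- The element of `L^∞(ℝ³)` given by a bounded measurable function (zero for other functions). -/
def linfOf (h : Space → ℝ) : RealLinf :=
  if hh : MemLp h ⊤ (volume : Measure Space) then hh.toLp h else 0

theorem coeFn_linfOf {h : Space → ℝ} (hh : MemLp h ⊤ (volume : Measure Space)) :
    ∀ᵐ x : Space, linfOf h x = h x := by
  rw [linfOf, dif_pos hh]
  exact hh.coeFn_toLp

theorem memLp_top_of_continuous {h : Space → ℝ} (hc : Continuous h) (hs : HasCompactSupport h) :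
    MemLp h ⊤ (volume : Measure Space) :=
  hc.memLp_of_hasCompactSupport hs

/-- The vector product of a bounded vector field with a field in `L²(ℝ³)³`. -/
def crossL2 (G : Fin 3 → RealLinf) (w : Fin 3 → ScalarL2) (i : Fin 3) : ScalarL2 :=
  linfMul (G (i + 1)) (w (i + 2)) - linfMul (G (i + 2)) (w (i + 1))

theorem coeFn_linfMul (g : RealLinf) (w : ScalarL2) :
    ∀ᵐ x : Space, linfMul g w x = g x * w x := by
  rw [linfMul_apply]
  exact Lp.coeFn_lpSMul (r := 2) g w

theorem coeFn_crossL2 {ψ : Space → ℝ} (hψ : ContDiff ℝ ∞ ψ) (hψc : HasCompactSupport ψ)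
    (w : Fin 3 → ScalarL2) :
    ∀ᵐ x : Space, ∀ i, crossL2 (fun j => linfOf fun x => gradient ψ x j) w i x
      = crossProduct (gradient ψ x) (fun i => w i x) i := by
  rw [ae_all_iff]
  intro i
  have hG : ∀ j, ∀ᵐ x : Space, linfOf (fun x => gradient ψ x j) x = gradient ψ x j := fun j =>
    coeFn_linfOf (memLp_top_of_continuous (contDiff_gradient hψ j).continuous
      (hasCompactSupport_gradient hψc j))
  filter_upwards [coeFn_linfMul (linfOf fun x => gradient ψ x (i + 1)) (w (i + 2)),
    coeFn_linfMul (linfOf fun x => gradient ψ x (i + 2)) (w (i + 1)), hG (i + 1), hG (i + 2),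
    Lp.coeFn_sub (linfMul (linfOf fun x => gradient ψ x (i + 1)) (w (i + 2)))
      (linfMul (linfOf fun x => gradient ψ x (i + 2)) (w (i + 1)))] with x h1 h2 h3 h4 h5
  rw [crossL2, h5, Pi.sub_apply, h1, h2, h3, h4, crossProduct_apply_eq]

/-- The commutator of the Maxwell operator with a scalar weight:
`(E, H) ↦ (∇ψ × H, -∇ψ × E)`. -/
def gradField (ψ : Space → ℝ) (v : FieldSpace) : FieldSpace :=
  fieldOf (crossL2 (fun j => linfOf fun x => gradient ψ x j) (magnetic v))
    (-crossL2 (fun j => linfOf fun x => gradient ψ x j) (electric v))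

theorem HasMaxwell.scalarOp {v g : FieldSpace} (h : HasMaxwell v g) {ψ : Space → ℝ}
    (hψ : ContDiff ℝ ∞ ψ) (hψc : HasCompactSupport ψ) :
    HasMaxwell (scalarOp (linfOf ψ) v) (scalarOp (linfOf ψ) g + gradField ψ v) := by
  have hl := coeFn_linfOf (memLp_top_of_continuous hψ.continuous hψc)
  constructor
  · refine h.1.mul hψ ?_ ?_
    · filter_upwards [hl, coeFn_scalarOp (linfOf ψ) v] with x h1 h2 i
      rw [← h1]; exact h2 (Sum.inr i)
    · have hadd : ∀ᵐ x : Space, ∀ i, electric (Maxwell.scalarOp (linfOf ψ) g + gradField ψ v) i x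
          = electric (Maxwell.scalarOp (linfOf ψ) g) i x + electric (gradField ψ v) i x :=
        ae_all_iff.2 fun i => Lp.coeFn_add _ _
      filter_upwards [hl, coeFn_scalarOp (linfOf ψ) g, coeFn_crossL2 hψ hψc (magnetic v), hadd]
        with x h1 h2 h3 h4 i
      rw [h4, ← h3, ← h1]
      exact congrArg (· + _) (h2 (Sum.inl i))
  · refine h.2.mul hψ ?_ ?_
    · filter_upwards [hl, coeFn_scalarOp (linfOf ψ) v] with x h1 h2 i
      rw [← h1]; exact h2 (Sum.inl i)
    · have hadd : ∀ᵐ x : Space, ∀ i,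
          (-magnetic (Maxwell.scalarOp (linfOf ψ) g + gradField ψ v)) i x
          = -(magnetic (Maxwell.scalarOp (linfOf ψ) g) i x)
            + crossL2 (fun j => linfOf fun x => gradient ψ x j) (electric v) i x := by
        refine ae_all_iff.2 fun i => ?_
        have e : (-magnetic (Maxwell.scalarOp (linfOf ψ) g + gradField ψ v)) i
            = -(magnetic (Maxwell.scalarOp (linfOf ψ) g) i)
              + crossL2 (fun j => linfOf fun x => gradient ψ x j) (electric v) i := by
          change -(magnetic (Maxwell.scalarOp (linfOf ψ) g) i
              + -crossL2 (fun j => linfOf fun x => gradient ψ x j) (electric v) i) = _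
          rw [neg_add, neg_neg]
        rw [e]
        filter_upwards [Lp.coeFn_add (-(magnetic (Maxwell.scalarOp (linfOf ψ) g) i))
          (crossL2 (fun j => linfOf fun x => gradient ψ x j) (electric v) i),
          Lp.coeFn_neg (magnetic (Maxwell.scalarOp (linfOf ψ) g) i)] with x h1 h2
        rw [h1, Pi.add_apply, h2, Pi.neg_apply]
      have hneg : ∀ᵐ x : Space, ∀ i, (-magnetic g) i x = -(magnetic g i x) :=
        ae_all_iff.2 fun i => Lp.coeFn_neg (magnetic g i)
      filter_upwards [hl, coeFn_scalarOp (linfOf ψ) g, coeFn_crossL2 hψ hψc (electric v), hadd,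
        hneg] with x h1 h2 h3 h4 h5 i
      rw [h4, ← h3, ← h1, h5, mul_neg]
      exact congrArg (fun s => -s + _) (h2 (Sum.inr i))

/-- The energy flux of a field through the level sets of a weight: the density
`E · (∇ψ × H)`. -/
def fluxDensity (ψ : Space → ℝ) (W : FieldSpace) (x : Space) : ℝ :=
  (fun i => electric W i x) ⬝ᵥ crossProduct (gradient ψ x) (fun i => magnetic W i x)

theorem inner_gradField {ψ : Space → ℝ} (hψ : ContDiff ℝ ∞ ψ) (hψc : HasCompactSupport ψ)
    (W : FieldSpace) : inner ℝ W (gradField ψ W) = ∫ x : Space, 2 * fluxDensity ψ W x := by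
  rw [inner_eq_integral]
  have hneg : ∀ᵐ x : Space, ∀ i,
      (-crossL2 (fun j => linfOf fun x => gradient ψ x j) (electric W)) i x
      = -(crossL2 (fun j => linfOf fun x => gradient ψ x j) (electric W) i x) :=
    ae_all_iff.2 fun i => Lp.coeFn_neg _
  apply integral_congr_ae
  filter_upwards [coeFn_crossL2 hψ hψc (electric W), coeFn_crossL2 hψ hψc (magnetic W), hneg]
    with x h1 h2 h3
  have e : ∑ i, W i x * gradField ψ W i x
      = ∑ i, electric W i x * crossL2 (fun j => linfOf fun x => gradient ψ x j) (magnetic W) i x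
        + ∑ i, magnetic W i x *
          (-crossL2 (fun j => linfOf fun x => gradient ψ x j) (electric W)) i x := by
    rw [Fintype.sum_sum_type]
    rfl
  rw [e]
  simp only [h3, h1, h2, fluxDensity, dotProduct, Fin.sum_univ_three, crossProduct_apply_eq]
  have e21 : (2 : Fin 3) + 1 = 0 := rfl
  have e22 : (2 : Fin 3) + 2 = 1 := rfl
  have e12 : (1 : Fin 3) + 2 = 0 := rfl
  have e11 : (1 : Fin 3) + 1 = 2 := rfl
  simp only [e21, e22, e12, e11, zero_add]
  ring

/-- Energy identity for a localized field. The equation tested with `ψ W`, which belongs to the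
domain of the Maxwell operator `𝔸`, leaves only the commutator of `𝔸` with `ψ`, since `𝔸` is
skew-symmetric. -/
theorem inner_scalarOp_eq_integral_fluxDensity {W K : FieldSpace}
    (h : ∀ v Av : FieldSpace, HasMaxwell v Av → inner ℝ K v = inner ℝ W Av) {ψ : Space → ℝ}
    (hψ : ContDiff ℝ ∞ ψ) (hψc : HasCompactSupport ψ) :
    inner ℝ K (scalarOp (linfOf ψ) W) = ∫ x : Space, fluxDensity ψ W x := by
  have h1 := h _ _ ((hasMaxwell_of_forall_inner h).scalarOp hψ hψc)
  rw [inner_add_right, map_neg, inner_neg_right, inner_gradField hψ hψc,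
    ← inner_scalarOp_left, real_inner_comm, ← inner_scalarOp_left, integral_const_mul,
    real_inner_comm] at h1
  linarith

/-! ### The mass matrix and the local speed -/

theorem sum_eigenvectorBasis {A : Matrix (Fin 3) (Fin 3) ℝ} (hA : A.IsHermitian)
    (ξ η : Fin 3 → ℝ) :
    ∑ i, (ξ ⬝ᵥ (hA.eigenvectorBasis i).ofLp) * (η ⬝ᵥ (hA.eigenvectorBasis i).ofLp) = ξ ⬝ᵥ η := by
  have h := hA.eigenvectorBasis.sum_inner_mul_inner (WithLp.toLp 2 ξ) (WithLp.toLp 2 η)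
  simp only [EuclideanSpace.inner_eq_star_dotProduct, star_trivial] at h
  rw [dotProduct_comm ξ η, ← h]
  exact Finset.sum_congr rfl fun i _ => by rw [dotProduct_comm ξ]

theorem dotProduct_mulVec_eq_sum {A : Matrix (Fin 3) (Fin 3) ℝ} (hA : A.IsHermitian)
    (ξ : Fin 3 → ℝ) :
    ξ ⬝ᵥ A.mulVec ξ
      = ∑ i, hA.eigenvalues i * (ξ ⬝ᵥ (hA.eigenvectorBasis i).ofLp) ^ 2 := by
  rw [← sum_eigenvectorBasis hA]
  refine Finset.sum_congr rfl fun i _ => ?_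
  have hs : A.transpose = A := by simpa using hA.eq
  have : A.mulVec ξ ⬝ᵥ (hA.eigenvectorBasis i).ofLp
      = hA.eigenvalues i * (ξ ⬝ᵥ (hA.eigenvectorBasis i).ofLp) := by
    rw [dotProduct_comm, Matrix.dotProduct_mulVec, ← Matrix.mulVec_transpose, hs,
      hA.mulVec_eigenvectorBasis, smul_dotProduct, dotProduct_comm, smul_eq_mul]
  rw [this]; ring

/-- The eigenvalues of `A^{-1/2}` are the powers `-1/2` of those of `A`. -/
theorem hasEigenvalue_invSqrt_iff {A : Matrix (Fin 3) (Fin 3) ℝ} (hA : A.IsHermitian) (k : ℝ) :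
    Module.End.HasEigenvalue (Matrix.toLin' (invSqrt A)) k
      ↔ ∃ i, hA.eigenvalues i ^ (-(1 / 2) : ℝ) = k := by
  rw [Module.End.hasEigenvalue_iff_isRoot_charpoly, Matrix.charpoly_toLin', invSqrt,
    hA.charpoly_cfc_eq, Polynomial.IsRoot, Polynomial.eval_prod, Finset.prod_eq_zero_iff]
  simp only [Finset.mem_univ, true_and, Polynomial.eval_sub, Polynomial.eval_X, Polynomial.eval_C,
    sub_eq_zero, RCLike.ofReal_real_eq_id, id]
  exact exists_congr fun i => eq_comm

/-- For a positive definite matrix `A`, the largest eigenvalue of `A^{-1/2}` is the square root of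
the inverse of the smallest eigenvalue of `A`. -/
theorem maxEigenvalue_invSqrt {A : Matrix (Fin 3) (Fin 3) ℝ} (hA : A.IsHermitian) {α : ℝ}
    (hα : 0 < α) (hell : ∀ ξ : Fin 3 → ℝ, α * (ξ ⬝ᵥ ξ) ≤ ξ ⬝ᵥ A.mulVec ξ) :
    0 ≤ maxEigenvalue (invSqrt A) ∧ maxEigenvalue (invSqrt A) ≤ α ^ (-(1 / 2) : ℝ) ∧
      ∀ ξ : Fin 3 → ℝ, ξ ⬝ᵥ ξ ≤ maxEigenvalue (invSqrt A) ^ 2 * (ξ ⬝ᵥ A.mulVec ξ) := by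
  have hset : {k : ℝ | Module.End.HasEigenvalue (Matrix.toLin' (invSqrt A)) k}
      = range fun i => hA.eigenvalues i ^ (-(1 / 2) : ℝ) := by
    ext k
    exact hasEigenvalue_invSqrt_iff hA k
  have hγ : maxEigenvalue (invSqrt A) = sSup (range fun i => hA.eigenvalues i ^ (-(1 / 2) : ℝ)) := by
    rw [maxEigenvalue, hset]
  have hnorm : ∀ i, (hA.eigenvectorBasis i).ofLp ⬝ᵥ (hA.eigenvectorBasis i).ofLp = 1 := by
    intro i
    have := hA.eigenvectorBasis.orthonormal.1 i
    have h2 : inner ℝ (hA.eigenvectorBasis i) (hA.eigenvectorBasis i) = (1 : ℝ) := by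
      rw [real_inner_self_eq_norm_sq, this, one_pow]
    rw [EuclideanSpace.inner_eq_star_dotProduct] at h2
    simpa only [star_trivial] using h2
  have hev : ∀ i, α ≤ hA.eigenvalues i := by
    intro i
    have h := hell (hA.eigenvectorBasis i).ofLp
    rw [hA.mulVec_eigenvectorBasis, dotProduct_smul, hnorm, mul_one, smul_eq_mul, mul_one] at h
    exact h
  have hle : ∀ i, hA.eigenvalues i ^ (-(1 / 2) : ℝ) ≤ maxEigenvalue (invSqrt A) := by
    intro i
    rw [hγ]
    exact le_csSup (finite_range _).bddAbove (mem_range_self i)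
  have hpos : ∀ i, 0 ≤ hA.eigenvalues i ^ (-(1 / 2) : ℝ) := fun i =>
    Real.rpow_nonneg (hα.le.trans (hev i)) _
  refine ⟨(hpos 0).trans (hle 0), ?_, fun ξ => ?_⟩
  · rw [hγ]
    refine csSup_le (range_nonempty _) ?_
    rintro _ ⟨i, rfl⟩
    exact Real.rpow_le_rpow_of_nonpos hα (hev i) (by norm_num)
  · rw [dotProduct_mulVec_eq_sum hA, ← sum_eigenvectorBasis hA, Finset.mul_sum]
    refine Finset.sum_le_sum fun i _ => ?_
    have hl : 0 < hA.eigenvalues i := hα.trans_le (hev i)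
    have h1 : 1 ≤ maxEigenvalue (invSqrt A) ^ 2 * hA.eigenvalues i := by
      calc 1 = (hA.eigenvalues i ^ (-(1 / 2) : ℝ)) ^ 2 * hA.eigenvalues i := by
            rw [← Real.rpow_natCast, ← Real.rpow_mul hl.le]
            norm_num
            rw [Real.rpow_neg_one, inv_mul_cancel₀ hl.ne']
        _ ≤ maxEigenvalue (invSqrt A) ^ 2 * hA.eigenvalues i := by
            gcongr
            exact hle i
    nlinarith [sq_nonneg (ξ ⬝ᵥ (hA.eigenvectorBasis i).ofLp)]

theorem sq_dotProduct_cross_le (e p h : Fin 3 → ℝ) :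
    (e ⬝ᵥ crossProduct p h) ^ 2 ≤ (e ⬝ᵥ e) * ((p ⬝ᵥ p) * (h ⬝ᵥ h)) := by
  have h1 : ∀ a b : Fin 3 → ℝ, (a ⬝ᵥ b) ^ 2 ≤ (a ⬝ᵥ a) * (b ⬝ᵥ b) := by
    intro a b
    simp only [dotProduct, Fin.sum_univ_three]
    nlinarith [sq_nonneg (a 0 * b 1 - a 1 * b 0), sq_nonneg (a 1 * b 2 - a 2 * b 1),
      sq_nonneg (a 2 * b 0 - a 0 * b 2)]
  have h2 : crossProduct p h ⬝ᵥ crossProduct p h ≤ (p ⬝ᵥ p) * (h ⬝ᵥ h) := by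
    rw [cross_apply]
    simp [dotProduct, Fin.sum_univ_three]
    nlinarith [sq_nonneg (p 0 * h 0 + p 1 * h 1 + p 2 * h 2)]
  have h3 : 0 ≤ e ⬝ᵥ e := by
    simp only [dotProduct, Fin.sum_univ_three]; nlinarith [sq_nonneg (e 0), sq_nonneg (e 1), sq_nonneg (e 2)]
  exact (h1 _ _).trans (mul_le_mul_of_nonneg_left h2 h3)

/-- The flux density is bounded by the local speed times the energy density. -/
theorem two_mul_abs_dotProduct_cross_le {e p h : Fin 3 → ℝ} {γe γm a b P c : ℝ} (hγe : 0 ≤ γe)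
    (hγm : 0 ≤ γm) (ha : 0 ≤ a) (hb : 0 ≤ b) (he : e ⬝ᵥ e ≤ γe ^ 2 * a)
    (hh : h ⬝ᵥ h ≤ γm ^ 2 * b) (hP : 0 ≤ P) (hp : p ⬝ᵥ p ≤ P ^ 2) (hc : γe * γm ≤ c) :
    2 * |e ⬝ᵥ crossProduct p h| ≤ P * (c * (a + b)) := by
  have hc0 : 0 ≤ c := (mul_nonneg hγe hγm).trans hc
  have hnn : ∀ v : Fin 3 → ℝ, 0 ≤ v ⬝ᵥ v := fun v => by
    simp only [dotProduct, Fin.sum_univ_three]; nlinarith [sq_nonneg (v 0), sq_nonneg (v 1), sq_nonneg (v 2)]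
  have h1 : (e ⬝ᵥ crossProduct p h) ^ 2 ≤ (γe ^ 2 * a) * (P ^ 2 * (γm ^ 2 * b)) := by
    refine (sq_dotProduct_cross_le e p h).trans ?_
    gcongr
    · exact mul_nonneg (hnn p) (hnn h)
    · exact hnn h
  have h2 : (2 * |e ⬝ᵥ crossProduct p h|) ^ 2 ≤ (P * (c * (a + b))) ^ 2 := by
    rw [mul_pow, sq_abs]
    calc 2 ^ 2 * (e ⬝ᵥ crossProduct p h) ^ 2
        ≤ 2 ^ 2 * ((γe ^ 2 * a) * (P ^ 2 * (γm ^ 2 * b))) := by gcongr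
      _ = P ^ 2 * ((γe * γm) ^ 2 * (4 * a * b)) := by ring
      _ ≤ P ^ 2 * (c ^ 2 * (a + b) ^ 2) := by
          gcongr
          nlinarith [sq_nonneg (a - b)]
      _ = (P * (c * (a + b))) ^ 2 := by ring
  exact (le_abs_self _).trans (abs_le_of_sq_le_sq h2 (by positivity))

/-- The bounds of the quadratic form bound the entries, by polarization. -/
theorem abs_entry_le {A : Matrix (Fin 3) (Fin 3) ℝ} (hA : A.IsSymm) {β : ℝ}
    (h0 : ∀ ξ : Fin 3 → ℝ, 0 ≤ ξ ⬝ᵥ A.mulVec ξ)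
    (h1 : ∀ ξ : Fin 3 → ℝ, ξ ⬝ᵥ A.mulVec ξ ≤ β * (ξ ⬝ᵥ ξ)) (i j : Fin 3) : |A i j| ≤ β := by
  have hd : ∀ i, 0 ≤ A i i ∧ A i i ≤ β := by
    intro i
    have a0 := h0 (Pi.single i 1)
    have a1 := h1 (Pi.single i 1)
    simp at a0 a1
    exact ⟨a0, a1⟩
  by_cases hij : i = j
  · subst hij
    rw [abs_of_nonneg (hd i).1]
    exact (hd i).2
  · have a0 := h0 (Pi.single i 1 + Pi.single j 1)
    have a1 := h1 (Pi.single i 1 + Pi.single j 1)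
    have hs : A j i = A i j := hA.apply i j
    simp [Matrix.mulVec_add, hij, Ne.symm hij, hs] at a0 a1
    have di := hd i
    have dj := hd j
    rw [abs_le]
    constructor <;> linarith [di.1, di.2, dj.1, dj.2]

theorem IsUniformlyElliptic.memLp_entry {A : Space → Matrix (Fin 3) (Fin 3) ℝ}
    (hA : IsUniformlyElliptic A) (i j : Fin 3) :
    MemLp (fun x => A x i j) ⊤ (volume : Measure Space) := by
  obtain ⟨α, β, hα, h⟩ := hA.elliptic
  refine memLp_top_of_bound (hA.aemeasurable i j).aestronglyMeasurable β ?_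
  filter_upwards [h, hA.symm] with x hx hs
  refine abs_entry_le hs (fun ξ => ?_) (fun ξ => (hx ξ).2) i j
  refine (mul_nonneg hα.le ?_).trans (hx ξ).1
  exact Finset.sum_nonneg fun i _ => mul_self_nonneg (ξ i)

theorem memLp_fromBlocks {ε μ : Space → Matrix (Fin 3) (Fin 3) ℝ}
    (hε : IsUniformlyElliptic ε) (hμ : IsUniformlyElliptic μ) (i j : Idx) :
    MemLp (fun x => Matrix.fromBlocks (ε x) 0 0 (μ x) i j) ⊤ (volume : Measure Space) := by
  rcases i with i | i <;> rcases j with j | j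
  · exact hε.memLp_entry i j
  · exact MemLp.zero
  · exact MemLp.zero
  · exact hμ.memLp_entry i j

/-- The operator of multiplication by the mass matrix, the block diagonal matrix of `ε` and `μ`. -/
def massOp (ε μ : Space → Matrix (Fin 3) (Fin 3) ℝ) : FieldSpace →L[ℝ] FieldSpace :=
  mulOp fun i j => linfOf fun x => Matrix.fromBlocks (ε x) 0 0 (μ x) i j

theorem coeFn_massOp {ε μ : Space → Matrix (Fin 3) (Fin 3) ℝ}
    (hε : IsUniformlyElliptic ε) (hμ : IsUniformlyElliptic μ) (u : FieldSpace) :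
    ∀ᵐ x : Space, ∀ i, massOp ε μ u i x
      = (Matrix.fromBlocks (ε x) 0 0 (μ x)).mulVec (fun i => u i x) i := by
  have h : ∀ᵐ x : Space, ∀ i j, linfOf (fun x => Matrix.fromBlocks (ε x) 0 0 (μ x) i j) x
      = Matrix.fromBlocks (ε x) 0 0 (μ x) i j :=
    ae_all_iff.2 fun i => ae_all_iff.2 fun j => coeFn_linfOf (memLp_fromBlocks hε hμ i j)
  filter_upwards [coeFn_mulOp (fun i j => linfOf fun x => Matrix.fromBlocks (ε x) 0 0 (μ x) i j) u,
    h] with x h1 h2 i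
  rw [massOp, h1]
  simp only [h2]
  rfl

theorem massForm_eq_inner {ε μ : Space → Matrix (Fin 3) (Fin 3) ℝ}
    (hε : IsUniformlyElliptic ε) (hμ : IsUniformlyElliptic μ) (u v : FieldSpace) :
    massForm ε μ u v = inner ℝ (massOp ε μ u) v := by
  rw [inner_eq_integral]
  apply integral_congr_ae
  filter_upwards [coeFn_massOp hε hμ u] with x hx
  simp only [hx]
  rfl

theorem inner_massOp_left {ε μ : Space → Matrix (Fin 3) (Fin 3) ℝ}
    (hε : IsUniformlyElliptic ε) (hμ : IsUniformlyElliptic μ) (u v : FieldSpace) :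
    inner ℝ (massOp ε μ u) v = inner ℝ u (massOp ε μ v) := by
  rw [inner_eq_integral, inner_eq_integral]
  apply integral_congr_ae
  filter_upwards [coeFn_massOp hε hμ u, coeFn_massOp hε hμ v, hε.symm, hμ.symm]
    with x h1 h2 h3 h4
  have hs : (Matrix.fromBlocks (ε x) 0 0 (μ x)).transpose = Matrix.fromBlocks (ε x) 0 0 (μ x) := by
    rw [Matrix.fromBlocks_transpose, h3.eq, h4.eq, Matrix.transpose_zero]
  simp only [h1, h2]
  change (Matrix.fromBlocks (ε x) 0 0 (μ x)).mulVec (fun i => u i x) ⬝ᵥ (fun i => v i x)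
    = (fun i => u i x) ⬝ᵥ (Matrix.fromBlocks (ε x) 0 0 (μ x)).mulVec (fun i => v i x)
  rw [Matrix.dotProduct_mulVec, ← Matrix.mulVec_transpose, hs]

/-- Twice the density of the electromagnetic energy, `M u · u`. -/
def energyDensity (ε μ : Space → Matrix (Fin 3) (Fin 3) ℝ) (u : FieldSpace) (x : Space) : ℝ :=
  (Matrix.fromBlocks (ε x) 0 0 (μ x)).mulVec (fun i => u i x) ⬝ᵥ (fun i => u i x)

theorem energyDensity_eq (ε μ : Space → Matrix (Fin 3) (Fin 3) ℝ) (u : FieldSpace) (x : Space) :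
    energyDensity ε μ u x
      = (fun i => electric u i x) ⬝ᵥ (ε x).mulVec (fun i => electric u i x)
        + (fun i => magnetic u i x) ⬝ᵥ (μ x).mulVec (fun i => magnetic u i x) := by
  have h : (fun i => u i x) = Sum.elim (fun i => electric u i x) (fun i => magnetic u i x) := by
    ext i
    rcases i with i | i <;> rfl
  rw [energyDensity, h, Matrix.fromBlocks_mulVec, sumElim_dotProduct_sumElim]
  simp [Function.comp_def, dotProduct_comm]

theorem integrable_energyDensity {ε μ : Space → Matrix (Fin 3) (Fin 3) ℝ}
    (hε : IsUniformlyElliptic ε) (hμ : IsUniformlyElliptic μ) (u : FieldSpace) :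
    Integrable (energyDensity ε μ u) := by
  have h : Integrable fun x : Space => ∑ i, massOp ε μ u i x * u i x :=
    integrable_finsetSum _ fun i _ => integrable_coe_mul _ _
  refine h.congr ?_
  filter_upwards [coeFn_massOp hε hμ u] with x hx
  simp only [hx]
  rfl

theorem inner_massOp_scalarOp {ε μ : Space → Matrix (Fin 3) (Fin 3) ℝ}
    (hε : IsUniformlyElliptic ε) (hμ : IsUniformlyElliptic μ) {ψ : Space → ℝ}
    (hψ : MemLp ψ ⊤ (volume : Measure Space)) (u : FieldSpace) :
    inner ℝ (massOp ε μ u) (scalarOp (linfOf ψ) u) = ∫ x : Space, ψ x * energyDensity ε μ u x := by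
  rw [← inner_scalarOp_left, inner_scalarOp]
  apply integral_congr_ae
  filter_upwards [coeFn_massOp hε hμ u, coeFn_linfOf hψ] with x hx h2
  simp only [hx, h2]
  rfl

theorem integral_energyDensity {ε μ : Space → Matrix (Fin 3) (Fin 3) ℝ}
    (hε : IsUniformlyElliptic ε) (hμ : IsUniformlyElliptic μ) (u : FieldSpace) :
    ∫ x : Space, energyDensity ε μ u x = inner ℝ (massOp ε μ u) u := by
  rw [inner_eq_integral]
  apply integral_congr_ae
  filter_upwards [coeFn_massOp hε hμ u] with x hx
  simp only [hx]
  rfl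

theorem exists_le_energyDensity {ε μ : Space → Matrix (Fin 3) (Fin 3) ℝ}
    (hε : IsUniformlyElliptic ε) (hμ : IsUniformlyElliptic μ) :
    ∃ α, 0 < α ∧ ∀ u : FieldSpace, ∀ᵐ x : Space,
      α * ∑ i, u i x * u i x ≤ energyDensity ε μ u x := by
  obtain ⟨α₁, _, h1, hα₁⟩ := hε.elliptic
  obtain ⟨α₂, _, h2, hα₂⟩ := hμ.elliptic
  refine ⟨min α₁ α₂, lt_min h1 h2, fun u => ?_⟩
  filter_upwards [hα₁, hα₂] with x hx1 hx2
  rw [energyDensity_eq, Fintype.sum_sum_type, mul_add]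
  refine add_le_add ?_ ?_
  · refine le_trans ?_ (hx1 _).1
    exact mul_le_mul_of_nonneg_right (min_le_left _ _)
      (Finset.sum_nonneg fun i _ => mul_self_nonneg _)
  · refine le_trans ?_ (hx2 _).1
    exact mul_le_mul_of_nonneg_right (min_le_right _ _)
      (Finset.sum_nonneg fun i _ => mul_self_nonneg _)

theorem energyDensity_nonneg {ε μ : Space → Matrix (Fin 3) (Fin 3) ℝ}
    (hε : IsUniformlyElliptic ε) (hμ : IsUniformlyElliptic μ) (u : FieldSpace) :
    ∀ᵐ x : Space, 0 ≤ energyDensity ε μ u x := by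
  obtain ⟨α, hα, h⟩ := exists_le_energyDensity hε hμ
  filter_upwards [h u] with x hx
  exact (mul_nonneg hα.le (Finset.sum_nonneg fun i _ => mul_self_nonneg _)).trans hx

/-- The local factors of the speed are nonnegative and essentially bounded, and control the
Euclidean norm by the quadratic form of the coefficient. -/
theorem IsUniformlyElliptic.maxEigenvalue_invSqrt {A : Space → Matrix (Fin 3) (Fin 3) ℝ}
    (hA : IsUniformlyElliptic A) :
    ∃ C, ∀ᵐ x : Space, 0 ≤ maxEigenvalue (invSqrt (A x)) ∧ maxEigenvalue (invSqrt (A x)) ≤ C ∧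
      ∀ ξ : Fin 3 → ℝ, 0 ≤ ξ ⬝ᵥ (A x).mulVec ξ ∧
        ξ ⬝ᵥ ξ ≤ maxEigenvalue (invSqrt (A x)) ^ 2 * (ξ ⬝ᵥ (A x).mulVec ξ) := by
  obtain ⟨α, β, hα, h⟩ := hA.elliptic
  refine ⟨α ^ (-(1 / 2) : ℝ), ?_⟩
  filter_upwards [h, hA.symm] with x hx hs
  have hH : (A x).IsHermitian := by
    rw [Matrix.IsHermitian, Matrix.conjTranspose_eq_transpose_of_trivial]
    exact hs
  obtain ⟨h1, h2, h3⟩ := Maxwell.maxEigenvalue_invSqrt hH hα fun ξ => (hx ξ).1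
  refine ⟨h1, h2, fun ξ => ⟨?_, h3 ξ⟩⟩
  exact (mul_nonneg hα.le (Finset.sum_nonneg fun i _ => mul_self_nonneg (ξ i))).trans (hx ξ).1

/-- The local speed is essentially bounded, so that the essential supremum defining `speed` is not a
junk value and bounds it. -/
theorem localSpeed_le_speed {ε μ : Space → Matrix (Fin 3) (Fin 3) ℝ}
    (hε : IsUniformlyElliptic ε) (hμ : IsUniformlyElliptic μ) (a : Space) (R : ℝ) :
    ∀ᵐ x ∂(volume.restrict (Metric.ball a R)), localSpeed ε μ x ≤ speed ε μ a R := by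
  obtain ⟨C₁, h1⟩ := hε.maxEigenvalue_invSqrt
  obtain ⟨C₂, h2⟩ := hμ.maxEigenvalue_invSqrt
  apply ae_le_essSup
  refine ⟨C₁ * C₂, ?_⟩
  rw [eventually_map]
  filter_upwards [ae_restrict_of_ae h1, ae_restrict_of_ae h2] with x h1 h2
  exact mul_le_mul h1.2.1 h2.2.1 h2.1 (h1.1.trans h1.2.1)

/-- In the ball, the energy flux through the level sets of a weight with gradient at most `P` is
bounded by the speed times the energy density. -/
theorem abs_fluxDensity_le {ε μ : Space → Matrix (Fin 3) (Fin 3) ℝ}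
    (hε : IsUniformlyElliptic ε) (hμ : IsUniformlyElliptic μ) (a : Space) (R : ℝ) {ψ : Space → ℝ}
    {P : Space → ℝ} (hP : ∀ x, 0 ≤ P x) (hψ : ∀ x, gradient ψ x ⬝ᵥ gradient ψ x ≤ P x ^ 2)
    (hψ0 : ∀ x, x ∉ Metric.ball a R → gradient ψ x = 0) (W : FieldSpace) :
    ∀ᵐ x : Space, 2 * |fluxDensity ψ W x|
      ≤ (Metric.ball a R).indicator (fun x => P x * (speed ε μ a R * energyDensity ε μ W x)) x := by
  obtain ⟨C₁, h1⟩ := hε.maxEigenvalue_invSqrt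
  obtain ⟨C₂, h2⟩ := hμ.maxEigenvalue_invSqrt
  filter_upwards [h1, h2, (ae_restrict_iff' measurableSet_ball).1 (localSpeed_le_speed hε hμ a R)]
    with x h1 h2 h3
  by_cases hx : x ∈ Metric.ball a R
  · rw [indicator_of_mem hx, energyDensity_eq]
    exact two_mul_abs_dotProduct_cross_le h1.1 h2.1 (h1.2.2 _).1 (h2.2.2 _).1 (h1.2.2 _).2
      (h2.2.2 _).2 (hP x) (hψ x) (h3 hx)
  · rw [indicator_of_notMem hx, fluxDensity, hψ0 x hx]
    simp

/-! ### The equation integrated twice in time -/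

section Primitive

variable {H : Type*} [NormedAddCommGroup H] [NormedSpace ℝ H]

/-- The primitive of `g` vanishing at time `0`. -/
def primitive (g : ℝ → H) (t : ℝ) : H := ∫ s in (0 : ℝ)..t, g s

theorem primitive_zero (g : ℝ → H) : primitive g 0 = 0 := intervalIntegral.integral_same

theorem primitive_of_nonpos {g : ℝ → H} (hg : ∀ t ≤ 0, g t = 0) {t : ℝ} (ht : t ≤ 0) :
    primitive g t = 0 := by
  apply intervalIntegral.integral_zero_ae
  filter_upwards with r hr
  rw [uIoc_of_ge ht] at hr
  exact hg r hr.2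

theorem continuous_primitive {g : ℝ → H} (hg : Integrable g) : Continuous (primitive g) :=
  intervalIntegral.continuous_primitive (fun _ _ => hg.intervalIntegrable) 0

theorem norm_primitive_le {g : ℝ → H} (hg : Integrable g) (t : ℝ) :
    ‖primitive g t‖ ≤ ∫ s, ‖g s‖ :=
  intervalIntegral.norm_integral_le_integral_norm_uIoc.trans
    (setIntegral_le_integral hg.norm (Eventually.of_forall fun _ => norm_nonneg _))

theorem hasDerivAt_primitive [CompleteSpace H] {g : ℝ → H} (hg : Continuous g) (t : ℝ) :
    HasDerivAt (primitive g) (g t) t :=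
  intervalIntegral.integral_hasDerivAt_right (hg.intervalIntegrable 0 t)
    hg.stronglyMeasurable.stronglyMeasurableAtFilter hg.continuousAt

theorem map_primitive [CompleteSpace H] {F : Type*} [NormedAddCommGroup F] [NormedSpace ℝ F]
    [CompleteSpace F] (L : H →L[ℝ] F)
    {g : ℝ → H} {t : ℝ} (hg : IntervalIntegrable g volume 0 t) :
    L (primitive g t) = ∫ s in (0 : ℝ)..t, L (g s) :=
  (L.intervalIntegral_comp_comm hg).symm

end Primitive

/-- The continuous linear functional `w ↦ ⟨w, v⟩`. -/
def innerRight (v : FieldSpace) : FieldSpace →L[ℝ] ℝ := innerSL ℝ v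

theorem innerRight_apply (v w : FieldSpace) : innerRight v w = inner ℝ w v := by
  rw [innerRight, innerSL_apply_apply, real_inner_comm]

/-- A weak solution satisfies the equation integrated twice in time, at every time, when it is
tested with an element of the domain of the Maxwell operator. -/
theorem IsWeakSolution.integrated_twice
    {ε μ : Space → Matrix (Fin 3) (Fin 3) ℝ}
    (hε : IsUniformlyElliptic ε) (hμ : IsUniformlyElliptic μ)
    {T : ℝ} (hT : 0 < T) {u₀ : FieldSpace} {f : ℝ → FieldSpace}
    (hf : IntegrableOn f (Ioo 0 T) volume) {Λ : Idx → Idx → ℝ → RealLinf}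
    (hΛ : ∀ i j, LocallyIntegrable (Λ i j) volume)
    {u : ℝ → FieldSpace} (hu : IsWeakSolution ε μ Λ T u₀ f u)
    {v Av : FieldSpace} (hv : HasMaxwell v Av) {t : ℝ} (ht : t ∈ Icc 0 T) :
    inner ℝ (massOp ε μ (primitive ((Ioo 0 T).indicator u) t)
        + timeConv (memoryKernel Λ T) (primitive (primitive ((Ioo 0 T).indicator u))) t
        - (t • massOp ε μ u₀ + primitive (primitive ((Ioo 0 T).indicator f)) t)) v
      = inner ℝ (primitive (primitive ((Ioo 0 T).indicator u)) t) Av := by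
  have hK := integrable_memoryKernel hΛ T
  have hK0 : ∀ t < 0, memoryKernel Λ T t = 0 := fun t ht => memoryKernel_of_nonpos Λ T ht.le
  set K := memoryKernel Λ T
  set w := (Ioo 0 T).indicator u with hw
  set F := (Ioo 0 T).indicator f with hF
  have hFi : Integrable F := (integrable_indicator_iff measurableSet_Ioo).2 hf
  have hwm : AEStronglyMeasurable w volume :=
    (aestronglyMeasurable_indicator_iff measurableSet_Ioo).2 hu.memLp.aestronglyMeasurable
  have hwi : Integrable w :=
    (integrable_indicator_iff measurableSet_Ioo).2 (hu.memLp.integrable le_top)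
  obtain ⟨C, hC⟩ : ∃ C, ∀ᵐ t, ‖w t‖ ≤ C := by
    have h := ae_le_eLpNormEssSup (f := u) (μ := volume.restrict (Ioo 0 T))
    have hlt : eLpNormEssSup u (volume.restrict (Ioo 0 T)) < ⊤ := by
      simpa using hu.memLp.eLpNorm_lt_top
    refine ⟨(eLpNormEssSup u (volume.restrict (Ioo 0 T))).toReal, ?_⟩
    filter_upwards [(ae_restrict_iff' measurableSet_Ioo).1 h] with t ht
    by_cases htm : t ∈ Ioo 0 T
    · rw [hw, indicator_of_mem htm]
      have := ENNReal.toReal_mono hlt.ne (ht htm)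
      simpa using this
    · rw [hw, indicator_of_notMem htm, norm_zero]
      exact ENNReal.toReal_nonneg
  have hw0 : ∀ t ≤ 0, w t = 0 := fun t ht => indicator_of_notMem (fun h => not_lt.2 ht h.1) _
  have hUc := continuous_primitive hwi
  have hU0 : ∀ t ≤ 0, primitive w t = 0 := fun t ht => primitive_of_nonpos hw0 ht
  have hNU : ∀ t, primitive (timeConv K w) t = timeConv K (primitive w) t :=
    fun t => integral_timeConv hK hK0 hwm hC hw0 t
  have hNW : ∀ t, primitive (timeConv K (primitive w)) t = timeConv K (primitive (primitive w)) t :=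
    fun t => integral_timeConv hK hK0 hUc.aestronglyMeasurable
      (Eventually.of_forall (norm_primitive_le hwi)) hU0 t
  have hNi := intervalIntegrable_timeConv hK hwm hC
  have hNUc : Continuous (timeConv K (primitive w)) :=
    continuous_timeConv hK hUc (norm_primitive_le hwi)
  -- the equation integrated once, at almost every time, through the continuous representative
  obtain ⟨g, hg, hgp, hg0⟩ := hu.initial v Av hv
  set k : ℝ → ℝ := fun t => innerRight Av (w t) + innerRight v (F t) - innerRight v (timeConv K w t)
    with hk
  have ki1 : Integrable fun t => innerRight Av (w t) := (innerRight Av).integrable_comp hwi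
  have ki2 : Integrable fun t => innerRight v (F t) := (innerRight v).integrable_comp hFi
  have ki3 : ∀ t, IntervalIntegrable (fun s => innerRight v (timeConv K w s)) volume 0 t := by
    intro t
    have h := hNi t
    rw [intervalIntegrable_iff] at h ⊢
    exact (innerRight v).integrable_comp h
  have ki3' : IntegrableOn (fun s => innerRight v (timeConv K w s)) (Ioo 0 T) := by
    have := ki3 T
    rwa [intervalIntegrable_iff_integrableOn_Ioo_of_le hT.le] at this
  have hki : IntegrableOn k (Ioo 0 T) := (ki1.integrableOn.add ki2.integrableOn).sub ki3'
  have h1 := eq_add_integral_of_distributional_deriv hT hki hg hgp (by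
    intro φ hφ hφc hφs
    have he := hu.equation v Av hv φ hφ hφc hφs
    obtain ⟨Cφ, hCφ⟩ := hφ.continuous.bounded_above_of_compact_support hφc
    have hmul : ∀ q : ℝ → ℝ, IntegrableOn q (Ioo 0 T) →
        IntegrableOn (fun t => φ t * q t) (Ioo 0 T) := fun q hq =>
      hq.bdd_mul hφ.continuous.aestronglyMeasurable (Eventually.of_forall hCφ)
    have e1 : ∫ t in Ioo 0 T, φ t * inner ℝ (memory Λ u t) v
        = ∫ t in Ioo 0 T, φ t * innerRight v (timeConv K w t) := by
      refine setIntegral_congr_fun measurableSet_Ioo fun t ht => ?_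
      simp only [innerRight_apply]
      rw [memory_eq_timeConv hΛ hwm hC ht]
    have e2 : ∫ t in Ioo 0 T, φ t * inner ℝ (u t) Av
        = ∫ t in Ioo 0 T, φ t * innerRight Av (w t) := by
      refine setIntegral_congr_fun measurableSet_Ioo fun t ht => ?_
      simp only [innerRight_apply, hw, indicator_of_mem ht]
    have e3 : ∫ t in Ioo 0 T, φ t * inner ℝ (f t) v
        = ∫ t in Ioo 0 T, φ t * innerRight v (F t) := by
      refine setIntegral_congr_fun measurableSet_Ioo fun t ht => ?_
      simp only [innerRight_apply, hF, indicator_of_mem ht]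
    have e4 : ∫ t in Ioo 0 T, φ t * k t = (∫ t in Ioo 0 T, φ t * innerRight Av (w t))
        + (∫ t in Ioo 0 T, φ t * innerRight v (F t))
        - ∫ t in Ioo 0 T, φ t * innerRight v (timeConv K w t) := by
      simp only [hk, mul_sub, mul_add]
      have hadd : IntegrableOn (fun t => φ t * innerRight Av (w t) + φ t * innerRight v (F t))
          (Ioo 0 T) := (hmul _ ki1.integrableOn).add (hmul _ ki2.integrableOn)
      rw [integral_sub hadd (hmul _ ki3'),
        integral_add (hmul _ ki1.integrableOn) (hmul _ ki2.integrableOn)]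
    rw [e1, e2, e3] at he
    rw [e4]
    linarith)
  have h2 : ∀ᵐ s, s ∈ Ioo 0 T → innerRight v (massOp ε μ (w s))
      = innerRight v (massOp ε μ u₀) + innerRight Av (primitive w s) + innerRight v (primitive F s)
        - innerRight v (timeConv K (primitive w) s) := by
    filter_upwards [(ae_restrict_iff' measurableSet_Ioo).1 hgp] with s hs hsT
    have e := h1 s (Ioo_subset_Icc_self hsT)
    rw [hs hsT, hg0, massForm_eq_inner hε hμ, massForm_eq_inner hε hμ,
      intervalIntegral.integral_sub (ki1.intervalIntegrable.add ki2.intervalIntegrable) (ki3 s),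
      intervalIntegral.integral_add ki1.intervalIntegrable ki2.intervalIntegrable,
      ← map_primitive _ hwi.intervalIntegrable, ← map_primitive _ hFi.intervalIntegrable,
      ← map_primitive _ (hNi s), hNU] at e
    rw [innerRight_apply, innerRight_apply v (massOp ε μ u₀), hw, indicator_of_mem hsT, e]
    ring
  -- the second integration
  have hFc := continuous_primitive hFi
  have h3 : innerRight v (massOp ε μ (primitive w t))
      = t * innerRight v (massOp ε μ u₀) + innerRight Av (primitive (primitive w) t)
        + innerRight v (primitive (primitive F) t)
        - innerRight v (timeConv K (primitive (primitive w)) t) := by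
    have c1 : Continuous fun s => innerRight Av (primitive w s) := (innerRight Av).continuous.comp hUc
    have c2 : Continuous fun s => innerRight v (primitive F s) := (innerRight v).continuous.comp hFc
    have c3 : Continuous fun s => innerRight v (timeConv K (primitive w) s) :=
      (innerRight v).continuous.comp hNUc
    have e := map_primitive ((innerRight v).comp (massOp ε μ)) (hwi.intervalIntegrable (a := 0) (b := t))
    rw [ContinuousLinearMap.comp_apply] at e
    rw [e, ← hNW, map_primitive _ (hUc.intervalIntegrable 0 t),
      map_primitive _ (hFc.intervalIntegrable 0 t), map_primitive _ (hNUc.intervalIntegrable 0 t)]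
    rw [intervalIntegral.integral_congr_ae (g := fun s => innerRight v (massOp ε μ u₀)
      + innerRight Av (primitive w s) + innerRight v (primitive F s)
      - innerRight v (timeConv K (primitive w) s))]
    · rw [intervalIntegral.integral_sub, intervalIntegral.integral_add,
        intervalIntegral.integral_add, intervalIntegral.integral_const]
      · simp
      all_goals exact Continuous.intervalIntegrable (by fun_prop) _ _
    · filter_upwards [h2, Measure.ae_ne volume T] with s hs hsT hst
      rw [uIoc_of_le ht.1] at hst
      exact hs ⟨hst.1, lt_of_le_of_ne (hst.2.trans ht.2) hsT⟩
  simp only [innerRight_apply] at h3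
  rw [inner_sub_left, inner_add_left, inner_add_left, real_inner_smul_left, h3]
  ring

/-! ### Exponential weights -/

/-- A smooth function which vanishes on `(-∞, 0]` and equals `exp` on `[1, ∞)`. -/
def expProfile (s : ℝ) : ℝ := Real.exp s * Real.smoothTransition s

theorem contDiff_expProfile : ContDiff ℝ ∞ expProfile :=
  Real.contDiff_exp.mul Real.smoothTransition.contDiff

theorem expProfile_of_nonpos {s : ℝ} (hs : s ≤ 0) : expProfile s = 0 := by
  rw [expProfile, Real.smoothTransition.zero_of_nonpos hs, mul_zero]

theorem expProfile_nonneg (s : ℝ) : 0 ≤ expProfile s :=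
  mul_nonneg (Real.exp_pos s).le (Real.smoothTransition.nonneg s)

theorem expProfile_le_exp (s : ℝ) : expProfile s ≤ Real.exp s :=
  mul_le_of_le_one_right (Real.exp_pos s).le (Real.smoothTransition.le_one s)

theorem expProfile_of_one_le {s : ℝ} (hs : 1 ≤ s) : expProfile s = Real.exp s := by
  rw [expProfile, Real.smoothTransition.one_of_one_le hs, mul_one]

theorem deriv_expProfile_of_nonpos {s : ℝ} (hs : s ≤ 0) : deriv expProfile s = 0 := by
  have hc : Continuous (deriv expProfile) := contDiff_expProfile.continuous_deriv (by simp)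
  have h : EqOn (deriv expProfile) 0 (Iio 0) := fun t ht => by
    have : expProfile =ᶠ[𝓝 t] fun _ => 0 := by
      filter_upwards [Iio_mem_nhds ht] with r hr using expProfile_of_nonpos (le_of_lt hr)
    rw [this.deriv_eq, deriv_const]; rfl
  have := h.closure hc continuous_const
  rw [closure_Iio] at this
  exact this hs

/-- The profile satisfies the differential inequality of `exp` up to a constant. -/
theorem exists_abs_deriv_expProfile_le :
    ∃ C, 0 ≤ C ∧ ∀ s, |deriv expProfile s| ≤ expProfile s + C := by
  have hc : Continuous (deriv expProfile) := contDiff_expProfile.continuous_deriv (by simp)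
  obtain ⟨C, hC⟩ := (isCompact_Icc (a := (0 : ℝ)) (b := 1)).exists_bound_of_continuousOn
    hc.continuousOn
  have hC0 : 0 ≤ C := (norm_nonneg _).trans (hC 0 (by simp))
  refine ⟨C, hC0, fun s => ?_⟩
  rcases le_or_gt s 0 with h | h
  · rw [deriv_expProfile_of_nonpos h, abs_zero]
    exact add_nonneg (expProfile_nonneg s) hC0
  rcases le_or_gt s 1 with h1 | h1
  · exact (hC s ⟨h.le, h1⟩).trans (le_add_of_nonneg_left (expProfile_nonneg s))
  · have : expProfile =ᶠ[𝓝 s] Real.exp := by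
      filter_upwards [Ioi_mem_nhds h1] with r hr using expProfile_of_one_le (le_of_lt hr)
    rw [this.deriv_eq, Real.deriv_exp, abs_of_pos (Real.exp_pos s), expProfile_of_one_le h1.le]
    exact le_add_of_nonneg_right hC0

/-- The function `√(|x - a|² + δ²)`, a smooth approximation of the distance to `a` from above. -/
def smoothDist (a : Space) (δ : ℝ) (x : Space) : ℝ := Real.sqrt (‖x - a‖ ^ 2 + δ ^ 2)

theorem contDiff_smoothDist (a : Space) {δ : ℝ} (hδ : 0 < δ) : ContDiff ℝ ∞ (smoothDist a δ) := by
  refine ContDiff.sqrt ?_ fun x => by positivity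
  exact ((contDiff_id.sub contDiff_const).norm_sq ℝ).add contDiff_const

theorem dist_le_smoothDist (a : Space) (δ : ℝ) (x : Space) : dist x a ≤ smoothDist a δ x := by
  rw [dist_eq_norm]
  exact Real.le_sqrt_of_sq_le (le_add_of_nonneg_right (sq_nonneg δ))

theorem smoothDist_le (a : Space) {δ : ℝ} (hδ : 0 ≤ δ) (x : Space) :
    smoothDist a δ x ≤ dist x a + δ := by
  rw [dist_eq_norm, smoothDist, Real.sqrt_le_left (by positivity)]
  nlinarith [mul_nonneg (norm_nonneg (x - a)) hδ]

theorem gradient_smoothDist (a : Space) {δ : ℝ} (hδ : 0 < δ) (x : Space) (j : Fin 3) :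
    gradient (smoothDist a δ) x j = (x j - a j) / smoothDist a δ x := by
  have h0 : ‖x - a‖ ^ 2 + δ ^ 2 ≠ 0 := by positivity
  have h1 : HasFDerivAt (fun x : Space => ‖x - a‖ ^ 2 + δ ^ 2)
      ((2 : ℕ) • (innerSL ℝ (x - a)).comp (ContinuousLinearMap.id ℝ Space)) x :=
    (((hasFDerivAt_id x).sub_const a).norm_sq).add_const _
  have h2 := h1.sqrt h0
  rw [gradient]
  rw [show fderiv ℝ (smoothDist a δ) x = _ from h2.fderiv]
  have hne : smoothDist a δ x ≠ 0 := (Real.sqrt_pos.2 (by positivity)).ne'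
  simp only [_root_.smul_apply, ContinuousLinearMap.comp_apply,
    ContinuousLinearMap.id_apply, innerSL_apply_apply, EuclideanSpace.inner_single_right]
  change 1 / (2 * smoothDist a δ x) * _ = _
  field_simp
  simp

theorem gradient_smoothDist_sq_le_one (a : Space) {δ : ℝ} (hδ : 0 < δ) (x : Space) :
    gradient (smoothDist a δ) x ⬝ᵥ gradient (smoothDist a δ) x ≤ 1 := by
  have hpos : 0 < smoothDist a δ x := Real.sqrt_pos.2 (by positivity)
  have hs : smoothDist a δ x ^ 2 = ‖x - a‖ ^ 2 + δ ^ 2 := Real.sq_sqrt (by positivity)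
  have hn : ‖x - a‖ ^ 2 = ∑ j, (x j - a j) * (x j - a j) := by
    rw [EuclideanSpace.real_norm_sq_eq]
    simp [sq]
  have : gradient (smoothDist a δ) x ⬝ᵥ gradient (smoothDist a δ) x
      = ‖x - a‖ ^ 2 / smoothDist a δ x ^ 2 := by
    rw [dotProduct, hn, Finset.sum_div]
    refine Finset.sum_congr rfl fun j _ => ?_
    rw [gradient_smoothDist a hδ]
    field_simp
  rw [this, div_le_one (by positivity), hs]
  exact le_add_of_nonneg_right (sq_nonneg δ)

/-- The weight of the local energy estimate: a smooth function supported in the ball `B(a,R)`, which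
approximates `exp (l (R - |x - a|))` there, except near the boundary. -/
def expWeight (a : Space) (R δ l : ℝ) (x : Space) : ℝ := expProfile (l * (R - smoothDist a δ x))

theorem contDiff_expWeight (a : Space) (R : ℝ) {δ : ℝ} (hδ : 0 < δ) (l : ℝ) :
    ContDiff ℝ ∞ (expWeight a R δ l) :=
  contDiff_expProfile.comp (contDiff_const.mul (contDiff_const.sub (contDiff_smoothDist a hδ)))

theorem expWeight_nonneg (a : Space) (R δ l : ℝ) (x : Space) : 0 ≤ expWeight a R δ l x :=
  expProfile_nonneg _

theorem expWeight_le_exp (a : Space) (R δ l : ℝ) (hl : 0 ≤ l) (x : Space) :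
    expWeight a R δ l x ≤ Real.exp (l * (R - dist x a)) := by
  refine (expProfile_le_exp _).trans (Real.exp_le_exp.2 ?_)
  have := dist_le_smoothDist a δ x
  gcongr

theorem hasCompactSupport_expWeight (a : Space) (R δ : ℝ) {l : ℝ} (hl : 0 ≤ l) :
    HasCompactSupport (expWeight a R δ l) := by
  refine HasCompactSupport.intro (isCompact_closedBall a R) fun x hx => expProfile_of_nonpos ?_
  rw [Metric.mem_closedBall, not_le] at hx
  exact mul_nonpos_of_nonneg_of_nonpos hl (by linarith [dist_le_smoothDist a δ x])

theorem gradient_expWeight (a : Space) (R : ℝ) {δ : ℝ} (hδ : 0 < δ) (l : ℝ) (x : Space) :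
    gradient (expWeight a R δ l) x
      = (-(l * deriv expProfile (l * (R - smoothDist a δ x)))) • gradient (smoothDist a δ) x := by
  have h1 : HasFDerivAt (smoothDist a δ) (fderiv ℝ (smoothDist a δ) x) x :=
    ((contDiff_smoothDist a hδ).differentiable (by simp) x).hasFDerivAt
  have h2 := ((h1.const_sub R).const_mul l)
  have h3 : HasDerivAt expProfile _ (l * (R - smoothDist a δ x)) :=
    (contDiff_expProfile.differentiable (by simp) _).hasDerivAt
  have h4 := h3.comp_hasFDerivAt x h2
  ext j
  rw [gradient, show fderiv ℝ (expWeight a R δ l) x = _ from h4.fderiv]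
  simp only [_root_.smul_apply, _root_.neg_apply, Pi.smul_apply,
    smul_eq_mul, gradient]
  ring

theorem gradient_expWeight_of_notMem_ball (a : Space) {R δ l : ℝ} (hδ : 0 < δ) (hl : 0 ≤ l)
    {x : Space} (hx : x ∉ Metric.ball a R) : gradient (expWeight a R δ l) x = 0 := by
  rw [Metric.mem_ball, not_lt] at hx
  rw [gradient_expWeight a R hδ, deriv_expProfile_of_nonpos, mul_zero, neg_zero, zero_smul]
  exact mul_nonpos_of_nonneg_of_nonpos hl (by linarith [dist_le_smoothDist a δ x])

theorem gradient_expWeight_sq_le {C : ℝ} (hC : ∀ s, |deriv expProfile s| ≤ expProfile s + C)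
    (a : Space) (R : ℝ) {δ : ℝ} (hδ : 0 < δ) (l : ℝ) (x : Space) :
    gradient (expWeight a R δ l) x ⬝ᵥ gradient (expWeight a R δ l) x
      ≤ (l * (expWeight a R δ l x + C)) ^ 2 := by
  rw [gradient_expWeight a R hδ, smul_dotProduct, dotProduct_smul, smul_eq_mul, smul_eq_mul]
  have h1 := gradient_smoothDist_sq_le_one a hδ x
  have h2 : |deriv expProfile (l * (R - smoothDist a δ x))| ≤ expWeight a R δ l x + C := hC _
  have h3 : (deriv expProfile (l * (R - smoothDist a δ x))) ^ 2 ≤ (expWeight a R δ l x + C) ^ 2 :=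
    sq_le_sq' ((abs_le.1 h2).1)
      (le_trans (le_abs_self _) h2)
  set q := deriv expProfile (l * (R - smoothDist a δ x))
  set g := gradient (smoothDist a δ) x ⬝ᵥ gradient (smoothDist a δ) x
  calc -(l * q) * (-(l * q) * g) = (l * q) ^ 2 * g := by ring
    _ ≤ (l * q) ^ 2 * 1 := by gcongr
    _ = l ^ 2 * q ^ 2 := by ring
    _ ≤ l ^ 2 * (expWeight a R δ l x + C) ^ 2 := by gcongr
    _ = _ := by ring

theorem memLp_expWeight (a : Space) (R : ℝ) {δ l : ℝ} (hδ : 0 < δ) (hl : 0 ≤ l) :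
    MemLp (expWeight a R δ l) ⊤ (volume : Measure Space) :=
  memLp_top_of_continuous (contDiff_expWeight a R hδ l).continuous (hasCompactSupport_expWeight a R δ hl)

theorem memLp_sqrt_expWeight (a : Space) (R : ℝ) {δ l : ℝ} (hδ : 0 < δ) (hl : 0 ≤ l) :
    MemLp (fun x => Real.sqrt (expWeight a R δ l x)) ⊤ (volume : Measure Space) :=
  memLp_top_of_continuous (contDiff_expWeight a R hδ l).continuous.sqrt
    ((hasCompactSupport_expWeight a R δ hl).comp_left Real.sqrt_zero)

/-! ### The local energy estimate -/

theorem massOp_scalarOp (ε μ : Space → Matrix (Fin 3) (Fin 3) ℝ) (ψ : RealLinf) (u : FieldSpace) :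
    massOp ε μ (scalarOp ψ u) = scalarOp ψ (massOp ε μ u) := mulOp_scalarOp _ ψ u

/-- Outside the ball where the source vanishes, the weight is at most `exp (l * c * t)`. -/
theorem inner_source_le {a : Space} {R δ l : ℝ} (hδ : 0 < δ) (hl : 0 ≤ l) {b : ℝ}
    {G : FieldSpace} (hG : VanishesOnBall G a (R - b)) (W : FieldSpace) :
    inner ℝ G (scalarOp (linfOf (expWeight a R δ l)) W)
      ≤ Real.exp (l * b) * ((‖G‖ ^ 2 + ‖W‖ ^ 2) / 2) := by
  have hsq : ∀ u : FieldSpace, Integrable fun x : Space => ∑ i, u i x * u i x := fun u =>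
    integrable_finsetSum _ fun i _ => integrable_coe_mul _ _
  have hb : Integrable fun x : Space =>
      Real.exp (l * b) * (((∑ i, G i x * G i x) + ∑ i, W i x * W i x) / 2) :=
    (((hsq G).add (hsq W)).div_const 2).const_mul _
  have hrhs : Real.exp (l * b) * ((‖G‖ ^ 2 + ‖W‖ ^ 2) / 2)
      = ∫ x : Space, Real.exp (l * b) * (((∑ i, G i x * G i x) + ∑ i, W i x * W i x) / 2) := by
    rw [integral_const_mul, integral_div, integral_add (hsq G) (hsq W), norm_sq_eq_integral,
      norm_sq_eq_integral]
  rw [← inner_scalarOp_left, inner_scalarOp, hrhs]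
  refine (Real.le_norm_self _).trans (norm_integral_le_of_norm_le hb ?_)
  filter_upwards [coeFn_linfOf (memLp_expWeight a R hδ hl),
    (ae_restrict_iff' measurableSet_ball).1 hG] with x h1 h2
  have h0 : 0 ≤ ((∑ i, G i x * G i x) + ∑ i, W i x * W i x) / 2 := by
    have h := fun u : FieldSpace => Finset.sum_nonneg fun i (_ : i ∈ Finset.univ) =>
      mul_self_nonneg (u i x)
    linarith [h G, h W]
  rw [h1]
  by_cases hx : x ∈ Metric.ball a (R - b)
  · simp only [h2 hx, zero_mul, Finset.sum_const_zero, mul_zero, norm_zero, zero_add]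
    simp only [h2 hx, mul_zero, Finset.sum_const_zero, zero_add] at h0
    positivity
  · rw [Metric.mem_ball, not_lt] at hx
    rw [norm_mul, Real.norm_of_nonneg (expWeight_nonneg _ _ _ _ _)]
    gcongr
    · refine (expWeight_le_exp a R δ l hl x).trans (Real.exp_le_exp.2 ?_)
      exact mul_le_mul_of_nonneg_left (by linarith) hl
    · rw [← Finset.sum_add_distrib, Finset.sum_div]
      refine (norm_sum_le _ _).trans (Finset.sum_le_sum fun i _ => ?_)
      rw [Real.norm_eq_abs, abs_le]
      constructor <;> nlinarith [sq_nonneg (G i x + W i x), sq_nonneg (G i x - W i x)]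

/-- The energy flux through the level sets of the weight is absorbed by the energy when the weight
moves with the speed `c`. -/
theorem integral_fluxDensity_le {ε μ : Space → Matrix (Fin 3) (Fin 3) ℝ}
    (hε : IsUniformlyElliptic ε) (hμ : IsUniformlyElliptic μ) {a : Space} {R δ l : ℝ}
    (hδ : 0 < δ) (hl : 0 ≤ l) {C : ℝ} (hC0 : 0 ≤ C)
    (hC : ∀ s, |deriv expProfile s| ≤ expProfile s + C) (hc : 0 ≤ speed ε μ a R) (W : FieldSpace) :
    ∫ x : Space, fluxDensity (expWeight a R δ l) W x
      ≤ l * speed ε μ a R * (inner ℝ (massOp ε μ W)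
          (scalarOp (linfOf (expWeight a R δ l)) W) / 2
        + C * inner ℝ (massOp ε μ W) W / 2) := by
  have hψ := memLp_expWeight a R hδ hl
  have hi := integrable_energyDensity hε hμ W
  have hi2 : Integrable fun x => expWeight a R δ l x * energyDensity ε μ W x := by
    refine (integrable_linf_mul (linfOf (expWeight a R δ l)) hi).congr ?_
    filter_upwards [coeFn_linfOf hψ] with x hx
    rw [hx]
  have hrhs : l * speed ε μ a R * (inner ℝ (massOp ε μ W)
          (scalarOp (linfOf (expWeight a R δ l)) W) / 2
        + C * inner ℝ (massOp ε μ W) W / 2)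
      = ∫ x : Space, l * speed ε μ a R * (expWeight a R δ l x * energyDensity ε μ W x / 2
        + C * energyDensity ε μ W x / 2) := by
    rw [integral_const_mul, integral_add (hi2.div_const 2) ((hi.const_mul C).div_const 2),
      integral_div, integral_div, integral_const_mul, inner_massOp_scalarOp hε hμ hψ,
      integral_energyDensity hε hμ]
  rw [hrhs]
  refine (Real.le_norm_self _).trans (norm_integral_le_of_norm_le
    (((hi2.div_const 2).add ((hi.const_mul C).div_const 2)).const_mul _) ?_)
  filter_upwards [energyDensity_nonneg hε hμ W, abs_fluxDensity_le hε hμ a R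
    (P := fun x => l * (expWeight a R δ l x + C))
    (fun x => mul_nonneg hl (add_nonneg (expWeight_nonneg _ _ _ _ _) hC0))
    (gradient_expWeight_sq_le hC a R hδ l)
    (fun x hx => gradient_expWeight_of_notMem_ball a hδ hl hx) W] with x h1 h2
  have h3 : (Metric.ball a R).indicator (fun x => l * (expWeight a R δ l x + C)
      * (speed ε μ a R * energyDensity ε μ W x)) x ≤ l * (expWeight a R δ l x + C)
      * (speed ε μ a R * energyDensity ε μ W x) := by
    by_cases hx : x ∈ Metric.ball a R
    · rw [indicator_of_mem hx]
    · rw [indicator_of_notMem hx]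
      exact mul_nonneg (mul_nonneg hl (add_nonneg (expWeight_nonneg _ _ _ _ _) hC0))
        (mul_nonneg hc h1)
  rw [Real.norm_eq_abs]
  linarith

/-- The local energy estimate, with an exponential weight moving at the speed `c`. -/
theorem energy_le {ε μ : Space → Matrix (Fin 3) (Fin 3) ℝ}
    (hε : IsUniformlyElliptic ε) (hμ : IsUniformlyElliptic μ) {a : Space} {R δ l : ℝ}
    (hδ : 0 < δ) (hl : 0 ≤ l) {C : ℝ} (hC0 : 0 ≤ C)
    (hC : ∀ s, |deriv expProfile s| ≤ expProfile s + C) (hc : 0 ≤ speed ε μ a R)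
    {U W N G : ℝ → FieldSpace} {s B B' : ℝ} (hs : 0 ≤ s)
    (hW : ∀ t, HasDerivAt W (U t) t) (hW0 : W 0 = 0) (hN : Continuous N)
    (heq : ∀ t ∈ Icc 0 s, ∀ v Av : FieldSpace, HasMaxwell v Av →
      inner ℝ (massOp ε μ (U t) + N t - G t) v = inner ℝ (W t) Av)
    (hG : ∀ t ∈ Icc 0 s, VanishesOnBall (G t) a (R - speed ε μ a R * t))
    (hpos : ∀ t ∈ Icc 0 s,
      0 ≤ ∫ r in (0 : ℝ)..t, inner ℝ (N r) (scalarOp (linfOf (expWeight a R δ l)) (W r)))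
    (hB : ∀ t ∈ Icc 0 s, (‖G t‖ ^ 2 + ‖W t‖ ^ 2) / 2 ≤ B)
    (hB' : ∀ t ∈ Icc 0 s, inner ℝ (massOp ε μ (W t)) (W t) ≤ B') :
    inner ℝ (massOp ε μ (W s)) (scalarOp (linfOf (expWeight a R δ l)) (W s)) / 2
      ≤ Real.exp (l * speed ε μ a R * s) * (s * (B + l * speed ε μ a R * (C * B' / 2))) := by
  set c := speed ε μ a R with hcdef
  set S := scalarOp (linfOf (expWeight a R δ l)) with hS
  have hWc : Continuous W := continuous_iff_continuousAt.2 fun t => (hW t).continuousAt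
  have hNc : Continuous fun r => inner ℝ (N r) (S (W r)) := hN.inner (S.continuous.comp hWc)
  set P : ℝ → ℝ := fun t => ∫ r in (0 : ℝ)..t, inner ℝ (N r) (S (W r)) with hP
  have hPd : ∀ t, HasDerivAt P (inner ℝ (N t) (S (W t))) t := fun t => hasDerivAt_primitive hNc t
  set D : ℝ → ℝ := fun t => inner ℝ (massOp ε μ (W t)) (S (W t)) / 2 + P t with hD
  have hsymm : ∀ x y, inner ℝ (massOp ε μ x) (S y) = inner ℝ (massOp ε μ y) (S x) := by
    intro x y
    rw [← inner_scalarOp_left, ← massOp_scalarOp, inner_massOp_left hε hμ, real_inner_comm]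
  have hDd : ∀ t, HasDerivAt D (inner ℝ (massOp ε μ (U t)) (S (W t)) + inner ℝ (N t) (S (W t))) t := by
    intro t
    have h1 : HasDerivAt (fun t => massOp ε μ (W t)) (massOp ε μ (U t)) t :=
      (massOp ε μ).hasFDerivAt.comp_hasDerivAt t (hW t)
    have h2 : HasDerivAt (fun t => S (W t)) (S (U t)) t := S.hasFDerivAt.comp_hasDerivAt t (hW t)
    refine (((h1.inner ℝ h2).div_const 2).add (hPd t)).congr_deriv ?_
    rw [hsymm (W t) (U t)]
    ring
  have hDle : ∀ t ∈ Icc 0 s, inner ℝ (massOp ε μ (U t)) (S (W t)) + inner ℝ (N t) (S (W t))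
      ≤ l * c * D t + Real.exp (l * c * t) * (B + l * c * (C * B' / 2)) := by
    intro t ht
    have e1 := inner_scalarOp_eq_integral_fluxDensity (heq t ht) (contDiff_expWeight a R hδ l)
      (hasCompactSupport_expWeight a R δ hl)
    rw [inner_sub_left, inner_add_left] at e1
    have e2 := integral_fluxDensity_le hε hμ hδ hl hC0 hC hc (W t) (a := a)
    have e3 := inner_source_le hδ hl (hG t ht) (W t)
    have e4 := hpos t ht
    rw [← hS] at e1 e2 e3
    rw [← hcdef] at e2
    have hlc : 0 ≤ l * c := mul_nonneg hl hc
    have e5 : l * c * 0 ≤ l * c * P t := mul_le_mul_of_nonneg_left e4 hlc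
    have e6 : l * c * (C * inner ℝ (massOp ε μ (W t)) (W t) / 2) ≤ l * c * (C * B' / 2) := by
      have := hB' t ht
      gcongr
    have hB'0 : 0 ≤ l * c * (C * B' / 2) := by
      refine le_trans ?_ e6
      have h7 : 0 ≤ inner ℝ (massOp ε μ (W t)) (W t) := by
        rw [← integral_energyDensity hε hμ]
        exact integral_nonneg_of_ae (energyDensity_nonneg hε hμ _)
      positivity
    have e7 : 1 ≤ Real.exp (l * c * t) := Real.one_le_exp (mul_nonneg hlc ht.1)
    have e8 : Real.exp (l * (c * t)) * ((‖G t‖ ^ 2 + ‖W t‖ ^ 2) / 2) ≤ Real.exp (l * c * t) * B := by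
      rw [← mul_assoc]
      have := hB t ht
      gcongr
    have e9 : l * c * (C * B' / 2) ≤ Real.exp (l * c * t) * (l * c * (C * B' / 2)) :=
      le_mul_of_one_le_left hB'0 e7
    simp only [hD]
    linarith
  -- the function `exp (-l c t) D t - t (B + ...)` is nonincreasing
  set E := B + l * c * (C * B' / 2) with hE
  have hmono : AntitoneOn (fun t => Real.exp (-(l * c * t)) * D t - t * E) (Icc 0 s) := by
    have hd : ∀ t, HasDerivAt (fun t => Real.exp (-(l * c * t)) * D t - t * E)
        (Real.exp (-(l * c * t)) * (-(l * c)) * D t + Real.exp (-(l * c * t))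
          * (inner ℝ (massOp ε μ (U t)) (S (W t)) + inner ℝ (N t) (S (W t))) - E) t := by
      intro t
      have h1 : HasDerivAt (fun t => Real.exp (-(l * c * t)))
          (Real.exp (-(l * c * t)) * (-(l * c))) t := by
        have := ((hasDerivAt_id t).const_mul (l * c)).neg.exp
        simpa using this
      have h2 : HasDerivAt (fun t => t * E) E t := by simpa using (hasDerivAt_id t).mul_const E
      exact (h1.mul (hDd t)).sub h2
    apply antitoneOn_of_deriv_nonpos (convex_Icc 0 s)
      (fun t _ => (hd t).continuousAt.continuousWithinAt)
      (fun t _ => (hd t).differentiableAt.differentiableWithinAt)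
    intro t ht
    rw [interior_Icc] at ht
    rw [(hd t).deriv]
    have h1 := mul_le_mul_of_nonneg_left (hDle t (Ioo_subset_Icc_self ht))
      (Real.exp_pos (-(l * c * t))).le
    have h2 : Real.exp (-(l * c * t)) * (Real.exp (l * c * t) * E) = E := by
      rw [← mul_assoc, ← Real.exp_add, neg_add_cancel, Real.exp_zero, one_mul]
    rw [mul_add (Real.exp _) (l * c * D t), h2] at h1
    linarith
  have h := hmono (left_mem_Icc.2 hs) (right_mem_Icc.2 hs) hs
  have hD0 : D 0 = 0 := by simp [hD, hP, hW0]
  simp only [hD0, mul_zero, zero_mul, sub_zero] at h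
  have h1 : D s ≤ Real.exp (l * c * s) * (s * E) := by
    have h2 : Real.exp (-(l * c * s)) * D s ≤ s * E := by linarith
    have h3 := mul_le_mul_of_nonneg_left h2 (Real.exp_pos (l * c * s)).le
    rwa [← mul_assoc, ← Real.exp_add, add_neg_cancel, Real.exp_zero, one_mul] at h3
  refine le_trans ?_ h1
  exact le_add_of_nonneg_right (hpos s (right_mem_Icc.2 hs))

/-! ### Vanishing on balls -/

/-- A bound of the weighted energies with exponential rate `b` forces the field to vanish where the
weights grow with a larger rate. -/
theorem vanishesOnBall_of_weighted_energy_le {ε μ : Space → Matrix (Fin 3) (Fin 3) ℝ}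
    (hε : IsUniformlyElliptic ε) (hμ : IsUniformlyElliptic μ) {a : Space} {R δ η r b : ℝ}
    (hδ : 0 < δ) (hη : 0 < η) (hb : 0 ≤ b) (hr : r + δ + η ≤ R - b) {w : FieldSpace} {A B : ℝ}
    (h : ∀ l, 0 ≤ l → inner ℝ (massOp ε μ w) (scalarOp (linfOf (expWeight a R δ l)) w) / 2
      ≤ Real.exp (l * b) * (A + l * B)) : VanishesOnBall w a r := by
  obtain ⟨α, hα, hle⟩ := exists_le_energyDensity hε hμ
  have hq : Integrable fun x : Space => ∑ i, w i x * w i x :=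
    integrable_finsetSum _ fun i _ => integrable_coe_mul _ _
  have hq0 : ∀ x : Space, 0 ≤ ∑ i, w i x * w i x := fun x =>
    Finset.sum_nonneg fun i _ => mul_self_nonneg _
  set I := ∫ x in Metric.ball a r, ∑ i, w i x * w i x with hI
  have hbound : ∀ y, 1 ≤ y → α * I ≤ 2 * (A * (y ^ 0 * Real.exp (-y))
      + B / η * (y ^ 1 * Real.exp (-y))) := by
    intro y hy
    -- with this rate the weight exceeds `exp (l b)` by the factor `exp y` on the smaller ball
    set l := y / η with hl
    have hl0 : 0 ≤ l := div_nonneg (by linarith) hη.le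
    have hlη : l * η = y := div_mul_cancel₀ _ hη.ne'
    have hψ := memLp_expWeight a R hδ hl0
    have hi2 : Integrable fun x => expWeight a R δ l x * energyDensity ε μ w x := by
      refine (integrable_linf_mul (linfOf (expWeight a R δ l))
        (integrable_energyDensity hε hμ w)).congr ?_
      filter_upwards [coeFn_linfOf hψ] with x hx
      rw [hx]
    have h1 : ∫ x in Metric.ball a r, Real.exp (l * (b + η)) * (α * ∑ i, w i x * w i x)
        ≤ ∫ x : Space, expWeight a R δ l x * energyDensity ε μ w x := by
      rw [← integral_indicator measurableSet_ball]
      refine integral_mono_ae (((hq.const_mul α).const_mul _).indicator measurableSet_ball) hi2 ?_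
      filter_upwards [hle w] with x hx
      have hx0 : 0 ≤ α * ∑ i, w i x * w i x := mul_nonneg hα.le (hq0 x)
      by_cases hxb : x ∈ Metric.ball a r
      · rw [indicator_of_mem hxb]
        rw [Metric.mem_ball] at hxb
        have hd : b + η ≤ R - smoothDist a δ x := by linarith [smoothDist_le a hδ.le x]
        have hd2 := mul_le_mul_of_nonneg_left hd hl0
        have hd3 : 1 ≤ l * (b + η) := by
          rw [mul_add, hlη]; linarith [mul_nonneg hl0 hb]
        have hw : Real.exp (l * (b + η)) ≤ expWeight a R δ l x := by
          rw [expWeight, expProfile_of_one_le (hd3.trans hd2)]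
          exact Real.exp_le_exp.2 hd2
        exact mul_le_mul hw hx hx0 (expWeight_nonneg _ _ _ _ _)
      · rw [indicator_of_notMem hxb]
        exact mul_nonneg (expWeight_nonneg _ _ _ _ _) (hx0.trans hx)
    rw [integral_const_mul, integral_const_mul, ← inner_massOp_scalarOp hε hμ hψ, ← hI,
      mul_add l, hlη, Real.exp_add] at h1
    have h2 := h l hl0
    have h3 : Real.exp (l * b) * (Real.exp y * (α * I)) ≤ Real.exp (l * b) * (2 * (A + l * B)) := by
      linarith
    have h4 := le_of_mul_le_mul_left h3 (Real.exp_pos _)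
    have h5 := mul_le_mul_of_nonneg_left h4 (Real.exp_pos (-y)).le
    rw [← mul_assoc, ← Real.exp_add, neg_add_cancel, Real.exp_zero, one_mul] at h5
    refine h5.trans (le_of_eq ?_)
    rw [hl]
    field_simp
  have hlim : Tendsto (fun y : ℝ => 2 * (A * (y ^ 0 * Real.exp (-y))
      + B / η * (y ^ 1 * Real.exp (-y)))) atTop (𝓝 0) := by
    have := (((Real.tendsto_pow_mul_exp_neg_atTop_nhds_zero 0).const_mul A).add
      ((Real.tendsto_pow_mul_exp_neg_atTop_nhds_zero 1).const_mul (B / η))).const_mul 2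
    simpa using this
  have hI0 : α * I ≤ 0 := ge_of_tendsto hlim (eventually_ge_atTop 1 |>.mono hbound)
  have hI1 : I = 0 := le_antisymm (by nlinarith) (integral_nonneg hq0)
  rw [hI, setIntegral_eq_zero_iff_of_nonneg_ae (Eventually.of_forall hq0) hq.integrableOn] at hI1
  filter_upwards [hI1] with x hx i
  have := (Finset.sum_eq_zero_iff_of_nonneg fun i _ => mul_self_nonneg (w i x)).1 hx i
    (Finset.mem_univ i)
  exact mul_self_eq_zero.1 this

theorem VanishesOnBall.mono {w : FieldSpace} {a : Space} {r r' : ℝ} (h : VanishesOnBall w a r)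
    (hr : r' ≤ r) : VanishesOnBall w a r' :=
  ae_restrict_of_ae_restrict_of_subset (Metric.ball_subset_ball hr) h

/-- The operator of restriction to a ball. -/
def ballCutoff (a : Space) (r : ℝ) : FieldSpace →L[ℝ] FieldSpace :=
  scalarOp (linfOf ((Metric.ball a r).indicator 1))

theorem vanishesOnBall_iff {w : FieldSpace} {a : Space} {r : ℝ} :
    VanishesOnBall w a r ↔ ballCutoff a r w = 0 := by
  have hm : MemLp ((Metric.ball a r).indicator (1 : Space → ℝ)) ⊤ (volume : Measure Space) :=
    MemLp.indicator measurableSet_ball (memLp_top_const 1)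
  have hc : ∀ᵐ x : Space, ∀ i, ballCutoff a r w i x = (Metric.ball a r).indicator 1 x * w i x := by
    filter_upwards [coeFn_scalarOp (linfOf ((Metric.ball a r).indicator 1)) w, coeFn_linfOf hm]
      with x h1 h2 i
    rw [ballCutoff, h1, h2]
  have h0 : ∀ᵐ x : Space, ∀ i, (0 : FieldSpace) i x = 0 :=
    ae_all_iff.2 fun i => Lp.coeFn_zero ℝ 2 volume
  rw [VanishesOnBall, ae_restrict_iff' measurableSet_ball]
  constructor
  · intro h
    apply field_ext
    filter_upwards [h, hc, h0] with x h1 h2 h3 i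
    rw [h2, h3]
    by_cases hx : x ∈ Metric.ball a r
    · rw [h1 hx, mul_zero]
    · rw [indicator_of_notMem hx, zero_mul]
  · intro h
    rw [h] at hc
    filter_upwards [hc, h0] with x h2 h3 hx i
    have := h2 i
    rwa [h3, indicator_of_mem hx, Pi.one_apply, one_mul, eq_comm] at this

theorem VanishesOnBall.add {v w : FieldSpace} {a : Space} {r : ℝ} (hv : VanishesOnBall v a r)
    (hw : VanishesOnBall w a r) : VanishesOnBall (v + w) a r := by
  rw [vanishesOnBall_iff] at *
  rw [map_add, hv, hw, add_zero]

theorem VanishesOnBall.smul {w : FieldSpace} {a : Space} {r : ℝ} (t : ℝ)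
    (hw : VanishesOnBall w a r) : VanishesOnBall (t • w) a r := by
  rw [vanishesOnBall_iff] at *
  rw [map_smul, hw, smul_zero]

theorem VanishesOnBall.massOp {w : FieldSpace} {a : Space} {r : ℝ} (hw : VanishesOnBall w a r)
    (ε μ : Space → Matrix (Fin 3) (Fin 3) ℝ) : VanishesOnBall (massOp ε μ w) a r := by
  rw [vanishesOnBall_iff] at *
  rw [ballCutoff] at *
  rw [← massOp_scalarOp, hw, map_zero]

theorem VanishesOnBall.primitive {g : ℝ → FieldSpace} {a : Space} {r t : ℝ}
    (hg : IntervalIntegrable g volume 0 t) (h : ∀ᵐ s, s ∈ uIoc 0 t → VanishesOnBall (g s) a r) :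
    VanishesOnBall (primitive g t) a r := by
  rw [vanishesOnBall_iff, map_primitive _ hg]
  apply intervalIntegral.integral_zero_ae
  filter_upwards [h] with s hs hst
  exact vanishesOnBall_iff.1 (hs hst)

/-- The derivative in time of fields which vanish on a fixed ball vanishes on it. -/
theorem VanishesOnBall.of_hasDerivAt {g : ℝ → FieldSpace} {g' : FieldSpace} {a : Space} {r t : ℝ}
    (hg : HasDerivAt g g' t) (h : ∀ᶠ s in 𝓝 t, VanishesOnBall (g s) a r) :
    VanishesOnBall g' a r := by
  rw [vanishesOnBall_iff]
  have h1 : HasDerivAt (fun s => ballCutoff a r (g s)) (ballCutoff a r g') t :=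
    (ballCutoff a r).hasFDerivAt.comp_hasDerivAt t hg
  have h2 : (fun s => ballCutoff a r (g s)) =ᶠ[𝓝 t] fun _ => 0 :=
    h.mono fun s hs => vanishesOnBall_iff.1 hs
  exact h1.unique ((hasDerivAt_const t (0 : FieldSpace)).congr_of_eventuallyEq h2)

/-- A ball is the union of the smaller concentric balls of rational radius. -/
theorem vanishesOnBall_of_forall_rat {w : FieldSpace} {a : Space} {r : ℝ}
    (h : ∀ q : ℚ, (q : ℝ) < r → VanishesOnBall w a q) : VanishesOnBall w a r := by
  have h1 : ∀ᵐ x : Space, ∀ q : ℚ, (q : ℝ) < r → x ∈ Metric.ball a (q : ℝ) → ∀ i, w i x = 0 := by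
    refine ae_all_iff.2 fun q => ?_
    by_cases hq : (q : ℝ) < r
    · filter_upwards [(ae_restrict_iff' measurableSet_ball).1 (h q hq)] with x hx _ using hx
    · exact Eventually.of_forall fun x hx => absurd hx hq
  rw [VanishesOnBall, ae_restrict_iff' measurableSet_ball]
  filter_upwards [h1] with x hx hxr
  obtain ⟨q, hq1, hq2⟩ := exists_rat_btwn (Metric.mem_ball.1 hxr)
  exact hx q hq2 (Metric.mem_ball.2 hq1)

/-! ### Finite speed of propagation -/

/-- The second primitive is unbounded in time, but its convolution with the kernel is the primitive
of that of the first primitive, which is bounded. -/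
theorem continuous_timeConv_primitive_primitive {K : ℝ → FieldSpace →L[ℝ] FieldSpace}
    (hK : Integrable K) (hK0 : ∀ t < 0, K t = 0) {w : ℝ → FieldSpace} (hw : Integrable w)
    (hw0 : ∀ t ≤ 0, w t = 0) : Continuous (timeConv K (primitive (primitive w))) := by
  have hUc := continuous_primitive hw
  have h : timeConv K (primitive (primitive w)) = primitive (timeConv K (primitive w)) := by
    ext1 t
    exact (integral_timeConv hK hK0 hUc.aestronglyMeasurable
      (Eventually.of_forall (norm_primitive_le hw)) (fun t ht => primitive_of_nonpos hw0 ht) t).symm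
  rw [h]
  exact continuous_iff_continuousAt.2 fun t => (hasDerivAt_primitive
    (continuous_timeConv hK hUc (norm_primitive_le hw)) t).continuousAt

/-- The second primitive of the solution vanishes in the cone `|x - a| < R - c t`. -/
theorem IsWeakSolution.vanishesOnBall_primitive_primitive
    {ε μ : Space → Matrix (Fin 3) (Fin 3) ℝ}
    (hε : IsUniformlyElliptic ε) (hμ : IsUniformlyElliptic μ)
    {R : ℝ} {a : Space} {T : ℝ} (hc : 0 < speed ε μ a R) (hT : R / speed ε μ a R < T)
    {u₀ : FieldSpace} {f : ℝ → FieldSpace} (hf : IntegrableOn f (Ioo 0 T) volume)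
    {Λ : Idx → Idx → ℝ → RealLinf} {Λhat : Idx → Idx → ℝ → ComplexLinf}
    (hΛ : ∀ i j, LocallyIntegrable (Λ i j) volume)
    (hΛhat : ∀ i j, LocallyIntegrable (Λhat i j) volume)
    (hfourier : ∀ i j, IsFourierTransform (complexify (Λ i j)) (Λhat i j))
    (hcausal : IsCausal Λ) (hpassive : IsPassive Λhat)
    (hu₀ : VanishesOnBall u₀ a R)
    (hf₀ : ∀ᵐ t ∂(volume.restrict (Ioo 0 (R / speed ε μ a R))),
      VanishesOnBall (f t) a (R - speed ε μ a R * t))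
    {u : ℝ → FieldSpace} (hu : IsWeakSolution ε μ Λ T u₀ f u)
    {s r : ℝ} (hs : 0 < s) (hsr : speed ε μ a R * s < R - r) (hsR : s < R / speed ε μ a R) :
    VanishesOnBall (primitive (primitive ((Ioo 0 T).indicator u)) s) a r := by
  have hsT : s < T := hsR.trans hT
  have hT0 : 0 < T := hs.trans hsT
  have hwi : Integrable ((Ioo 0 T).indicator u) :=
    (integrable_indicator_iff measurableSet_Ioo).2 (hu.memLp.integrable le_top)
  have hFi : Integrable ((Ioo 0 T).indicator f) := (integrable_indicator_iff measurableSet_Ioo).2 hf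
  have heq := fun t (ht : t ∈ Icc 0 s) v Av (hv : HasMaxwell v Av) =>
    hu.integrated_twice hε hμ hT0 hf hΛ hv ⟨ht.1, ht.2.trans hsT.le⟩
  have hw0 : ∀ t ≤ 0, (Ioo 0 T).indicator u t = 0 := fun t ht =>
    indicator_of_notMem (fun h => not_lt.2 ht h.1) _
  have hFv : ∀ᵐ t : ℝ, t ∈ Ioo 0 (R / speed ε μ a R) →
      VanishesOnBall ((Ioo 0 T).indicator f t) a (R - speed ε μ a R * t) := by
    filter_upwards [(ae_restrict_iff' measurableSet_Ioo).1 hf₀] with t ht htm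
    rw [indicator_of_mem (show t ∈ Ioo 0 T from ⟨htm.1, htm.2.trans hT⟩)]
    exact ht htm
  have hK := integrable_memoryKernel hΛ T
  have hNc := continuous_timeConv_primitive_primitive hK
    (fun t ht => memoryKernel_of_nonpos Λ T ht.le) hwi hw0
  set w := (Ioo 0 T).indicator u
  set F := (Ioo 0 T).indicator f
  set c := speed ε μ a R with hcdef
  have hUc := continuous_primitive hwi
  have hFc := continuous_primitive hFi
  have hWd : ∀ t, HasDerivAt (primitive (primitive w)) (primitive w t) t := hasDerivAt_primitive hUc
  have hWc : Continuous (primitive (primitive w)) :=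
    continuous_iff_continuousAt.2 fun t => (hWd t).continuousAt
  have hFFc : Continuous (primitive (primitive F)) :=
    continuous_iff_continuousAt.2 fun t => (hasDerivAt_primitive hFc t).continuousAt
  have hGc : Continuous fun t => t • massOp ε μ u₀ + primitive (primitive F) t := by fun_prop
  have hGv : ∀ t ∈ Icc 0 s,
      VanishesOnBall (t • massOp ε μ u₀ + primitive (primitive F) t) a (R - c * t) := by
    intro t ht
    refine VanishesOnBall.add (((hu₀.mono ?_).massOp ε μ).smul t)
      (VanishesOnBall.primitive (hFc.intervalIntegrable 0 t) (Eventually.of_forall fun r hr => ?_))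
    · linarith [mul_nonneg hc.le ht.1]
    · rw [uIoc_of_le ht.1] at hr
      refine VanishesOnBall.primitive hFi.intervalIntegrable ?_
      filter_upwards [hFv] with q hq hqm
      rw [uIoc_of_le hr.1.le] at hqm
      have hqt : q ≤ t := hqm.2.trans hr.2
      refine (hq ⟨hqm.1, (hqt.trans ht.2).trans_lt hsR⟩).mono ?_
      linarith [mul_le_mul_of_nonneg_left hqt hc.le]
  obtain ⟨B, hB⟩ := (isCompact_Icc (a := 0) (b := s)).exists_bound_of_continuousOn
    (f := fun t => (‖t • massOp ε μ u₀ + primitive (primitive F) t‖ ^ 2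
      + ‖primitive (primitive w) t‖ ^ 2) / 2)
    (((hGc.norm.pow 2).add (hWc.norm.pow 2)).div_const 2).continuousOn
  obtain ⟨B', hB'⟩ := (isCompact_Icc (a := 0) (b := s)).exists_bound_of_continuousOn
    (f := fun t => inner ℝ (massOp ε μ (primitive (primitive w) t)) (primitive (primitive w) t))
    (((massOp ε μ).continuous.comp hWc).inner hWc).continuousOn
  obtain ⟨C, hC0, hC⟩ := exists_abs_deriv_expProfile_le
  -- the gap between `r` and `R - c s` is shared by the smoothing `δ` and the gain `η` of the rate
  set δ := (R - c * s - r) / 2 with hδ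
  have hδ0 : 0 < δ := by rw [hδ]; linarith
  refine vanishesOnBall_of_weighted_energy_le hε hμ (R := R) (δ := δ) (η := δ) (b := c * s)
    (A := s * B) (B := s * (c * (C * B' / 2))) hδ0 hδ0 (by positivity) (by rw [hδ]; linarith)
    fun l hl => ?_
  refine (energy_le hε hμ hδ0 hl hC0 hC hc.le hs.le hWd (primitive_zero _) hNc heq hGv
    (fun t ht => ?_) (fun t ht => (Real.le_norm_self _).trans (hB t ht))
    (fun t ht => (Real.le_norm_self _).trans (hB' t ht))).trans (le_of_eq ?_)
  · refine integral_inner_memoryKernel_weight_nonneg hΛ hΛhat hfourier hcausal hpassive ht.1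
      (ht.2.trans_lt hsT) hWc (fun t ht => primitive_of_nonpos
        (fun t ht => primitive_of_nonpos hw0 ht) ht)
      (χ := linfOf fun x => Real.sqrt (expWeight a R δ l x)) ?_
    filter_upwards [coeFn_linfOf (memLp_expWeight a R hδ0 hl),
      coeFn_linfOf (memLp_sqrt_expWeight a R hδ0 hl)] with x h1 h2
    rw [h1, h2, Real.mul_self_sqrt (expWeight_nonneg _ _ _ _ _)]
  · rw [← hcdef, mul_assoc l c s]
    ring

end Maxwell

end

open Maxwell
/-- Finite speed of propagation for Maxwell's equations in dispersive bi-anisotropic media. -/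
theorem theorem2
    (ε μ : Space → Matrix (Fin 3) (Fin 3) ℝ)
    (hε : IsUniformlyElliptic ε) (hμ : IsUniformlyElliptic μ)
    (R : ℝ) (hR : 0 < R) (a : Space)
    (T : ℝ) (hT : R / speed ε μ a R < T)
    (u₀ : FieldSpace)
    (f : ℝ → FieldSpace) (hf : IntegrableOn f (Ioo 0 T) volume)
    (Λ : Idx → Idx → ℝ → RealLinf)
    (Λhat : Idx → Idx → ℝ → ComplexLinf)
    (hΛ : ∀ i j, LocallyIntegrable (Λ i j) volume)
    (hΛhat : ∀ i j, LocallyIntegrable (Λhat i j) volume)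
    (hfourier : ∀ i j, IsFourierTransform (complexify (Λ i j)) (Λhat i j))
    (hcausal : IsCausal Λ)
    (hpassive : IsPassive Λhat)
    (hu₀ : VanishesOnBall u₀ a R)
    (hf₀ : ∀ᵐ t ∂(volume.restrict (Ioo 0 (R / speed ε μ a R))),
      VanishesOnBall (f t) a (R - speed ε μ a R * t))
    (u : ℝ → FieldSpace) (hu : IsWeakSolution ε μ Λ T u₀ f u) :
    ∀ᵐ t ∂(volume.restrict (Ioo 0 (R / speed ε μ a R))),
      VanishesOnBall (u t) a (R - speed ε μ a R * t) := by
  rcases le_or_gt (speed ε μ a R) 0 with hc | hc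
  · -- a nonpositive speed leaves no times to consider
    rw [Ioo_eq_empty (not_lt.2 (div_nonpos_of_nonneg_of_nonpos hR.le hc)), Measure.restrict_empty]
    simp
  have hwi : Integrable ((Ioo 0 T).indicator u) :=
    (integrable_indicator_iff measurableSet_Ioo).2 (hu.memLp.integrable le_top)
  have hW : ∀ q s : ℝ, s ∈ Ioo 0 (R / speed ε μ a R) → q < R - speed ε μ a R * s →
      ∀ᶠ t in nhds s, VanishesOnBall (primitive (primitive ((Ioo 0 T).indicator u)) t) a q := by
    intro q s hs hq
    have h1 : ∀ᶠ t in nhds s, q < R - speed ε μ a R * t :=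
      (ContinuousAt.eventually_lt (by fun_prop) (by fun_prop) hq)
    filter_upwards [h1, Ioo_mem_nhds hs.1 hs.2] with t ht htm
    exact hu.vanishesOnBall_primitive_primitive hε hμ hc hT hf hΛ hΛhat hfourier hcausal hpassive
      hu₀ hf₀ htm.1 (by linarith) htm.2
  have hU : ∀ q s : ℝ, s ∈ Ioo 0 (R / speed ε μ a R) → q < R - speed ε μ a R * s →
      ∀ᶠ t in nhds s, VanishesOnBall (primitive ((Ioo 0 T).indicator u) t) a q := by
    intro q s hs hq
    have h1 : ∀ᶠ t in nhds s, q < R - speed ε μ a R * t :=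
      (ContinuousAt.eventually_lt (by fun_prop) (by fun_prop) hq)
    filter_upwards [h1, Ioo_mem_nhds hs.1 hs.2] with t ht htm
    exact VanishesOnBall.of_hasDerivAt (hasDerivAt_primitive (continuous_primitive hwi) t)
      (hW q t htm ht)
  rw [ae_restrict_iff' measurableSet_Ioo]
  filter_upwards [_root_.LocallyIntegrable.ae_hasDerivAt_integral hwi.locallyIntegrable] with t ht htm
  -- countably many balls exhaust `B(a, R - c t)`, with one null set of times for all of them
  refine vanishesOnBall_of_forall_rat fun q hq => ?_
  have h := VanishesOnBall.of_hasDerivAt (ht 0) (hU q t htm hq)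
  rwa [indicator_of_mem (show t ∈ Ioo 0 T from ⟨htm.1, htm.2.trans hT⟩)] at h
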